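/- Let $\Theta=(\theta_i)_{i\ge 0}$ be a sequence of nonnegative reals with $\sum_{i\ge 0}\theta_i^2=1$, $\theta_1\ge\theta_2\ge\cdots$, and $\theta_0\neq 0$ or $\sum_{i\ge 1}\theta_i=\infty$. The $\Theta$-ICRT (inhomogeneous continuum random tree) $\mathcal T$ is constructed as follows. Let $(X_i)_{i\ge 1}$ be independent, $X_i$ exponential of parameter $\theta_i$ (a term with $\theta_i=0$ is ignored), and let $\mu=\theta_0^2\,dx+\sum_{i\ge 1}\theta_i\delta_{X_i}$, a random measure on $\mathbb R^+=[0,\infty)$. Given $\mu$, let $Y_1<Y_2<\cdots$ be a Poisson point process on $\mathbb R^+$ of rate $\mu[0,l]\,dl$. Given $\mu$ and $(Y_i)$, let $(Z_i)_{i\ge 1}$ be independent, $Z_i$ having law $\mu(\cdot\cap[0,Y_i])/\mu[0,Y_i]$. Put $Y_0=Z_0=0$. Almost surely $0\le Z_i\le Y_i$ for all $i$ and $Y_i\to\infty$, and there is a unique metric $d$ on $\mathbb R^+$ such that, for all $n\ge 0$ and $0\le x\le y\le Y_{n+1}$ with $y>Y_n$, $d(x,y)=d(x,Z_n)+y-Y_n$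 if $x\le Y_n$, and $d(x,y)=y-x$ if $x>Y_n$. Then $\mathcal T$ is the completion of $(\mathbb R^+,d)$. For $l\ge 0$ let $\mathcal T_l\subset\mathcal T$ be the subset $[0,l]$. Theorem. (a) $\mathcal T$ is almost surely compact if and only if $$\int_1^\infty \frac{dl}{l\,\mathbb E[\mu[0,l]]}<\infty .$$ (b) For every $l\ge 0$ there is a unique real $\mathcal X_l\ge 0$ with $\mathbb E[\mu[0,\mathcal X_l]]=l$. There are constants $c,C\in(0,\infty)$, not depending on $\Theta$, such that almost surely, for all integers $k$ large enough, $$c\sum_{n>k}\frac{\log \mathcal X_{2^n}}{2^n}\;\le\; d_H(\mathcal T,\mathcal T_{\mathcal X_{2^k}})\;\le\; C\sum_{n>k}\frac{\log \mathcal X_{2^n}}{2^n},$$ where $d_H$ is the Hausdorff distance in $\mathcal T$ and both sides may be $+\infty$. -/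

import Mathlib

open MeasureTheory ProbabilityTheory Set Filter Topology
open scoped ENNReal NNReal

namespace ICRT

/-! ### The deterministic stick-breaking construction

A sequence `y : ℕ → ℝ` stands for the cuts `y₁, y₂, …` (so `y i` is the cut of index `i + 1`), and
likewise `z : ℕ → ℝ` for the glue points `z₁, z₂, …`. -/

/-- The admissible inputs of the construction: sequences in `ℝ⁺`, with strictly increasing cuts that
tend to infinity, each glue point lying below the corresponding cut. -/
structure IsStickData (y z : ℕ → ℝ) : Prop where
  cut_nonneg : ∀ i, 0 ≤ y i
  strictMono : StrictMono y
  tendsto : Tendsto y atTop atTop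
  glue_nonneg : ∀ i, 0 ≤ z i
  glue_le : ∀ i, z i ≤ y i

/-- The sequence `0, y₁, y₂, …`, following the convention `y₀ = 0`, `z₀ = 0`. -/
def withZero (y : ℕ → ℝ) : ℕ → ℝ
  | 0 => 0
  | n + 1 => y n

/-- The distance `dₙ` on `[0, yₙ]` (only its values on that interval matter): the segment
`(yₙ, yₙ₊₁]` is glued at the point `zₙ`. -/
noncomputable def stickDist (y z : ℕ → ℝ) : ℕ → ℝ → ℝ → ℝ
  | 0, _, _ => 0
  | n + 1, a, b =>
    if max a b ≤ withZero y n then stickDist y z n a b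
    else if min a b ≤ withZero y n then
      stickDist y z n (min a b) (withZero z n) + (max a b - withZero y n)
    else |a - b|

/-- The distance `d` on `ℝ⁺` which agrees with `dₙ` on `[0, yₙ]` for all `n`: it is computed with the
first `n` such that both points lie in `[0, yₙ]`. -/
noncomputable def lineDist (y z : ℕ → ℝ) (a b : ℝ) : ℝ :=
  stickDist y z (sInf {n | max a b ≤ withZero y n}) a b

section Metric

variable {y z : ℕ → ℝ}

theorem withZero_mono (h : IsStickData y z) : Monotone (withZero y) := by
  refine monotone_nat_of_le_succ fun n => ?_
  cases n with
  | zero => exact h.cut_nonneg 0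
  | succ n => exact (h.strictMono (Nat.lt_succ_self n)).le

theorem withZero_glue (h : IsStickData y z) (n : ℕ) :
    0 ≤ withZero z n ∧ withZero z n ≤ withZero y n := by
  cases n with
  | zero => simp [withZero]
  | succ n => exact ⟨h.glue_nonneg n, h.glue_le n⟩

theorem stickDist_comm (n : ℕ) (a b : ℝ) : stickDist y z n a b = stickDist y z n b a := by
  induction n generalizing a b with
  | zero => rfl
  | succ n ih => simp only [stickDist, max_comm a b, min_comm a b, abs_sub_comm a b, ih a b]

theorem stickDist_old {n : ℕ} {a b : ℝ} (ha : a ≤ withZero y n) (hb : b ≤ withZero y n) :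
    stickDist y z (n + 1) a b = stickDist y z n a b := by
  simp [stickDist, ha, hb]

theorem stickDist_mid {n : ℕ} {a b : ℝ} (ha : a ≤ withZero y n) (hb : withZero y n < b) :
    stickDist y z (n + 1) a b
      = stickDist y z n a (withZero z n) + (b - withZero y n) := by
  have hab : a ≤ b := ha.trans hb.le
  simp [stickDist, ha, hb.not_ge, hab]

theorem stickDist_new {n : ℕ} {a b : ℝ} (ha : withZero y n < a) (hb : withZero y n < b) :
    stickDist y z (n + 1) a b = |a - b| := by
  simp [stickDist, ha.not_ge, hb.not_ge]

theorem stickDist_metric (h : IsStickData y z) (n : ℕ) :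
    (∀ a, stickDist y z n a a = 0) ∧
    (∀ a ∈ Icc 0 (withZero y n), ∀ b ∈ Icc 0 (withZero y n),
      0 ≤ stickDist y z n a b ∧ (stickDist y z n a b = 0 → a = b) ∧
      ∀ c ∈ Icc 0 (withZero y n),
        stickDist y z n a c ≤ stickDist y z n a b + stickDist y z n b c) := by
  induction n with
  | zero =>
    refine ⟨fun _ => rfl, fun a ha b hb => ⟨le_rfl, fun _ => ?_, fun c _ => ?_⟩⟩
    · have h1 : a ≤ 0 := ha.2
      have h2 : b ≤ 0 := hb.2
      linarith [ha.1, hb.1]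
    · simp [stickDist]
  | succ n ih =>
    obtain ⟨hself, ih⟩ := ih
    have hz : withZero z n ∈ Icc 0 (withZero y n) := withZero_glue h n
    refine ⟨fun a => ?_, fun a ha b hb => ?_⟩
    · by_cases ha : a ≤ withZero y n
      · rw [stickDist_old ha ha, hself]
      · rw [stickDist_new (not_le.1 ha) (not_le.1 ha)]; simp
    · rcases le_or_gt a (withZero y n) with ha' | ha' <;>
        rcases le_or_gt b (withZero y n) with hb' | hb'
      · rw [stickDist_old ha' hb']
        obtain ⟨h0, h1, h2⟩ := ih a ⟨ha.1, ha'⟩ b ⟨hb.1, hb'⟩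
        refine ⟨h0, h1, fun c hc => ?_⟩
        rcases le_or_gt c (withZero y n) with hc' | hc'
        · rw [stickDist_old ha' hc', stickDist_old hb' hc']
          exact h2 c ⟨hc.1, hc'⟩
        · rw [stickDist_mid ha' hc', stickDist_mid hb' hc']
          linarith [h2 _ hz]
      · rw [stickDist_mid ha' hb']
        obtain ⟨h0, h1, h2⟩ := ih a ⟨ha.1, ha'⟩ _ hz
        refine ⟨by linarith, fun h3 => by linarith, fun c hc => ?_⟩
        rcases le_or_gt c (withZero y n) with hc' | hc'
        · rw [stickDist_old ha' hc', stickDist_comm (n + 1) b c, stickDist_mid hc' hb',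
            stickDist_comm n c]
          linarith [h2 c ⟨hc.1, hc'⟩]
        · rw [stickDist_mid ha' hc', stickDist_new hb' hc']
          linarith [neg_abs_le (b - c)]
      · rw [stickDist_comm, stickDist_mid hb' ha']
        obtain ⟨h0, h1, h2⟩ := ih b ⟨hb.1, hb'⟩ _ hz
        refine ⟨by linarith, fun h3 => by linarith, fun c hc => ?_⟩
        rcases le_or_gt c (withZero y n) with hc' | hc'
        · rw [stickDist_comm (n + 1) a c, stickDist_mid hc' ha', stickDist_old hb' hc']
          have h3 := (ih c ⟨hc.1, hc'⟩ b ⟨hb.1, hb'⟩).2.2 _ hz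
          rw [stickDist_comm n c b] at h3
          linarith
        · rw [stickDist_new ha' hc', stickDist_mid hb' hc']
          exact abs_le.2 ⟨by linarith, by linarith⟩
      · rw [stickDist_new ha' hb']
        refine ⟨abs_nonneg _, fun h3 => by linarith [abs_eq_zero.1 h3], fun c hc => ?_⟩
        rcases le_or_gt c (withZero y n) with hc' | hc'
        · rw [stickDist_comm (n + 1) a c, stickDist_comm (n + 1) b c, stickDist_mid hc' ha',
            stickDist_mid hc' hb']
          linarith [le_abs_self (a - b)]
        · rw [stickDist_new ha' hc', stickDist_new hb' hc']
          exact abs_sub_le a b c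

theorem stickDist_stable (h : IsStickData y z) {m n : ℕ} (hmn : m ≤ n) {a b : ℝ}
    (ha : a ≤ withZero y m) (hb : b ≤ withZero y m) :
    stickDist y z n a b = stickDist y z m a b := by
  induction n, hmn using Nat.le_induction with
  | base => rfl
  | succ k hk ih =>
    rw [stickDist_old (ha.trans (withZero_mono h hk)) (hb.trans (withZero_mono h hk)), ih]

/-- `d` agrees with `dₙ` on `[0, yₙ]`. -/
theorem lineDist_eq (h : IsStickData y z) {n : ℕ} {a b : ℝ}
    (ha : a ≤ withZero y n) (hb : b ≤ withZero y n) :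
    lineDist y z a b = stickDist y z n a b := by
  have hn : n ∈ {n | max a b ≤ withZero y n} := max_le ha hb
  have hm := Nat.sInf_mem ⟨n, hn⟩
  exact (stickDist_stable h (Nat.sInf_le hn) ((le_max_left a b).trans hm)
    ((le_max_right a b).trans hm)).symm

theorem exists_le_withZero (h : IsStickData y z) (a : ℝ) : ∃ n, a ≤ withZero y n := by
  obtain ⟨n, hn⟩ := (h.tendsto.eventually_ge_atTop a).exists
  exact ⟨n + 1, hn⟩

end Metric

/-- The half-line `ℝ⁺`, to be equipped with the distance `d`. -/
structure Line {y z : ℕ → ℝ} (h : IsStickData y z) where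
  /-- The underlying nonnegative real number. -/
  val : ℝ≥0

/-- The metric space `(ℝ⁺, d)`. -/
noncomputable instance {y z : ℕ → ℝ} (h : IsStickData y z) : MetricSpace (Line h) where
  dist a b := lineDist y z a.val b.val
  dist_self a := by
    obtain ⟨n, hn⟩ := exists_le_withZero h a.val
    rw [lineDist_eq h hn hn, (stickDist_metric h n).1]
  dist_comm a b := by
    obtain ⟨n, hn⟩ := exists_le_withZero h (max a.val b.val : ℝ)
    have ha := (le_max_left _ _).trans hn
    have hb := (le_max_right _ _).trans hn
    rw [lineDist_eq h ha hb, lineDist_eq h hb ha, stickDist_comm]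
  dist_triangle a b c := by
    obtain ⟨n, hn⟩ := exists_le_withZero h (max (max a.val b.val : ℝ) c.val)
    have ha := ((le_max_left _ _).trans (le_max_left _ _)).trans hn
    have hb := ((le_max_right _ _).trans (le_max_left _ _)).trans hn
    have hc := (le_max_right _ _).trans hn
    rw [lineDist_eq h ha hb, lineDist_eq h hb hc, lineDist_eq h ha hc]
    exact ((stickDist_metric h n).2 _ ⟨a.val.2, ha⟩ _ ⟨b.val.2, hb⟩).2.2 _ ⟨c.val.2, hc⟩
  eq_of_dist_eq_zero := by
    rintro ⟨a⟩ ⟨b⟩ hab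
    obtain ⟨n, hn⟩ := exists_le_withZero h (max a b : ℝ)
    have ha := (le_max_left _ _).trans hn
    have hb := (le_max_right _ _).trans hn
    have hab' : lineDist y z a b = 0 := hab
    rw [lineDist_eq h ha hb] at hab'
    have := ((stickDist_metric h n).2 _ ⟨a.2, ha⟩ _ ⟨b.2, hb⟩).2.1 hab'
    rw [NNReal.coe_injective this]

/-- The tree `SB(y, z)`: the completion of `(ℝ⁺, d)`. -/
abbrev SB {y z : ℕ → ℝ} (h : IsStickData y z) : Type := UniformSpace.Completion (Line h)

/-- The subset `𝒯_l = [0, l]` of the tree. -/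
def subtree {y z : ℕ → ℝ} (h : IsStickData y z) (l : ℝ) : Set (SB h) :=
  (fun a : Line h => (a : SB h)) '' {a | (a.val : ℝ) ≤ l}

/-! ### The parameters and the random data -/

/-- The parameter space: nonnegative sequences `θ₀, θ₁, θ₂, …` with `∑_{i ≥ 0} θᵢ² = 1`,
`θ₁ ≥ θ₂ ≥ …`, and `θ₀ ≠ 0` or `∑_{i ≥ 1} θᵢ = ∞`. -/
structure IsParameter (θ : ℕ → ℝ) : Prop where
  nonneg : ∀ i, 0 ≤ θ i
  hasSum_sq : HasSum (fun i => θ i ^ 2) 1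
  antitone : Antitone fun i => θ (i + 1)
  ne_zero_or : θ 0 ≠ 0 ∨ ¬ Summable fun i => θ (i + 1)

/-- The measure `μ = θ₀² dx + ∑_{i ≥ 1} θᵢ δ_{Xᵢ}` on `ℝ⁺`; `x i` stands for `X_{i + 1}`. -/
noncomputable def mass (θ x : ℕ → ℝ) : Measure ℝ :=
  ENNReal.ofReal (θ 0 ^ 2) • volume.restrict (Ici 0) +
    Measure.sum fun i => ENNReal.ofReal (θ (i + 1)) • Measure.dirac (x i)

/-- The measure `μ[0, l] dl` on `ℝ⁺`. -/
noncomputable def cutIntensity (θ x : ℕ → ℝ) : Measure ℝ :=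
  (volume.restrict (Ici 0)).withDensity fun l => mass θ x (Icc 0 l)

/-- The number of points of the sequence `y` that lie in `A`. -/
noncomputable def count (A : Set ℝ) (y : ℕ → ℝ) : ℕ∞ := {i | y i ∈ A}.encard

/-- `Q` is the law of the increasing enumeration of a Poisson point process on `ℝ` of intensity
`Λ`: the number of points in a set of finite intensity is Poisson distributed, and the numbers of
points in disjoint sets are independent. -/
structure IsPoissonPointProcess (Q : Measure (ℕ → ℝ)) (Λ : Measure ℝ) : Prop where
  strictMono : ∀ᵐ y ∂Q, StrictMono y
  law_count : ∀ A, MeasurableSet A → Λ A ≠ ∞ →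
    Q.map (count A) = (poissonMeasure (Λ A).toNNReal).map (fun n : ℕ => (n : ℕ∞))
  indep_count : ∀ (n : ℕ) (A : Fin n → Set ℝ), (∀ i, MeasurableSet (A i)) →
    Pairwise (fun i j => Disjoint (A i) (A j)) → iIndepFun (fun i => count (A i)) Q

/-- The random data of the `Θ`-ICRT, `X i`, `Y i`, `Z i` standing for the variables of index `i + 1`:
* the `Xᵢ` are independent, exponential of parameter `θᵢ` (nothing is asked of the law of `Xᵢ` if
  `θᵢ = 0`, as the weight of the atom `Xᵢ` of `μ` is then zero);
* given `X`, the cuts `Y` form a Poisson point process of intensity `μ[0, l] dl`;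
* given `X` and `Y`, the glue points `Zᵢ` are independent, of respective laws
  `μ_{Yᵢ} / μ[0, Yᵢ]`, where `μ_l` is the restriction of `μ` to `[0, l]`. -/
structure IsICRTData {Ω : Type*} [MeasurableSpace Ω] (P : Measure Ω) [IsProbabilityMeasure P]
    (θ : ℕ → ℝ) (X Y Z : Ω → ℕ → ℝ) : Prop where
  measurable_X : Measurable X
  measurable_Y : Measurable Y
  measurable_Z : Measurable Z
  indep_X : iIndepFun (fun i ω => X ω i) P
  law_X : ∀ i, 0 < θ (i + 1) → P.map (fun ω => X ω i) = expMeasure (θ (i + 1))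
  law_Y : ∀ᵐ x ∂P.map X, IsPoissonPointProcess (condDistrib Y X P x) (cutIntensity θ x)
  law_Z : ∀ᵐ p ∂P.map (fun ω => (X ω, Y ω)),
    iIndepFun (fun i z => z i) (condDistrib Z (fun ω => (X ω, Y ω)) P p) ∧
    ∀ i, (condDistrib Z (fun ω => (X ω, Y ω)) P p).map (fun z => z i) =
      cond (mass θ p.1) (Icc 0 (p.2 i))

/-- The expectation `𝔼[μ[0, l]]`. -/
noncomputable def meanMass {Ω : Type*} [MeasurableSpace Ω] (P : Measure Ω) (θ : ℕ → ℝ)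
    (X : Ω → ℕ → ℝ) (l : ℝ) : ℝ≥0∞ :=
  ∫⁻ ω, mass θ (X ω) (Icc 0 l) ∂P

end ICRT

/-!
Write `q n = 𝒳(2ⁿ)`. The Hausdorff distance between the tree and its subtree `[0, q k]` is, up to
constants, the sum over the scales `n > k` of the height `log q n / 2ⁿ` which the sticks of scale
`n`, those that cover `(q (n - 1), q n]`, add to the subtree already built. As the mean mass is a
concave function which is at most the identity, `q n ≥ 2ⁿ` and the mass of `[0, q n]` has variance
at most `1`, so that it is comparable to `2ⁿ` almost surely for `n` large
(`IsAtomLaw.ae_mass_quantile`). At scale `n` the cuts are thus a Poisson process of rate about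
`2ⁿ`. The argument is quenched: it is almost sure in the atoms `X`, then in the cuts `Y` given
`X`, then in the glue points `Z` given `X` and `Y`, each time by the Borel–Cantelli lemma; the
three layers are put together in `IsICRTData.ae_regular`.

*Upper bound.* The longest of the polynomially many (in `q n`) sticks of scale `n` has length
`O(log q n / 2ⁿ)` (`ae_cellsHit`). A point of `(q n, q (n + 1)]` reaches `[0, q n]` along a path
of sticks of scale `n + 1`. Conditionally on the atoms and the cuts, the glue points are
independent, so that the exponential moment of order `2ⁿ / 8` of the length of the path is at
most a product over the sticks, and at most `e^(10n)` (`IsGlueLaw.lintegral_exp_climb_le`). A union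
bound over the cuts gives `IsGlueLaw.ae_climb_le`, and the sum over the scales is
`hausdorffEDist_le_tailSum`.

*Lower bound.* For `n` large, each interval `[2 q n, 2 q (n + 1)]` contains a scale `bₙ = uₙ¹⁶`
such that the window `(bₙ / 2, bₙ]` has mean mass at least `2ⁿ bₙ^(-1/16)`
(`exists_isWindowScale`): otherwise the mean mass could not double. The window is cut into blocks
of length of order `log bₙ / 2ⁿ`, so short that a block contains a stick of the order of its
length with probability at least `bₙ^(-1/16) / 2`. Hence there are many such sticks with enough
mass on their top third (`ae_card_cutBlocks`). If `bₙ ≥ bₙ₋₁^(9/5)`, these sticks are so many that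
each of the charged tops of the previous scales
receives one of them (`IsGlueLaw.ae_isAttached`).
Following a chain of such sticks, one gains the height `log bₙ / 2ⁿ`, up to a constant, at each of
these fast scales. At the other scales `log bₙ / 2ⁿ ≤ 0.9 log bₙ₋₁ / 2ⁿ⁻¹`, so that the sum of all
the terms is at most a constant times the first term plus the sum over the fast scales
(`exists_block_far`).

*Compactness.* Every `[0, l]` is totally bounded, so the tree is compact as soon as the tails of
the series vanish, and it is unbounded if they are infinite. Summation by parts over the intervals
`(q n, q (n + 1)]`, on which the mean mass is between `2ⁿ` and `2ⁿ⁺¹`, turns the convergence of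
the series into the integral criterion (`lintegral_inv_lt_top_iff`).
-/

namespace ICRT

/-! ### The mean mass function -/

/-- The mean `𝔼[μ[0, l]] = θ₀² l + ∑_{i ≥ 1} θᵢ (1 - e^{-θᵢ l})` as a real function of `l ≥ 0`. -/
noncomputable def meanFun (θ : ℕ → ℝ) (l : ℝ) : ℝ :=
  θ 0 ^ 2 * l + ∑' i, θ (i + 1) * (1 - Real.exp (-(θ (i + 1) * l)))

section MeanFun

variable {θ : ℕ → ℝ}

theorem IsParameter.summable_sq (hθ : IsParameter θ) : Summable fun i => θ (i + 1) ^ 2 :=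
  (summable_nat_add_iff 1 (f := fun i => θ i ^ 2)).2 hθ.hasSum_sq.summable

theorem IsParameter.tsum_sq (hθ : IsParameter θ) : θ 0 ^ 2 + ∑' i, θ (i + 1) ^ 2 = 1 := by
  rw [← hθ.hasSum_sq.tsum_eq, hθ.hasSum_sq.summable.tsum_eq_zero_add]

theorem atom_term_nonneg {t l : ℝ} (ht : 0 ≤ t) (hl : 0 ≤ l) : 0 ≤ t * (1 - Real.exp (-(t * l))) :=
  mul_nonneg ht (sub_nonneg.2 (Real.exp_le_one_iff.2 (by have := mul_nonneg ht hl; linarith)))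

theorem atom_term_le {t l : ℝ} (ht : 0 ≤ t) : t * (1 - Real.exp (-(t * l))) ≤ t ^ 2 * l := by
  have := Real.add_one_le_exp (-(t * l))
  nlinarith

theorem summable_meanFun (hθ : IsParameter θ) {l : ℝ} (hl : 0 ≤ l) :
    Summable fun i => θ (i + 1) * (1 - Real.exp (-(θ (i + 1) * l))) :=
  .of_nonneg_of_le (fun _ => atom_term_nonneg (hθ.nonneg _) hl)
    (fun _ => atom_term_le (hθ.nonneg _)) (hθ.summable_sq.mul_right l)

@[simp] theorem meanFun_zero : meanFun θ 0 = 0 := by simp [meanFun]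

theorem meanFun_le (hθ : IsParameter θ) {l : ℝ} (hl : 0 ≤ l) : meanFun θ l ≤ l := by
  have h1 := (summable_meanFun hθ hl).tsum_le_tsum
    (fun i => atom_term_le (l := l) (hθ.nonneg (i + 1))) (hθ.summable_sq.mul_right l)
  rw [tsum_mul_right] at h1
  have h2 := hθ.tsum_sq
  unfold meanFun
  calc _ ≤ θ 0 ^ 2 * l + (∑' i, θ (i + 1) ^ 2) * l := by linarith
    _ = l := by rw [← add_mul, h2, one_mul]

theorem meanFun_nonneg (hθ : IsParameter θ) {l : ℝ} (hl : 0 ≤ l) : 0 ≤ meanFun θ l :=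
  add_nonneg (by positivity) (tsum_nonneg fun i => atom_term_nonneg (hθ.nonneg _) hl)

/-- The increments of the mean mass over intervals of a given length decrease. -/
theorem meanFun_increment_anti (hθ : IsParameter θ) {a b h : ℝ} (ha : 0 ≤ a) (hab : a ≤ b)
    (hh : 0 ≤ h) : meanFun θ (b + h) - meanFun θ b ≤ meanFun θ (a + h) - meanFun θ a := by
  have hb := ha.trans hab
  have key : ∑' i, θ (i + 1) * (1 - Real.exp (-(θ (i + 1) * (b + h)))) +
      ∑' i, θ (i + 1) * (1 - Real.exp (-(θ (i + 1) * a))) ≤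
      ∑' i, θ (i + 1) * (1 - Real.exp (-(θ (i + 1) * (a + h)))) +
      ∑' i, θ (i + 1) * (1 - Real.exp (-(θ (i + 1) * b))) := by
    rw [← (summable_meanFun hθ (by positivity)).tsum_add (summable_meanFun hθ ha),
      ← (summable_meanFun hθ (by positivity)).tsum_add (summable_meanFun hθ hb)]
    refine Summable.tsum_le_tsum (fun i => ?_)
      ((summable_meanFun hθ (by positivity)).add (summable_meanFun hθ ha))
      ((summable_meanFun hθ (by positivity)).add (summable_meanFun hθ hb))
    have ht := hθ.nonneg (i + 1)
    set t := θ (i + 1)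
    have e1 : Real.exp (-(t * (b + h))) = Real.exp (-(t * b)) * Real.exp (-(t * h)) := by
      rw [← Real.exp_add]; ring_nf
    have e2 : Real.exp (-(t * (a + h))) = Real.exp (-(t * a)) * Real.exp (-(t * h)) := by
      rw [← Real.exp_add]; ring_nf
    have e3 : Real.exp (-(t * b)) ≤ Real.exp (-(t * a)) :=
      Real.exp_le_exp.2 (by nlinarith)
    have e4 : Real.exp (-(t * h)) ≤ 1 := Real.exp_le_one_iff.2 (by nlinarith)
    rw [e1, e2]
    nlinarith [mul_nonneg ht (mul_nonneg (sub_nonneg.2 e3) (sub_nonneg.2 e4))]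
  unfold meanFun
  linarith

theorem meanFun_strictMonoOn (hθ : IsParameter θ) : StrictMonoOn (meanFun θ) (Ici 0) := by
  intro a ha b hb hab
  have ha' : 0 ≤ a := ha
  have hb' : 0 ≤ b := hb
  have hterm : ∀ i, θ (i + 1) * (1 - Real.exp (-(θ (i + 1) * a))) ≤
      θ (i + 1) * (1 - Real.exp (-(θ (i + 1) * b))) := fun i => by
    have ht := hθ.nonneg (i + 1)
    gcongr
  by_cases h0 : θ 0 = 0
  · have : ∃ i, θ (i + 1) ≠ 0 := by
      by_contra! h
      have := hθ.tsum_sq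
      simp [h0, h] at this
    obtain ⟨i, hi⟩ := this
    have hi' : 0 < θ (i + 1) := lt_of_le_of_ne (hθ.nonneg _) hi.symm
    have : θ (i + 1) * (1 - Real.exp (-(θ (i + 1) * a))) <
        θ (i + 1) * (1 - Real.exp (-(θ (i + 1) * b))) := by
      gcongr
    have := Summable.tsum_lt_tsum hterm this (summable_meanFun hθ ha') (summable_meanFun hθ hb')
    unfold meanFun
    rw [h0]
    linarith
  · have := Summable.tsum_le_tsum hterm (summable_meanFun hθ ha') (summable_meanFun hθ hb')
    have h1 : 0 < θ 0 ^ 2 := by positivity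
    unfold meanFun
    nlinarith

theorem meanFun_mono (hθ : IsParameter θ) {a b : ℝ} (ha : 0 ≤ a) (hab : a ≤ b) :
    meanFun θ a ≤ meanFun θ b :=
  (meanFun_strictMonoOn hθ).monotoneOn ha (ha.trans hab) hab

theorem meanFun_sub_le (hθ : IsParameter θ) {a b : ℝ} (ha : 0 ≤ a) (hab : a ≤ b) :
    meanFun θ b - meanFun θ a ≤ b - a := by
  have h1 := meanFun_increment_anti hθ le_rfl ha (sub_nonneg.2 hab)
  have h2 := meanFun_le hθ (sub_nonneg.2 hab)
  simp only [zero_add, meanFun_zero, sub_zero, add_sub_cancel] at h1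
  linarith

theorem meanFun_continuousOn (hθ : IsParameter θ) : ContinuousOn (meanFun θ) (Ici 0) := by
  refine LipschitzOnWith.continuousOn (K := 1) (LipschitzOnWith.of_dist_le_mul ?_)
  intro a ha b hb
  simp only [NNReal.coe_one, one_mul, Real.dist_eq]
  rcases le_total a b with hab | hab
  · have := meanFun_sub_le hθ ha hab
    have := meanFun_mono hθ ha hab
    rw [abs_sub_comm, abs_sub_comm a, abs_of_nonneg (by linarith), abs_of_nonneg (by linarith)]
    linarith
  · have := meanFun_sub_le hθ hb hab
    have := meanFun_mono hθ hb hab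
    rw [abs_of_nonneg (by linarith), abs_of_nonneg (by linarith)]
    linarith

theorem meanFun_two_mul_le (hθ : IsParameter θ) {a : ℝ} (ha : 0 ≤ a) :
    meanFun θ (2 * a) ≤ 2 * meanFun θ a := by
  have := meanFun_increment_anti hθ le_rfl ha ha
  simp only [zero_add, meanFun_zero, sub_zero] at this
  rw [two_mul a]
  linarith

theorem meanFun_concaveOn (hθ : IsParameter θ) : ConcaveOn ℝ (Ici 0) (meanFun θ) := by
  refine ⟨convex_Ici 0, fun a ha b hb s t hs ht hst => ?_⟩
  simp only [smul_eq_mul]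
  have ha' : 0 ≤ a := ha
  have hb' : 0 ≤ b := hb
  have hab : 0 ≤ s * a + t * b := by positivity
  have key : s * ∑' i, θ (i + 1) * (1 - Real.exp (-(θ (i + 1) * a))) +
      t * ∑' i, θ (i + 1) * (1 - Real.exp (-(θ (i + 1) * b))) ≤
      ∑' i, θ (i + 1) * (1 - Real.exp (-(θ (i + 1) * (s * a + t * b)))) := by
    rw [← tsum_mul_left, ← tsum_mul_left,
      ← ((summable_meanFun hθ ha').mul_left s).tsum_add ((summable_meanFun hθ hb').mul_left t)]
    refine Summable.tsum_le_tsum (fun i => ?_)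
      (((summable_meanFun hθ ha').mul_left s).add ((summable_meanFun hθ hb').mul_left t))
      (summable_meanFun hθ hab)
    have hp := hθ.nonneg (i + 1)
    set p := θ (i + 1)
    have := convexOn_exp.2 (mem_univ (-(p * a))) (mem_univ (-(p * b))) hs ht hst
    simp only [smul_eq_mul] at this
    have e : s * -(p * a) + t * -(p * b) = -(p * (s * a + t * b)) := by ring
    rw [e] at this
    calc _ = p * ((s + t) - (s * Real.exp (-(p * a)) + t * Real.exp (-(p * b)))) := by ring
      _ ≤ p * (1 - Real.exp (-(p * (s * a + t * b)))) := by
        rw [hst]; gcongr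
  unfold meanFun
  nlinarith

/-- By concavity, the mean mass of `(a, a + h]` is at most `h / a` times that of `[0, a]`. -/
theorem meanFun_increment_le (hθ : IsParameter θ) {a h : ℝ} (ha : 0 < a) (hh : 0 ≤ h) :
    meanFun θ (a + h) - meanFun θ a ≤ h * meanFun θ a / a := by
  rcases hh.eq_or_lt with rfl | hh
  · simp
  have h1 := (meanFun_concaveOn hθ).slope_anti_adjacent (x := 0) (y := a) (z := a + h)
    (mem_Ici.2 le_rfl) (mem_Ici.2 (by linarith)) ha (by linarith)
  simp only [meanFun_zero, sub_zero, add_sub_cancel_left] at h1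
  rw [div_le_div_iff₀ hh ha] at h1
  rw [le_div_iff₀ ha]
  linarith

theorem meanFun_unbounded (hθ : IsParameter θ) (K : ℝ) : ∃ l, 0 ≤ l ∧ K ≤ meanFun θ l := by
  rcases hθ.ne_zero_or with h0 | hs
  · have h1 : 0 < θ 0 ^ 2 := by positivity
    refine ⟨|K| / θ 0 ^ 2, by positivity, ?_⟩
    have h2 : 0 ≤ ∑' i, θ (i + 1) * (1 - Real.exp (-(θ (i + 1) * (|K| / θ 0 ^ 2)))) :=
      tsum_nonneg fun i => atom_term_nonneg (hθ.nonneg _) (by positivity)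
    unfold meanFun
    rw [mul_div_cancel₀ _ h1.ne']
    linarith [le_abs_self K]
  · have h1 := (not_summable_iff_tendsto_nat_atTop_of_nonneg
      (fun i => hθ.nonneg (i + 1))).1 hs
    obtain ⟨N, hN⟩ := (h1.eventually_ge_atTop (K + 1)).exists
    have h2 : Tendsto (fun l : ℝ => ∑ i ∈ Finset.range N,
        θ (i + 1) * (1 - Real.exp (-(θ (i + 1) * l)))) atTop
        (𝓝 (∑ i ∈ Finset.range N, θ (i + 1))) := by
      refine tendsto_finsetSum _ fun i _ => ?_
      rcases (hθ.nonneg (i + 1)).eq_or_lt with h | h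
      · simp [← h]
      · have : Tendsto (fun l : ℝ => Real.exp (-(θ (i + 1) * l))) atTop (𝓝 0) :=
          Real.tendsto_exp_neg_atTop_nhds_zero.comp (tendsto_id.const_mul_atTop h)
        simpa using (this.const_sub 1).const_mul (θ (i + 1))
    have h3 := (h2.eventually (lt_mem_nhds (show K < _ by linarith))).and (eventually_ge_atTop 0)
    obtain ⟨l, hl, hl0⟩ := h3.exists
    refine ⟨l, hl0, hl.le.trans ?_⟩
    have := (summable_meanFun hθ hl0).sum_le_tsum (Finset.range N)
      (fun i _ => atom_term_nonneg (hθ.nonneg _) hl0)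
    unfold meanFun
    have : 0 ≤ θ 0 ^ 2 * l := by positivity
    linarith

/-- The inverse of the mean mass function. -/
theorem exists_meanFun_eq (hθ : IsParameter θ) {l : ℝ} (hl : 0 ≤ l) :
    ∃ x, 0 ≤ x ∧ meanFun θ x = l := by
  obtain ⟨b, hb, hlb⟩ := meanFun_unbounded hθ l
  obtain ⟨x, hx, hxl⟩ := intermediate_value_Icc hb
    ((meanFun_continuousOn hθ).mono fun _ h => h.1) ⟨by simpa using hl, hlb⟩
  exact ⟨x, hx.1, hxl⟩

end MeanFun

/-! ### Dyadic quantiles and window scales -/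

section

/-- The sequence `𝒳(2ⁿ)`: the lengths at which the mean mass is `2ⁿ`. -/
def IsDyadicQuantile (θ q : ℕ → ℝ) : Prop := ∀ n, 0 ≤ q n ∧ meanFun θ (q n) = 2 ^ n

namespace IsDyadicQuantile

variable {θ q : ℕ → ℝ}

theorem two_pow_le (hq : IsDyadicQuantile θ q) (hθ : IsParameter θ) (n : ℕ) : 2 ^ n ≤ q n := by
  rw [← (hq n).2]
  exact meanFun_le hθ (hq n).1

theorem one_le (hq : IsDyadicQuantile θ q) (hθ : IsParameter θ) (n : ℕ) : 1 ≤ q n :=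
  (one_le_pow₀ (by norm_num)).trans (hq.two_pow_le hθ n)

theorem pos (hq : IsDyadicQuantile θ q) (hθ : IsParameter θ) (n : ℕ) : 0 < q n :=
  one_pos.trans_le (hq.one_le hθ n)

theorem two_mul_le (hq : IsDyadicQuantile θ q) (hθ : IsParameter θ) (n : ℕ) :
    2 * q n ≤ q (n + 1) := by
  have h1 := meanFun_two_mul_le hθ (hq n).1
  rw [(hq n).2, ← pow_succ', ← (hq (n + 1)).2] at h1
  exact (meanFun_strictMonoOn hθ).le_iff_le (mem_Ici.2 (by have := (hq n).1; positivity))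
    (hq (n + 1)).1 |>.1 h1

theorem strictMono (hq : IsDyadicQuantile θ q) (hθ : IsParameter θ) : StrictMono q :=
  strictMono_nat_of_lt_succ fun n => by linarith [hq.two_mul_le hθ n, hq.pos hθ n]

theorem log_ge (hq : IsDyadicQuantile θ q) (hθ : IsParameter θ) (n : ℕ) :
    n * Real.log 2 ≤ Real.log (q n) := by
  rw [← Real.log_pow]
  exact Real.log_le_log (by positivity) (hq.two_pow_le hθ n)

theorem log_nonneg (hq : IsDyadicQuantile θ q) (hθ : IsParameter θ) (n : ℕ) :
    0 ≤ Real.log (q n) := Real.log_nonneg (hq.one_le hθ n)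

theorem tendsto (hq : IsDyadicQuantile θ q) (hθ : IsParameter θ) : Tendsto q atTop atTop :=
  tendsto_atTop_mono (hq.two_pow_le hθ) (tendsto_pow_atTop_atTop_of_one_lt (by norm_num))

end IsDyadicQuantile

/-- A sequence of scales `bₙ = uₙ¹⁶`, comparable to `𝒳(2ⁿ)` up to a shift of the index, such that
the mean mass of the window `(bₙ / 2, bₙ]` is at least `2ⁿ bₙ^(-1/16)` for `n` large. The sixteenth
root is recorded so that all the powers of `bₙ` in use are integral powers of `uₙ`. -/
structure IsWindowScale (θ q u : ℕ → ℝ) : Prop where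
  one_le : ∀ n, 1 ≤ u n
  le_pow : ∀ n, 2 * q n ≤ u n ^ 16
  pow_le : ∀ n, u n ^ 16 ≤ 2 * q (n + 1)
  mass_le : ∀ᶠ n in atTop, 2 ^ n / u n ≤ meanFun θ (u n ^ 16) - meanFun θ (u n ^ 16 / 2)

variable {θ q u : ℕ → ℝ}

/-- The mean mass doubles between `𝒳(2ⁿ)` and `𝒳(2ⁿ⁺¹)`, so one of the dyadic windows which cover
this interval has to carry more than a small negative power of its scale. -/
theorem exists_isWindowScale (hθ : IsParameter θ) (hq : IsDyadicQuantile θ q) :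
    ∃ u, IsWindowScale θ q u := by
  set g : ℝ := 2 ^ (1 / 16 : ℝ) with hg
  have hg1 : 1 < g := Real.one_lt_rpow (by norm_num) (by norm_num)
  have hg0 : 0 < g := by linarith
  have hg16 : g ^ 16 = 2 := by
    rw [hg, ← Real.rpow_natCast, ← Real.rpow_mul (by norm_num)]; norm_num
  set r : ℕ → ℝ := fun n => q n ^ (1 / 16 : ℝ) with hr
  have hr16 : ∀ n, r n ^ 16 = q n := fun n => by
    rw [hr, ← Real.rpow_natCast, ← Real.rpow_mul (hq n).1]; norm_num
  have hr1 : ∀ n, 1 ≤ r n := fun n => Real.one_le_rpow (hq.one_le hθ n) (by norm_num)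
  have hr0 : ∀ n, 0 < r n := fun n => by linarith [hr1 n]
  have hrt : Tendsto r atTop atTop :=
    (tendsto_rpow_atTop (by norm_num)).comp (hq.tendsto hθ)
  have hpow : ∀ n k, (r n * g ^ k) ^ 16 = 2 ^ k * q n := fun n k => by
    rw [mul_pow, hr16, ← pow_mul, mul_comm k, pow_mul, hg16, mul_comm]
  have key : ∀ n, ∃ v : ℝ, (1 ≤ v ∧ 2 * q n ≤ v ^ 16 ∧ v ^ 16 ≤ 2 * q (n + 1)) ∧
      (1 / (g - 1) < r n → 2 ^ n / v ≤ meanFun θ (v ^ 16) - meanFun θ (v ^ 16 / 2)) := by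
    intro n
    have hqn := hq.pos hθ n
    have hqq := hq.two_mul_le hθ n
    by_cases hn : 1 / (g - 1) < r n
    swap
    · refine ⟨r n * g ^ 1, ⟨?_, ?_, ?_⟩, fun h => absurd h hn⟩
      · exact one_le_mul_of_one_le_of_one_le (hr1 n) (one_le_pow₀ hg1.le)
      · rw [hpow]; linarith
      · rw [hpow]; linarith
    by_contra! hcon
    have hfail : ∀ k, 2 ^ k * q n ≤ q (n + 1) → meanFun θ (2 ^ (k + 1) * q n) -
        meanFun θ (2 ^ k * q n) < 2 ^ n / (r n * g ^ (k + 1)) := by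
      intro k hk
      have := (hcon (r n * g ^ (k + 1)) ⟨one_le_mul_of_one_le_of_one_le (hr1 n)
        (one_le_pow₀ hg1.le), by
          rw [hpow, pow_succ]
          have : (1:ℝ) ≤ 2 ^ k := one_le_pow₀ (by norm_num)
          nlinarith, by rw [hpow, pow_succ]; linarith⟩).2
      rw [hpow] at this
      have e : 2 ^ (k + 1) * q n / 2 = 2 ^ k * q n := by rw [pow_succ]; ring
      rwa [e] at this
    have hsum : ∀ k, (∀ j < k, 2 ^ j * q n ≤ q (n + 1)) → meanFun θ (2 ^ k * q n) -
        meanFun θ (q n) ≤ 2 ^ n / r n * ((1 - (g ^ k)⁻¹) / (g - 1)) := by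
      intro k
      induction k with
      | zero => intro _; simp
      | succ k ih =>
        intro h
        have h1 := ih fun j hj => h j (by omega)
        have h2 := hfail k (h k (by omega))
        have h3 : 2 ^ n / r n * ((1 - (g ^ (k + 1))⁻¹) / (g - 1)) =
            2 ^ n / r n * ((1 - (g ^ k)⁻¹) / (g - 1)) + 2 ^ n / (r n * g ^ (k + 1)) := by
          have := (hr0 n).ne'
          have : g - 1 ≠ 0 := by linarith
          field_simp
          ring
        linarith
    have hex : ∃ k, q (n + 1) < 2 ^ k * q n := by
      obtain ⟨k, hk⟩ := pow_unbounded_of_one_lt (q (n + 1) / q n) (show (1:ℝ) < 2 by norm_num)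
      exact ⟨k, by rwa [div_lt_iff₀ hqn] at hk⟩
    classical
    have h1 := hsum (Nat.find hex) fun j hj => not_lt.1 (Nat.find_min hex hj)
    have h2 := meanFun_mono hθ (hq (n + 1)).1 (Nat.find_spec hex).le
    rw [(hq (n + 1)).2] at h2
    rw [(hq n).2] at h1
    have h3 : 2 ^ n / r n * ((1 - (g ^ (Nat.find hex))⁻¹) / (g - 1)) < 2 ^ n := by
      have hgi : 0 < (g ^ (Nat.find hex))⁻¹ := by positivity
      have hg' : 0 < g - 1 := by linarith
      calc _ ≤ 2 ^ n / r n * (1 / (g - 1)) := by gcongr; linarith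
        _ < 2 ^ n / r n * r n := by
          have := hr0 n
          gcongr
        _ = 2 ^ n := div_mul_cancel₀ _ (hr0 n).ne'
    rw [pow_succ] at h2
    linarith
  choose u hu hu' using key
  exact ⟨u, fun n => (hu n).1, fun n => (hu n).2.1, fun n => (hu n).2.2,
    (hrt.eventually_gt_atTop (1 / (g - 1))).mono hu'⟩

namespace IsWindowScale

theorem pos (hu : IsWindowScale θ q u) (n : ℕ) : 0 < u n := by linarith [hu.one_le n]

theorem mono (hu : IsWindowScale θ q u) : Monotone u := by
  refine monotone_nat_of_le_succ fun n => ?_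
  refine le_of_pow_le_pow_left₀ (n := 16) (by norm_num) (hu.pos _).le ?_
  exact (hu.pow_le n).trans (hu.le_pow _)

theorem pow_le_quantile (hθ : IsParameter θ) (hq : IsDyadicQuantile θ q)
    (hu : IsWindowScale θ q u) (n : ℕ) : u n ^ 16 ≤ q (n + 2) :=
  (hu.pow_le n).trans (hq.two_mul_le hθ _)

theorem meanFun_le (hθ : IsParameter θ) (hq : IsDyadicQuantile θ q)
    (hu : IsWindowScale θ q u) (n : ℕ) : meanFun θ (u n ^ 16) ≤ 2 ^ (n + 2) := by
  rw [← (hq (n + 2)).2]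
  exact meanFun_mono hθ (by have := hu.pos n; positivity) (hu.pow_le_quantile hθ hq n)

theorem two_pow_le (hθ : IsParameter θ) (hq : IsDyadicQuantile θ q)
    (hu : IsWindowScale θ q u) (n : ℕ) : 2 ^ (n + 1) ≤ u n ^ 16 := by
  rw [pow_succ']
  exact (mul_le_mul_of_nonneg_left (hq.two_pow_le hθ n) (by norm_num)).trans (hu.le_pow n)

theorem geom_le (hθ : IsParameter θ) (hq : IsDyadicQuantile θ q)
    (hu : IsWindowScale θ q u) (n : ℕ) : ((2:ℝ) ^ (1 / 16 : ℝ)) ^ n ≤ u n := by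
  refine le_of_pow_le_pow_left₀ (n := 16) (by norm_num) (hu.pos _).le ?_
  rw [← pow_mul, mul_comm, pow_mul, ← Real.rpow_natCast (2 ^ (1 / 16 : ℝ)),
    ← Real.rpow_mul (by norm_num)]
  norm_num
  refine le_trans ?_ (hu.two_pow_le hθ hq n)
  rw [pow_succ]
  linarith [show (0:ℝ) < 2 ^ n by positivity]

theorem summable_inv (hθ : IsParameter θ) (hq : IsDyadicQuantile θ q)
    (hu : IsWindowScale θ q u) : Summable fun n => (u n)⁻¹ := by
  have hg1 : (1:ℝ) < 2 ^ (1 / 16 : ℝ) := Real.one_lt_rpow (by norm_num) (by norm_num)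
  refine .of_nonneg_of_le (fun n => inv_nonneg.2 (hu.pos n).le) (fun n => ?_)
    (summable_geometric_of_lt_one (r := (2 ^ (1 / 16 : ℝ))⁻¹) (by positivity)
      (inv_lt_one_of_one_lt₀ hg1))
  rw [inv_pow]
  exact inv_anti₀ (by positivity) (hu.geom_le hθ hq n)

theorem tendsto (hθ : IsParameter θ) (hq : IsDyadicQuantile θ q)
    (hu : IsWindowScale θ q u) : Tendsto u atTop atTop :=
  tendsto_atTop_mono (hu.geom_le hθ hq) (tendsto_pow_atTop_atTop_of_one_lt
    (Real.one_lt_rpow (by norm_num) (by norm_num)))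

end IsWindowScale

end

/-! ### Second moments -/

section SecondMoment

variable {Ω : Type*} [MeasurableSpace Ω] {ρ : Measure Ω}

/-- The second moment of a sum of pairwise uncorrelated nonnegative variables. -/
theorem lintegral_const_add_tsum_sq_le [IsProbabilityMeasure ρ] (c : ℝ≥0∞) {a : ℕ → Ω → ℝ≥0∞}
    (ha : ∀ i, Measurable (a i))
    (hij : ∀ i j, i ≠ j → ∫⁻ ω, a i ω * a j ω ∂ρ = (∫⁻ ω, a i ω ∂ρ) * ∫⁻ ω, a j ω ∂ρ) :
    ∫⁻ ω, (c + ∑' i, a i ω) ^ 2 ∂ρ ≤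
      (∫⁻ ω, (c + ∑' i, a i ω) ∂ρ) ^ 2 + ∑' i, ∫⁻ ω, a i ω ^ 2 ∂ρ := by
  have hS : Measurable fun ω => ∑' i, a i ω := Measurable.tsum ha
  have e1 : ∫⁻ ω, (c + ∑' i, a i ω) ∂ρ = c + ∑' i, ∫⁻ ω, a i ω ∂ρ := by
    rw [lintegral_add_left measurable_const, lintegral_const, measure_univ, mul_one,
      lintegral_tsum fun i => (ha i).aemeasurable]
  have e2 : ∫⁻ ω, (∑' i, a i ω) ^ 2 ∂ρ ≤
      (∑' i, ∫⁻ ω, a i ω ∂ρ) ^ 2 + ∑' i, ∫⁻ ω, a i ω ^ 2 ∂ρ := by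
    have h1 : ∀ ω, (∑' i, a i ω) ^ 2 = ∑' i, ∑' j, a i ω * a j ω := fun ω => by
      rw [sq, ← ENNReal.tsum_mul_right]
      exact tsum_congr fun i => ENNReal.tsum_mul_left.symm
    have hp : ∀ i j, Measurable fun ω => a i ω * a j ω := fun i j => (ha i).mul (ha j)
    simp_rw [h1]
    rw [lintegral_tsum fun i => (Measurable.tsum fun j => hp i j).aemeasurable]
    have h2 : (∑' i, ∫⁻ ω, a i ω ∂ρ) ^ 2 + ∑' i, ∫⁻ ω, a i ω ^ 2 ∂ρ =
        ∑' i, (∑' j, ((∫⁻ ω, a i ω ∂ρ) * ∫⁻ ω, a j ω ∂ρ) + ∫⁻ ω, a i ω ^ 2 ∂ρ) := by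
      rw [ENNReal.tsum_add, sq, ← ENNReal.tsum_mul_right]
      congr 1
      exact tsum_congr fun i => ENNReal.tsum_mul_left.symm
    rw [h2]
    refine ENNReal.tsum_le_tsum fun i => ?_
    rw [lintegral_tsum fun j => (hp i j).aemeasurable,
      ← tsum_ite_eq i (fun _ => ∫⁻ ω, a i ω ^ 2 ∂ρ), ← ENNReal.tsum_add]
    refine ENNReal.tsum_le_tsum fun j => ?_
    by_cases h : j = i
    · subst h
      simp only [if_true, sq]
      exact le_add_self
    · rw [hij i j (Ne.symm h)]
      exact le_self_add
  have e3 : ∀ ω, (c + ∑' i, a i ω) ^ 2 = c ^ 2 + 2 * c * ∑' i, a i ω + (∑' i, a i ω) ^ 2 :=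
    fun ω => by ring
  simp_rw [e3]
  rw [lintegral_add_left (by fun_prop), lintegral_add_left measurable_const, lintegral_const,
    measure_univ, mul_one, lintegral_const_mul _ hS, e1,
    lintegral_tsum fun i => (ha i).aemeasurable]
  calc _ ≤ c ^ 2 + 2 * c * ∑' i, ∫⁻ ω, a i ω ∂ρ +
        ((∑' i, ∫⁻ ω, a i ω ∂ρ) ^ 2 + ∑' i, ∫⁻ ω, a i ω ^ 2 ∂ρ) := by gcongr
    _ = _ := by ring

/-- Chebyshev's inequality for a nonnegative variable with given first two moments. -/
theorem measure_far_from_mean_le [IsProbabilityMeasure ρ] {f : Ω → ℝ≥0∞} (hf : Measurable f)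
    {m s t : ℝ} (hm : 0 ≤ m) (hs : 0 ≤ s) (ht : 0 < t) (h1 : ∫⁻ ω, f ω ∂ρ = ENNReal.ofReal m)
    (h2 : ∫⁻ ω, f ω ^ 2 ∂ρ ≤ ENNReal.ofReal m ^ 2 + ENNReal.ofReal s) :
    ρ {ω | ¬ (ENNReal.ofReal (m - t) ≤ f ω ∧ f ω ≤ ENNReal.ofReal (m + t))} ≤
      ENNReal.ofReal (s / t ^ 2) := by
  have hfin : ∀ᵐ ω ∂ρ, f ω < ∞ := ae_lt_top hf (by rw [h1]; exact ENNReal.ofReal_ne_top)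
  have hF : Measurable fun ω => (f ω).toReal := hf.ennreal_toReal
  have hsq : ∫⁻ ω, ‖(f ω).toReal‖ₑ ^ 2 ∂ρ = ∫⁻ ω, f ω ^ 2 ∂ρ := by
    refine lintegral_congr_ae (hfin.mono fun ω hω => ?_)
    simp only
    rw [Real.enorm_eq_ofReal ENNReal.toReal_nonneg, ENNReal.ofReal_toReal hω.ne]
  have h2' : ∫⁻ ω, f ω ^ 2 ∂ρ ≤ ENNReal.ofReal (m ^ 2 + s) := by
    rw [ENNReal.ofReal_add (by positivity) hs, ENNReal.ofReal_pow hm]; exact h2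
  have hmem : MemLp (fun ω => (f ω).toReal) 2 ρ := by
    refine ⟨hF.aestronglyMeasurable, ?_⟩
    rw [eLpNorm_lt_top_iff_lintegral_rpow_enorm_lt_top (by norm_num) (by norm_num)]
    simp only [ENNReal.toReal_ofNat, ENNReal.rpow_ofNat]
    rw [hsq]
    exact h2'.trans_lt ENNReal.ofReal_lt_top
  have hmean : ρ[fun ω => (f ω).toReal] = m := by
    rw [integral_toReal hf.aemeasurable hfin, h1, ENNReal.toReal_ofReal hm]
  have hint2 : ρ[(fun ω => (f ω).toReal) ^ 2] ≤ m ^ 2 + s := by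
    have hF2 : Measurable ((fun ω => (f ω).toReal) ^ 2) := hF.pow_const 2
    have hnn : 0 ≤ᵐ[ρ] (fun ω => (f ω).toReal) ^ 2 := ae_of_all _ fun ω => sq_nonneg _
    rw [integral_eq_lintegral_of_nonneg_ae hnn hF2.aestronglyMeasurable]
    refine ENNReal.toReal_le_of_le_ofReal (by positivity) (le_trans (le_of_eq ?_) h2')
    rw [← hsq]
    refine lintegral_congr fun ω => ?_
    simp only [Pi.pow_apply]
    rw [Real.enorm_eq_ofReal ENNReal.toReal_nonneg, ENNReal.ofReal_pow ENNReal.toReal_nonneg]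
  have hvar : variance (fun ω => (f ω).toReal) ρ ≤ s := by
    rw [variance_eq_sub hmem, hmean]; linarith
  have hcheb := meas_ge_le_variance_div_sq hmem ht
  rw [hmean] at hcheb
  calc _ ≤ ρ {ω | t ≤ |(f ω).toReal - m|} := by
        refine measure_mono_ae (hfin.mono fun ω hω => ?_)
        intro h
        by_contra h'
        have h' : |(f ω).toReal - m| < t := not_le.1 h'
        rw [abs_lt] at h'
        refine h ⟨?_, ?_⟩
        · rw [← ENNReal.ofReal_toReal hω.ne]; exact ENNReal.ofReal_le_ofReal (by linarith)
        · rw [← ENNReal.ofReal_toReal hω.ne]; exact ENNReal.ofReal_le_ofReal (by linarith)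
    _ ≤ _ := hcheb
    _ ≤ _ := ENNReal.ofReal_le_ofReal (by gcongr)

/-- Markov's inequality in the form used for Borel–Cantelli arguments. -/
theorem measure_gt_ofReal_le {f : Ω → ℝ≥0∞} (hf : AEMeasurable f ρ) {m t : ℝ} (ht : 0 < t)
    (h1 : ∫⁻ ω, f ω ∂ρ ≤ ENNReal.ofReal m) :
    ρ {ω | ¬ f ω ≤ ENNReal.ofReal t} ≤ ENNReal.ofReal (m / t) := by
  have h := meas_ge_le_lintegral_div hf (ε := ENNReal.ofReal t) (by simpa using ht)
    ENNReal.ofReal_ne_top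
  rw [ENNReal.ofReal_div_of_pos ht]
  exact (measure_mono fun ω hω => (not_le.1 hω).le).trans (h.trans (by gcongr))

/-- Borel–Cantelli with an explicit summable bound that holds eventually. -/
theorem ae_eventually_of_summable [IsFiniteMeasure ρ] {p : ℕ → Ω → Prop} {g : ℕ → ℝ}
    (hg : Summable g)
    (h : ∀ᶠ n in atTop, ρ {ω | ¬ p n ω} ≤ ENNReal.ofReal (g n)) :
    ∀ᵐ ω ∂ρ, ∀ᶠ n in atTop, p n ω := by
  obtain ⟨N, hN⟩ := eventually_atTop.1 h
  have hsum : ∑' n, ρ {ω | ¬ p (n + N) ω} ≠ ∞ := by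
    refine ne_top_of_le_ne_top ?_ (ENNReal.tsum_le_tsum fun n => hN (n + N) (by omega))
    exact ((summable_nat_add_iff N).2 hg).tsum_ofReal_ne_top
  filter_upwards [ae_eventually_notMem hsum] with ω hω
  obtain ⟨M, hM⟩ := eventually_atTop.1 hω
  refine eventually_atTop.2 ⟨M + N, fun n hn => ?_⟩
  have := hM (n - N) (by omega)
  rw [Nat.sub_add_cancel (by omega)] at this
  exact not_not.1 this

end SecondMoment

/-! ### The mass measure as a random variable -/

section Mass

variable {θ : ℕ → ℝ}

theorem mass_apply (x : ℕ → ℝ) {A : Set ℝ} (hA : MeasurableSet A) :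
    mass θ x A = ENNReal.ofReal (θ 0 ^ 2) * volume (A ∩ Ici 0) +
      ∑' i, ENNReal.ofReal (θ (i + 1)) * A.indicator 1 (x i) := by
  simp [mass, Measure.sum_apply _ hA, Measure.restrict_apply hA, Measure.dirac_apply' _ hA]

theorem measurable_mass {A : Set ℝ} (hA : MeasurableSet A) : Measurable fun x => mass θ x A := by
  simp_rw [mass_apply _ hA]
  refine measurable_const.add (Measurable.tsum fun i => measurable_const.mul ?_)
  exact (measurable_one.indicator hA).comp (measurable_pi_apply i)

/-- A law of the sequence of the atoms: independent exponential variables. -/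
structure IsAtomLaw (θ : ℕ → ℝ) (ρ : Measure (ℕ → ℝ)) : Prop where
  indep : iIndepFun (fun i (x : ℕ → ℝ) => x i) ρ
  law : ∀ i, 0 < θ (i + 1) → ρ.map (fun x => x i) = expMeasure (θ (i + 1))

theorem expMeasure_Ioc {r : ℝ} (hr : 0 < r) {a b : ℝ} (ha : 0 ≤ a) (hab : a ≤ b) :
    expMeasure r (Ioc a b) = ENNReal.ofReal (Real.exp (-(r * a)) - Real.exp (-(r * b))) := by
  have := isProbabilityMeasure_expMeasure hr
  rw [← measure_cdf (expMeasure r), StieltjesFunction.measure_Ioc, cdf_expMeasure_eq hr,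
    cdf_expMeasure_eq hr, if_pos ha, if_pos (ha.trans hab)]
  congr 1
  ring

theorem expMeasure_Iic_zero {r : ℝ} (hr : 0 < r) : expMeasure r (Iic 0) = 0 := by
  have := isProbabilityMeasure_expMeasure hr
  rw [← ofReal_cdf, cdf_expMeasure_eq hr]
  simp

variable {ρ : Measure (ℕ → ℝ)}

theorem IsAtomLaw.weight_mul_prob (h : IsAtomLaw θ ρ) (hθ : IsParameter θ) (i : ℕ) {a b : ℝ}
    (ha : 0 ≤ a) (hab : a ≤ b) : ENNReal.ofReal (θ (i + 1)) * ρ {x | x i ∈ Ioc a b} =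
      ENNReal.ofReal (θ (i + 1) * (1 - Real.exp (-(θ (i + 1) * b))) -
        θ (i + 1) * (1 - Real.exp (-(θ (i + 1) * a)))) := by
  rcases (hθ.nonneg (i + 1)).eq_or_lt with h0 | h0
  · simp [← h0]
  · have : ρ {x | x i ∈ Ioc a b} = expMeasure (θ (i + 1)) (Ioc a b) := by
      rw [← h.law i h0, Measure.map_apply (measurable_pi_apply i) measurableSet_Ioc]; rfl
    rw [this, expMeasure_Ioc h0 ha hab, ← ENNReal.ofReal_mul h0.le]
    congr 1
    ring

theorem IsAtomLaw.lintegral_atom (i : ℕ) {A : Set ℝ}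
    (hA : MeasurableSet A) : ∫⁻ x, ENNReal.ofReal (θ (i + 1)) * A.indicator 1 (x i) ∂ρ =
      ENNReal.ofReal (θ (i + 1)) * ρ {x | x i ∈ A} := by
  have hm : Measurable fun x : ℕ → ℝ => A.indicator (1 : ℝ → ℝ≥0∞) (x i) :=
    (measurable_one.indicator hA).comp (measurable_pi_apply i)
  rw [lintegral_const_mul _ hm]
  congr 1
  have : (fun x : ℕ → ℝ => A.indicator (1 : ℝ → ℝ≥0∞) (x i)) =
      ((fun x : ℕ → ℝ => x i) ⁻¹' A).indicator 1 := rfl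
  rw [this, lintegral_indicator_one (measurable_pi_apply i hA)]
  rfl

variable [IsProbabilityMeasure ρ]

theorem IsAtomLaw.lintegral_mass {A : Set ℝ} (hA : MeasurableSet A) :
    ∫⁻ x, mass θ x A ∂ρ = ENNReal.ofReal (θ 0 ^ 2) * volume (A ∩ Ici 0) +
      ∑' i, ENNReal.ofReal (θ (i + 1)) * ρ {x | x i ∈ A} := by
  have hm : ∀ i, Measurable fun x : ℕ → ℝ => ENNReal.ofReal (θ (i + 1)) *
      A.indicator (1 : ℝ → ℝ≥0∞) (x i) := fun i =>
    measurable_const.mul ((measurable_one.indicator hA).comp (measurable_pi_apply i))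
  simp_rw [mass_apply _ hA]
  rw [lintegral_add_left measurable_const, lintegral_const, measure_univ, mul_one,
    lintegral_tsum fun i => (hm i).aemeasurable]
  simp_rw [IsAtomLaw.lintegral_atom _ hA]

theorem IsAtomLaw.lintegral_mass_Ioc (h : IsAtomLaw θ ρ) (hθ : IsParameter θ) {a b : ℝ}
    (ha : 0 ≤ a) (hab : a ≤ b) :
    ∫⁻ x, mass θ x (Ioc a b) ∂ρ = ENNReal.ofReal (meanFun θ b - meanFun θ a) := by
  have hb := ha.trans hab
  rw [IsAtomLaw.lintegral_mass measurableSet_Ioc]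
  simp_rw [h.weight_mul_prob hθ _ ha hab]
  have e : Ioc a b ∩ Ici 0 = Ioc a b := inter_eq_left.2 fun x hx => ha.trans hx.1.le
  have hs := (summable_meanFun hθ hb).sub (summable_meanFun hθ ha)
  have hnn : ∀ i, 0 ≤ θ (i + 1) * (1 - Real.exp (-(θ (i + 1) * b))) -
      θ (i + 1) * (1 - Real.exp (-(θ (i + 1) * a))) := fun i => by
    have := hθ.nonneg (i + 1)
    rw [sub_nonneg]
    gcongr
  rw [e, Real.volume_Ioc, ← ENNReal.ofReal_mul (by positivity),
    ← ENNReal.ofReal_tsum_of_nonneg hnn hs, ← ENNReal.ofReal_add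
      (mul_nonneg (by positivity) (by linarith)) (tsum_nonneg hnn),
    (summable_meanFun hθ hb).tsum_sub (summable_meanFun hθ ha)]
  congr 1
  unfold meanFun
  ring

theorem IsAtomLaw.lintegral_mass_Icc (h : IsAtomLaw θ ρ) (hθ : IsParameter θ) {l : ℝ}
    (hl : 0 ≤ l) : ∫⁻ x, mass θ x (Icc 0 l) ∂ρ = ENNReal.ofReal (meanFun θ l) := by
  have h1 := h.lintegral_mass_Ioc hθ le_rfl hl
  rw [meanFun_zero, sub_zero] at h1
  rw [← h1]
  have h0 : ∫⁻ x, mass θ x {0} ∂ρ = 0 := by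
    rw [IsAtomLaw.lintegral_mass (measurableSet_singleton _)]
    have : volume ({0} ∩ Ici (0:ℝ)) = 0 := measure_mono_null inter_subset_left (by simp)
    rw [this, mul_zero, zero_add, ENNReal.tsum_eq_zero]
    intro i
    rcases (hθ.nonneg (i + 1)).eq_or_lt with h0 | h0
    · simp [← h0]
    · have : ρ {x | x i ∈ ({0} : Set ℝ)} ≤ expMeasure (θ (i + 1)) (Iic 0) := by
        rw [← h.law i h0, Measure.map_apply (measurable_pi_apply i) measurableSet_Iic]
        exact measure_mono fun x hx => le_of_eq hx
      rw [expMeasure_Iic_zero h0] at this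
      rw [le_zero_iff.1 this, mul_zero]
  rw [← Icc_union_Ioc_eq_Icc le_rfl hl, Icc_self]
  have : ∀ x : ℕ → ℝ, mass θ x ({0} ∪ Ioc 0 l) = mass θ x {0} + mass θ x (Ioc 0 l) := fun x =>
    measure_union (by simp) measurableSet_Ioc
  simp_rw [this]
  rw [lintegral_add_left (measurable_mass (measurableSet_singleton _)), h0, zero_add]

/-- The variance of the mass of a set is at most `∑ θᵢ² ℙ(Xᵢ ∈ A)`. -/
theorem IsAtomLaw.lintegral_mass_sq_le (h : IsAtomLaw θ ρ) {A : Set ℝ} (hA : MeasurableSet A) :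
    ∫⁻ x, mass θ x A ^ 2 ∂ρ ≤ (∫⁻ x, mass θ x A ∂ρ) ^ 2 +
      ∑' i, ENNReal.ofReal (θ (i + 1)) ^ 2 * ρ {x | x i ∈ A} := by
  have hm : ∀ i, Measurable fun x : ℕ → ℝ => ENNReal.ofReal (θ (i + 1)) *
      A.indicator (1 : ℝ → ℝ≥0∞) (x i) := fun i =>
    measurable_const.mul ((measurable_one.indicator hA).comp (measurable_pi_apply i))
  simp_rw [mass_apply _ hA]
  refine (lintegral_const_add_tsum_sq_le _ hm fun i j hij => ?_).trans (le_of_eq ?_)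
  · have hi := (h.indep.indepFun hij).comp
      (φ := fun t => ENNReal.ofReal (θ (i + 1)) * A.indicator (1 : ℝ → ℝ≥0∞) t)
      (ψ := fun t => ENNReal.ofReal (θ (j + 1)) * A.indicator (1 : ℝ → ℝ≥0∞) t)
      (measurable_const.mul (measurable_one.indicator hA))
      (measurable_const.mul (measurable_one.indicator hA))
    exact lintegral_mul_eq_lintegral_mul_lintegral_of_indepFun (hm i) (hm j) hi
  · congr 1
    refine tsum_congr fun i => ?_
    have e : ∀ x : ℕ → ℝ, (ENNReal.ofReal (θ (i + 1)) * A.indicator (1 : ℝ → ℝ≥0∞) (x i)) ^ 2 =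
        ENNReal.ofReal (θ (i + 1)) * (ENNReal.ofReal (θ (i + 1)) *
          A.indicator (1 : ℝ → ℝ≥0∞) (x i)) := fun x => by
      by_cases hx : x i ∈ A <;> simp [hx, sq]
    simp_rw [e]
    rw [lintegral_const_mul _ (hm i), IsAtomLaw.lintegral_atom _ hA, sq, mul_assoc]

end Mass

/-! ### Concentration of the mass of initial intervals -/

section

variable {θ q u : ℕ → ℝ} {ρ : Measure (ℕ → ℝ)}

theorem tsum_weight_sq_mul_le (hθ : IsParameter θ) (p : ℕ → ℝ≥0∞) {c : ℝ≥0∞}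
    (hp : ∀ i, p i ≤ c) : ∑' i, ENNReal.ofReal (θ (i + 1)) ^ 2 * p i ≤ c := by
  calc _ ≤ ∑' i, ENNReal.ofReal (θ (i + 1) ^ 2) * c := by
        refine ENNReal.tsum_le_tsum fun i => ?_
        rw [ENNReal.ofReal_pow (hθ.nonneg _)]
        gcongr
        exact hp i
    _ = ENNReal.ofReal (∑' i, θ (i + 1) ^ 2) * c := by
        rw [ENNReal.tsum_mul_right, ENNReal.ofReal_tsum_of_nonneg (fun i => sq_nonneg _)
          hθ.summable_sq]
    _ ≤ 1 * c := by
        gcongr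
        rw [← ENNReal.ofReal_one]
        refine ENNReal.ofReal_le_ofReal ?_
        have := hθ.tsum_sq
        nlinarith [sq_nonneg (θ 0)]
    _ = c := one_mul c

/-- Almost surely, `μ[0, 𝒳(2ⁿ)]` is comparable to its mean `2ⁿ` for all large `n`: its variance is
at most `∑ θᵢ² ≤ 1`. -/
theorem IsAtomLaw.ae_mass_quantile [IsProbabilityMeasure ρ] (h : IsAtomLaw θ ρ)
    (hθ : IsParameter θ) (hq : IsDyadicQuantile θ q) :
    ∀ᵐ x ∂ρ, ∀ᶠ n in atTop, ENNReal.ofReal (2 ^ n / 2) ≤ mass θ x (Icc 0 (q n)) ∧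
      mass θ x (Icc 0 (q n)) ≤ ENNReal.ofReal (2 * 2 ^ n) := by
  refine ae_eventually_of_summable (g := fun n => 4 * (1 / 4) ^ n)
    ((summable_geometric_of_lt_one (by norm_num) (by norm_num)).mul_left 4) (.of_forall fun n => ?_)
  have h1 := h.lintegral_mass_Icc hθ (hq n).1
  rw [(hq n).2] at h1
  have h2 := h.lintegral_mass_sq_le (θ := θ) (A := Icc 0 (q n)) measurableSet_Icc
  rw [h1] at h2
  have h3 := measure_far_from_mean_le (ρ := ρ) (measurable_mass measurableSet_Icc)
    (m := 2 ^ n) (s := 1) (t := 2 ^ n / 2) (by positivity) zero_le_one (by positivity) h1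
    (h2.trans (by
      gcongr
      rw [ENNReal.ofReal_one]
      exact tsum_weight_sq_mul_le hθ _ fun i => prob_le_one))
  refine (measure_mono fun x hx => ?_).trans (h3.trans (ENNReal.ofReal_le_ofReal ?_))
  · refine fun hx' => hx ⟨?_, ?_⟩
    · convert hx'.1 using 2; ring
    · refine hx'.2.trans (ENNReal.ofReal_le_ofReal ?_)
      linarith [show (0:ℝ) < 2 ^ n by positivity]
  · rw [one_div_pow, div_pow, one_div_div, ← pow_mul, mul_comm n 2, pow_mul]
    norm_num
    rw [div_eq_mul_inv]

/-! ### Blocks -/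

/-- A third of the length of the blocks of scale `n`. -/
noncomputable def blockLen (u : ℕ → ℝ) (n : ℕ) : ℝ := Real.log (u n) / (16 * 2 ^ n)

/-- The left end of the `j`-th block of the window `(bₙ / 2, bₙ]`, where `bₙ = uₙ¹⁶`. -/
noncomputable def blockStart (u : ℕ → ℝ) (n j : ℕ) : ℝ := u n ^ 16 / 2 + 3 * blockLen u n * j

/-- The number of the blocks of scale `n`. -/
noncomputable def numBlocks (u : ℕ → ℝ) (n : ℕ) : ℕ := ⌊u n ^ 16 / (6 * blockLen u n)⌋₊

/-- The first third of a block, where a cut is looked for. -/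
def blockHead (u : ℕ → ℝ) (n j : ℕ) : Set ℝ :=
  Ioc (blockStart u n j) (blockStart u n j + blockLen u n)

/-- The last two thirds of a block, which should contain no cut. -/
def blockTail (u : ℕ → ℝ) (n j : ℕ) : Set ℝ :=
  Ioc (blockStart u n j + blockLen u n) (blockStart u n j + 3 * blockLen u n)

/-- The last third of a block, where the branches of the next scale are to be glued. -/
def blockTop (u : ℕ → ℝ) (n j : ℕ) : Set ℝ :=
  Ioc (blockStart u n j + 2 * blockLen u n) (blockStart u n j + 3 * blockLen u n)

/-- A block is charged if the mass of its top is not much smaller than `1 / bₙ`. -/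
def IsCharged (θ u x : ℕ → ℝ) (n j : ℕ) : Prop :=
  ENNReal.ofReal (1 / u n ^ 18) ≤ mass θ x (blockTop u n j)

open Classical in
/-- The set of the charged blocks of scale `n`. -/
noncomputable def chargedBlocks (θ u x : ℕ → ℝ) (n : ℕ) : Finset ℕ :=
  (Finset.range (numBlocks u n)).filter (IsCharged θ u x n)

theorem blockLen_pos {n : ℕ} (h : 1 < u n) : 0 < blockLen u n :=
  div_pos (Real.log_pos h) (by positivity)

theorem numBlocks_mul_le {n : ℕ} (h : 1 < u n) :
    numBlocks u n * (6 * blockLen u n) ≤ u n ^ 16 := by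
  have h1 := blockLen_pos h
  have h2 : (numBlocks u n : ℝ) ≤ u n ^ 16 / (6 * blockLen u n) := Nat.floor_le (by positivity)
  rwa [le_div_iff₀ (by positivity)] at h2

theorem lt_numBlocks_succ_mul {n : ℕ} (h : 1 < u n) :
    u n ^ 16 < (numBlocks u n + 1) * (6 * blockLen u n) := by
  have h1 := blockLen_pos h
  rw [← div_lt_iff₀ (by positivity)]
  exact Nat.lt_floor_add_one _

theorem blockStart_ge {n : ℕ} (h : 1 < u n) (j : ℕ) : u n ^ 16 / 2 ≤ blockStart u n j := by
  have h1 := blockLen_pos h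
  unfold blockStart
  have : 0 ≤ 3 * blockLen u n * j := by positivity
  linarith

theorem blockEnd_le {n j : ℕ} (h : 1 < u n) (hj : j < numBlocks u n) :
    blockStart u n j + 3 * blockLen u n ≤ u n ^ 16 := by
  have h1 := blockLen_pos h
  have h2 := numBlocks_mul_le h
  have h3 : (j : ℝ) + 1 ≤ numBlocks u n := by exact_mod_cast hj
  unfold blockStart
  nlinarith

theorem blockStart_succ (n j : ℕ) :
    blockStart u n (j + 1) = blockStart u n j + 3 * blockLen u n := by
  unfold blockStart; push_cast; ring

theorem blockEnd_le_blockStart {n i j : ℕ} (h : 1 < u n) (hij : i < j) :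
    blockStart u n i + 3 * blockLen u n ≤ blockStart u n j := by
  have h1 := blockLen_pos h
  have h3 : (i : ℝ) + 1 ≤ j := by exact_mod_cast hij
  unfold blockStart
  nlinarith

/-- The parts of distinct blocks are disjoint. -/
theorem disjoint_of_blocks {n i j : ℕ} (h : 1 < u n) (hij : i ≠ j) {A B : Set ℝ}
    (hA : A ⊆ Ioc (blockStart u n i) (blockStart u n i + 3 * blockLen u n))
    (hB : B ⊆ Ioc (blockStart u n j) (blockStart u n j + 3 * blockLen u n)) : Disjoint A B := by
  rw [Set.disjoint_left]
  intro t hA' hB'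
  have h1 := hA hA'
  have h2 := hB hB'
  rcases lt_or_gt_of_ne hij with h3 | h3
  · linarith [blockEnd_le_blockStart h h3, h1.2, h2.1]
  · linarith [blockEnd_le_blockStart h h3, h2.2, h1.1]

theorem blockTop_subset {n : ℕ} (h : 1 < u n) (j : ℕ) : blockTop u n j ⊆
    Ioc (blockStart u n j) (blockStart u n j + 3 * blockLen u n) :=
  Ioc_subset_Ioc_left (by linarith [blockLen_pos h])

theorem blockTail_subset {n : ℕ} (h : 1 < u n) (j : ℕ) : blockTail u n j ⊆
    Ioc (blockStart u n j) (blockStart u n j + 3 * blockLen u n) :=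
  Ioc_subset_Ioc_left (by linarith [blockLen_pos h])

theorem blockHead_subset {n : ℕ} (h : 1 < u n) (j : ℕ) : blockHead u n j ⊆
    Ioc (blockStart u n j) (blockStart u n j + 3 * blockLen u n) :=
  Ioc_subset_Ioc_right (by linarith [blockLen_pos h])

theorem block_subset_window {n j : ℕ} (h : 1 < u n) (hj : j < numBlocks u n) :
    Ioc (blockStart u n j) (blockStart u n j + 3 * blockLen u n) ⊆
      Ioc (u n ^ 16 / 2) (u n ^ 16) :=
  Ioc_subset_Ioc (blockStart_ge h j) (blockEnd_le h hj)

/-- The mean mass of the top of a block. -/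
noncomputable def topMean (θ u : ℕ → ℝ) (n j : ℕ) : ℝ :=
  meanFun θ (blockStart u n j + 3 * blockLen u n) - meanFun θ (blockStart u n j + 2 * blockLen u n)

theorem topMean_nonneg (hθ : IsParameter θ) {n : ℕ} (h : 1 < u n) (j : ℕ) :
    0 ≤ topMean θ u n j := by
  have h1 := blockLen_pos h
  have h2 := blockStart_ge h j
  have : 0 < u n ^ 16 := by positivity
  exact sub_nonneg.2 (meanFun_mono hθ (by linarith) (by linarith))

theorem IsAtomLaw.lintegral_blockTop [IsProbabilityMeasure ρ] (hρ : IsAtomLaw θ ρ)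
    (hθ : IsParameter θ) {n : ℕ} (h : 1 < u n) (j : ℕ) :
    ∫⁻ x, mass θ x (blockTop u n j) ∂ρ = ENNReal.ofReal (topMean θ u n j) := by
  have h1 := blockLen_pos h
  have h2 := blockStart_ge h j
  have : 0 < u n ^ 16 := by positivity
  exact hρ.lintegral_mass_Ioc hθ (by linarith) (by linarith)

theorem topMean_le (hθ : IsParameter θ) (hq : IsDyadicQuantile θ q) (hu : IsWindowScale θ q u)
    {n j : ℕ} (h : 1 < u n) (hj : j < numBlocks u n) :
    topMean θ u n j ≤ Real.log (u n) / (2 * u n ^ 16) := by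
  have h1 := blockLen_pos h
  have h2 := blockStart_ge h j
  have h3 := blockEnd_le h hj
  have h0 : 0 < u n ^ 16 := by positivity
  have h4 := meanFun_increment_le hθ (a := blockStart u n j + 2 * blockLen u n)
    (h := blockLen u n) (by linarith) h1.le
  have e : blockStart u n j + 2 * blockLen u n + blockLen u n =
      blockStart u n j + 3 * blockLen u n := by ring
  rw [e] at h4
  have h5 : meanFun θ (blockStart u n j + 2 * blockLen u n) ≤ 2 ^ (n + 2) :=
    (meanFun_mono hθ (by linarith) (by linarith)).trans (hu.meanFun_le hθ hq n)
  refine h4.trans ?_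
  calc _ ≤ blockLen u n * 2 ^ (n + 2) / (u n ^ 16 / 2) := by
        gcongr
        linarith
    _ = _ := by unfold blockLen; field_simp; ring

/-- The tops of the blocks carry a fixed proportion of the mean mass of the window: by concavity,
the increments of the mean mass over the thirds of a block are at most the increment over the top
of the previous block. -/
theorem sum_topMean_ge (hθ : IsParameter θ) (hq : IsDyadicQuantile θ q)
    (hu : IsWindowScale θ q u) {n : ℕ} (h : 2 ≤ u n)
    (hmass : 2 ^ n / u n ≤ meanFun θ (u n ^ 16) - meanFun θ (u n ^ 16 / 2)) :
    2 ^ n / (4 * u n) ≤ ∑ j ∈ Finset.range (numBlocks u n), topMean θ u n j := by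
  have h' : 1 < u n := by linarith
  have h1 := blockLen_pos h'
  have h0 : 0 < u n ^ 16 := by positivity
  set ℓ := blockLen u n
  set M := numBlocks u n
  have htel := Finset.sum_range_sub (fun j => meanFun θ (blockStart u n j)) (M + 1)
  have hend : u n ^ 16 ≤ blockStart u n (M + 1) := by
    have := lt_numBlocks_succ_mul h'
    unfold blockStart
    push_cast
    nlinarith
  have hs0 : blockStart u n 0 = u n ^ 16 / 2 := by simp [blockStart]
  rw [Finset.sum_range_succ', hs0] at htel
  have h2 := meanFun_mono hθ h0.le hend
  have h3 : meanFun θ (blockStart u n (0 + 1)) - meanFun θ (u n ^ 16 / 2) ≤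
      3 / 2 * Real.log (u n) / u n ^ 16 := by
    rw [blockStart_succ, hs0]
    refine (meanFun_increment_le hθ (by positivity) (by positivity)).trans ?_
    have : meanFun θ (u n ^ 16 / 2) ≤ 2 ^ (n + 2) :=
      (meanFun_mono hθ (by positivity) (by linarith)).trans (hu.meanFun_le hθ hq n)
    calc _ ≤ 3 * ℓ * 2 ^ (n + 2) / (u n ^ 16 / 2) := by gcongr
      _ = _ := by simp only [ℓ, blockLen]; field_simp; ring
  have h4 : ∑ j ∈ Finset.range M, (meanFun θ (blockStart u n (j + 1 + 1)) -
      meanFun θ (blockStart u n (j + 1))) ≤ ∑ j ∈ Finset.range M, 3 * topMean θ u n j := by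
    refine Finset.sum_le_sum fun j _ => ?_
    have hj := blockStart_ge h' j
    set a := blockStart u n j with ha
    have e1 : blockStart u n (j + 1) = a + 3 * ℓ := blockStart_succ n j
    have e2 : blockStart u n (j + 1 + 1) = a + 3 * ℓ + ℓ + ℓ + ℓ := by
      rw [blockStart_succ, e1]; ring
    rw [e1, e2]
    have e3 : topMean θ u n j = meanFun θ (a + 2 * ℓ + ℓ) - meanFun θ (a + 2 * ℓ) := by
      unfold topMean; rw [← ha]; congr 2; ring
    rw [e3]
    have i1 := meanFun_increment_anti hθ (a := a + 2 * ℓ) (b := a + 3 * ℓ) (h := ℓ)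
      (by linarith) (by linarith) h1.le
    have i2 := meanFun_increment_anti hθ (a := a + 2 * ℓ) (b := a + 3 * ℓ + ℓ) (h := ℓ)
      (by linarith) (by linarith) h1.le
    have i3 := meanFun_increment_anti hθ (a := a + 2 * ℓ) (b := a + 3 * ℓ + ℓ + ℓ) (h := ℓ)
      (by linarith) (by linarith) h1.le
    linarith
  rw [← Finset.mul_sum] at h4
  have h5 : 3 / 2 * Real.log (u n) / u n ^ 16 ≤ 2 ^ n / (4 * u n) := by
    have hl : Real.log (u n) ≤ u n := (Real.log_le_sub_one_of_pos (by linarith)).trans (by linarith)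
    have hp : (1:ℝ) ≤ 2 ^ n := one_le_pow₀ (by norm_num)
    rw [div_le_div_iff₀ h0 (by linarith)]
    have h14 : (2:ℝ) ^ 14 ≤ u n ^ 14 := by gcongr
    have : 3 / 2 * Real.log (u n) * (4 * u n) ≤ 6 * u n ^ 2 := by nlinarith
    have : 6 * u n ^ 2 ≤ u n ^ 16 := by
      have : u n ^ 16 = u n ^ 14 * u n ^ 2 := by ring
      rw [this]
      gcongr
      linarith
    nlinarith
  have h6 : 2 ^ n / (4 * u n) = 2 ^ n / u n / 4 := by rw [div_div, mul_comm]
  linarith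

/-- A bound for the variance of the mass of the window `(bₙ / 2, bₙ]`: an atom of weight more than
`bₙ^(-15/16)` is unlikely to fall that far from zero. -/
theorem IsAtomLaw.tsum_weight_sq_window_le [IsProbabilityMeasure ρ] (hρ : IsAtomLaw θ ρ)
    (hθ : IsParameter θ) (hq : IsDyadicQuantile θ q) (hu : IsWindowScale θ q u) {n : ℕ}
    (hn : Real.exp (-(u n / 2)) ≤ 1 / u n ^ 15) :
    ∑' i, ENNReal.ofReal (θ (i + 1)) ^ 2 * ρ {x | x i ∈ Ioc (u n ^ 16 / 2) (u n ^ 16)} ≤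
      ENNReal.ofReal (5 * 2 ^ n / u n ^ 15) := by
  have hu0 := hu.pos n
  have h16 : 0 < u n ^ 16 := by positivity
  set W := Ioc (u n ^ 16 / 2) (u n ^ 16)
  have hterm : ∀ i, ENNReal.ofReal (θ (i + 1)) ^ 2 * ρ {x | x i ∈ W} ≤
      ENNReal.ofReal (1 / u n ^ 15) * (ENNReal.ofReal (θ (i + 1)) * ρ {x | x i ∈ W}) +
      ENNReal.ofReal (θ (i + 1)) ^ 2 * ENNReal.ofReal (1 / u n ^ 15) := by
    intro i
    rcases le_or_gt (θ (i + 1)) (1 / u n ^ 15) with hc | hc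
    · refine le_trans ?_ le_self_add
      rw [sq, mul_assoc]
      gcongr
    · refine le_trans ?_ le_add_self
      have ht : 0 < θ (i + 1) := lt_trans (by positivity) hc
      gcongr
      have : ρ {x | x i ∈ W} = expMeasure (θ (i + 1)) W := by
        rw [← hρ.law i ht, Measure.map_apply (measurable_pi_apply i) measurableSet_Ioc]; rfl
      rw [this, expMeasure_Ioc ht (by positivity) (by linarith)]
      refine ENNReal.ofReal_le_ofReal ?_
      have h1 : u n / 2 ≤ θ (i + 1) * (u n ^ 16 / 2) := by
        have : 1 / u n ^ 15 * (u n ^ 16 / 2) = u n / 2 := by field_simp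
        rw [← this]
        gcongr
      have h2 : Real.exp (-(θ (i + 1) * (u n ^ 16 / 2))) ≤ Real.exp (-(u n / 2)) :=
        Real.exp_le_exp.2 (by linarith)
      linarith [Real.exp_pos (-(θ (i + 1) * u n ^ 16))]
  refine (ENNReal.tsum_le_tsum hterm).trans ?_
  rw [ENNReal.tsum_add, ENNReal.tsum_mul_left]
  have h1 : ∑' i, ENNReal.ofReal (θ (i + 1)) * ρ {x | x i ∈ W} ≤ ENNReal.ofReal (2 ^ (n + 2)) := by
    calc _ ≤ ∫⁻ x, mass θ x W ∂ρ := by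
          rw [IsAtomLaw.lintegral_mass measurableSet_Ioc]; exact le_add_self
      _ ≤ _ := by
          rw [hρ.lintegral_mass_Ioc hθ (by positivity) (by linarith)]
          refine ENNReal.ofReal_le_ofReal ?_
          linarith [hu.meanFun_le hθ hq n, meanFun_nonneg hθ (show 0 ≤ u n ^ 16 / 2 by positivity)]
  calc _ ≤ ENNReal.ofReal (1 / u n ^ 15) * ENNReal.ofReal (2 ^ (n + 2)) +
        ENNReal.ofReal (1 / u n ^ 15) := by
        gcongr
        exact tsum_weight_sq_mul_le hθ _ fun i => le_rfl
    _ ≤ _ := by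
        rw [← ENNReal.ofReal_mul (by positivity), ← ENNReal.ofReal_add (by positivity)
          (by positivity)]
        refine ENNReal.ofReal_le_ofReal ?_
        have hp : (1:ℝ) ≤ 2 ^ n := one_le_pow₀ (by norm_num)
        rw [one_div_mul_eq_div, ← add_div, pow_add]
        gcongr
        linarith

/-! ### Charged blocks -/

/-- A lower bound for the number of large terms of a sum, by the Cauchy–Schwarz inequality. -/
theorem card_large_terms_ge {ι : Type*} (s : Finset ι) (v : ι → ℝ) {A B τ : ℝ}
    (hA : 0 ≤ A) (hB : 0 < B) (h1 : A ≤ ∑ j ∈ s, v j)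
    (h2 : ∑ j ∈ s, v j ^ 2 ≤ B) (hτ : s.card * τ ≤ A / 2) [DecidablePred fun j => τ ≤ v j] :
    A ^ 2 / (4 * B) ≤ (s.filter fun j => τ ≤ v j).card := by
  set c := s.filter fun j => τ ≤ v j
  have hsplit := Finset.sum_filter_add_sum_filter_not s (fun j => τ ≤ v j) v
  have hτ0 : 0 ≤ τ ∨ τ < 0 := le_or_gt 0 τ
  have hsmall : ∑ j ∈ s.filter (fun j => ¬ τ ≤ v j), v j ≤ A / 2 := by
    rcases hτ0 with hτ0 | hτ0
    · calc _ ≤ ∑ j ∈ s.filter (fun j => ¬ τ ≤ v j), τ :=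
            Finset.sum_le_sum fun j hj => (not_le.1 (Finset.mem_filter.1 hj).2).le
        _ ≤ s.card * τ := by
            rw [Finset.sum_const, nsmul_eq_mul]
            gcongr
            exact Finset.filter_subset _ _
        _ ≤ _ := hτ
    · calc _ ≤ ∑ j ∈ s.filter (fun j => ¬ τ ≤ v j), (0:ℝ) :=
            Finset.sum_le_sum fun j hj => ((not_le.1 (Finset.mem_filter.1 hj).2).trans hτ0).le
        _ ≤ _ := by simp; linarith
  have hlarge : A / 2 ≤ ∑ j ∈ c, v j := by linarith
  have hcs := sq_sum_le_card_mul_sum_sq (s := c) (f := v)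
  have hsq : ∑ j ∈ c, v j ^ 2 ≤ B := (Finset.sum_le_sum_of_subset_of_nonneg
    (Finset.filter_subset _ _) fun _ _ _ => sq_nonneg _).trans h2
  rw [div_le_iff₀ (by positivity)]
  have : (A / 2) ^ 2 ≤ c.card * B := by
    calc _ ≤ (∑ j ∈ c, v j) ^ 2 := by gcongr
      _ ≤ _ := hcs
      _ ≤ _ := by gcongr
  linarith

theorem blockTop_measurable (n j : ℕ) : MeasurableSet (blockTop u n j) := measurableSet_Ioc

/-- The total mass of the tops is at least half its mean, by Chebyshev's inequality. -/
theorem IsAtomLaw.measure_sum_top_small_le [IsProbabilityMeasure ρ] (hρ : IsAtomLaw θ ρ)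
    (hθ : IsParameter θ) (hq : IsDyadicQuantile θ q) (hu : IsWindowScale θ q u) {n : ℕ}
    (h : 2 ≤ u n) (hn : Real.exp (-(u n / 2)) ≤ 1 / u n ^ 15)
    (hmass : 2 ^ n / u n ≤ meanFun θ (u n ^ 16) - meanFun θ (u n ^ 16 / 2)) :
    ρ {x | ¬ ENNReal.ofReal (2 ^ n / (8 * u n)) ≤
      ∑ j ∈ Finset.range (numBlocks u n), mass θ x (blockTop u n j)} ≤
      ENNReal.ofReal (320 / u n) := by
  have h' : 1 < u n := by linarith
  have hu0 := hu.pos n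
  set M := numBlocks u n
  set U := ⋃ j ∈ Finset.range M, blockTop u n j with hU
  have hUm : MeasurableSet U := Finset.measurableSet_biUnion _ fun j _ => blockTop_measurable n j
  have hdisj : (↑(Finset.range M) : Set ℕ).PairwiseDisjoint (blockTop u n) := fun i _ j _ hij =>
    disjoint_of_blocks h' hij (blockTop_subset h' i) (blockTop_subset h' j)
  have hsum : ∀ x, mass θ x U = ∑ j ∈ Finset.range M, mass θ x (blockTop u n j) := fun x =>
    measure_biUnion_finset hdisj fun j _ => blockTop_measurable n j
  have hmean : ∫⁻ x, mass θ x U ∂ρ =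
      ENNReal.ofReal (∑ j ∈ Finset.range M, topMean θ u n j) := by
    simp_rw [hsum]
    rw [lintegral_finsetSum _ fun j _ => measurable_mass (blockTop_measurable n j),
      ENNReal.ofReal_sum_of_nonneg fun j _ => topMean_nonneg hθ h' j]
    exact Finset.sum_congr rfl fun j _ => hρ.lintegral_blockTop hθ h' j
  set m := ∑ j ∈ Finset.range M, topMean θ u n j
  have hm : 2 ^ n / (4 * u n) ≤ m := sum_topMean_ge hθ hq hu h hmass
  have hm0 : 0 < m := lt_of_lt_of_le (by positivity) hm
  have hsq := hρ.lintegral_mass_sq_le (θ := θ) hUm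
  rw [hmean] at hsq
  have hUW : U ⊆ Ioc (u n ^ 16 / 2) (u n ^ 16) := by
    refine iUnion₂_subset fun j hj => (blockTop_subset h' j).trans
      (block_subset_window h' (Finset.mem_range.1 hj))
  have hvar : ∑' i, ENNReal.ofReal (θ (i + 1)) ^ 2 * ρ {x | x i ∈ U} ≤
      ENNReal.ofReal (5 * 2 ^ n / u n ^ 15) :=
    (ENNReal.tsum_le_tsum fun i => by gcongr).trans
      (hρ.tsum_weight_sq_window_le hθ hq hu hn)
  have hcheb := measure_far_from_mean_le (ρ := ρ) (measurable_mass hUm) (t := m / 2)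
    (s := 5 * 2 ^ n / u n ^ 15) hm0.le (by positivity) (by positivity) hmean
    (hsq.trans (by gcongr))
  refine (measure_mono fun x hx => ?_).trans (hcheb.trans (ENNReal.ofReal_le_ofReal ?_))
  · intro hx'
    refine hx (le_trans (ENNReal.ofReal_le_ofReal ?_) (hx'.1.trans (hsum x).le))
    have : 2 ^ n / (8 * u n) = 2 ^ n / (4 * u n) / 2 := by rw [div_div]; congr 1; ring
    linarith
  · have h3 : (2 ^ n / (8 * u n)) ^ 2 ≤ (m / 2) ^ 2 := by
      have : 2 ^ n / (8 * u n) = 2 ^ n / (4 * u n) / 2 := by rw [div_div]; congr 1; ring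
      rw [this]
      gcongr
    refine (div_le_div_of_nonneg_left (by positivity) (by positivity) h3).trans ?_
    have hp : (1:ℝ) ≤ 2 ^ n := one_le_pow₀ (by norm_num)
    have e : 5 * 2 ^ n / u n ^ 15 / (2 ^ n / (8 * u n)) ^ 2 =
        320 / u n * (1 / (2 ^ n * u n ^ 12)) := by
      field_simp; ring
    rw [e]
    refine mul_le_of_le_one_right (by positivity) ?_
    rw [div_le_one (by positivity)]
    exact one_le_mul_of_one_le_of_one_le hp (one_le_pow₀ (by linarith))

/-- The mass of the tops is not concentrated on few of them, by Markov's inequality for the sum of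
the squares. -/
theorem IsAtomLaw.measure_sum_sq_top_large_le [IsProbabilityMeasure ρ] (hρ : IsAtomLaw θ ρ)
    (hθ : IsParameter θ) (hq : IsDyadicQuantile θ q) (hu : IsWindowScale θ q u) {n : ℕ}
    (h : 2 ≤ u n) (hn : Real.exp (-(u n / 2)) ≤ 1 / u n ^ 15) :
    ρ {x | ¬ ∑ j ∈ Finset.range (numBlocks u n), mass θ x (blockTop u n j) ^ 2 ≤
      ENNReal.ofReal (2 ^ n / u n ^ 14)} ≤ ENNReal.ofReal (7 / u n) := by
  have h' : 1 < u n := by linarith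
  have hu0 := hu.pos n
  set M := numBlocks u n
  set δ := Real.log (u n) / (2 * u n ^ 16)
  have hδ0 : 0 ≤ δ := div_nonneg (Real.log_nonneg h'.le) (by positivity)
  have hm : ∀ j, Measurable fun x => mass θ x (blockTop u n j) := fun j =>
    measurable_mass (blockTop_measurable n j)
  have hdisj : (↑(Finset.range M) : Set ℕ).PairwiseDisjoint (blockTop u n) := fun i _ j _ hij =>
    disjoint_of_blocks h' hij (blockTop_subset h' i) (blockTop_subset h' j)
  have hUW : ⋃ j ∈ Finset.range M, blockTop u n j ⊆ Ioc (u n ^ 16 / 2) (u n ^ 16) :=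
    iUnion₂_subset fun j hj => (blockTop_subset h' j).trans
      (block_subset_window h' (Finset.mem_range.1 hj))
  have hmeans : ∑ j ∈ Finset.range M, ∫⁻ x, mass θ x (blockTop u n j) ∂ρ ≤
      ENNReal.ofReal (2 ^ (n + 2)) := by
    rw [← lintegral_finsetSum _ fun j _ => hm j]
    have : ∀ x, ∑ j ∈ Finset.range M, mass θ x (blockTop u n j) ≤ mass θ x (Icc 0 (u n ^ 16)) := by
      intro x
      rw [← measure_biUnion_finset hdisj fun j _ => blockTop_measurable n j]
      refine measure_mono (hUW.trans fun t ht => ⟨?_, ht.2⟩)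
      exact le_trans (by positivity) ht.1.le
    refine (lintegral_mono this).trans ?_
    rw [hρ.lintegral_mass_Icc hθ (by positivity)]
    exact ENNReal.ofReal_le_ofReal (hu.meanFun_le hθ hq n)
  have hprob : ∀ i, ∑ j ∈ Finset.range M, ρ {x | x i ∈ blockTop u n j} ≤
      ρ {x | x i ∈ Ioc (u n ^ 16 / 2) (u n ^ 16)} := by
    intro i
    rw [← measure_biUnion_finset (f := fun j => {x : ℕ → ℝ | x i ∈ blockTop u n j})]
    · refine measure_mono (iUnion₂_subset fun j hj x hx => hUW (mem_biUnion hj hx))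
    · intro j hj k hk hjk
      exact (hdisj hj hk hjk).preimage (fun x : ℕ → ℝ => x i)
    · exact fun j _ => measurable_pi_apply i (blockTop_measurable n j)
  have hint : ∫⁻ x, ∑ j ∈ Finset.range M, mass θ x (blockTop u n j) ^ 2 ∂ρ ≤
      ENNReal.ofReal (7 * 2 ^ n / u n ^ 15) := by
    rw [lintegral_finsetSum _ fun j _ => (hm j).pow_const 2]
    calc _ ≤ ∑ j ∈ Finset.range M, (ENNReal.ofReal δ * ∫⁻ x, mass θ x (blockTop u n j) ∂ρ +
          ∑' i, ENNReal.ofReal (θ (i + 1)) ^ 2 * ρ {x | x i ∈ blockTop u n j}) := by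
          refine Finset.sum_le_sum fun j hj => ?_
          refine (hρ.lintegral_mass_sq_le (blockTop_measurable n j)).trans ?_
          rw [sq]
          gcongr
          rw [hρ.lintegral_blockTop hθ h']
          exact ENNReal.ofReal_le_ofReal (topMean_le hθ hq hu h' (Finset.mem_range.1 hj))
      _ = ENNReal.ofReal δ * ∑ j ∈ Finset.range M, ∫⁻ x, mass θ x (blockTop u n j) ∂ρ +
          ∑' i, ENNReal.ofReal (θ (i + 1)) ^ 2 *
            ∑ j ∈ Finset.range M, ρ {x | x i ∈ blockTop u n j} := by
          rw [Finset.sum_add_distrib, ← Finset.mul_sum,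
            ← Summable.tsum_finsetSum fun _ _ => ENNReal.summable]
          simp_rw [Finset.mul_sum]
      _ ≤ ENNReal.ofReal δ * ENNReal.ofReal (2 ^ (n + 2)) +
          ENNReal.ofReal (5 * 2 ^ n / u n ^ 15) := by
          gcongr
          refine (ENNReal.tsum_le_tsum fun i => ?_).trans
            (hρ.tsum_weight_sq_window_le hθ hq hu hn)
          gcongr
          exact hprob i
      _ ≤ _ := by
          rw [← ENNReal.ofReal_mul hδ0, ← ENNReal.ofReal_add (by positivity) (by positivity)]
          refine ENNReal.ofReal_le_ofReal ?_
          have hl : Real.log (u n) ≤ u n :=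
            (Real.log_le_sub_one_of_pos (by linarith)).trans (by linarith)
          have : δ * 2 ^ (n + 2) ≤ 2 * 2 ^ n / u n ^ 15 := by
            calc δ * 2 ^ (n + 2) ≤ u n / (2 * u n ^ 16) * 2 ^ (n + 2) := by
                  simp only [δ]; gcongr
              _ = _ := by field_simp; ring
          calc _ ≤ 2 * 2 ^ n / u n ^ 15 + 5 * 2 ^ n / u n ^ 15 := by gcongr
            _ = _ := by ring
  have hfin := measure_gt_ofReal_le (ρ := ρ) (t := 2 ^ n / u n ^ 14)
    (f := fun x => ∑ j ∈ Finset.range M, mass θ x (blockTop u n j) ^ 2)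
    (Finset.measurable_fun_sum _ fun j _ => (hm j).pow_const 2).aemeasurable (by positivity) hint
  refine hfin.trans (ENNReal.ofReal_le_ofReal (le_of_eq ?_))
  field_simp

theorem card_chargedBlocks_ge (hu : IsWindowScale θ q u) {x : ℕ → ℝ} {n : ℕ}
    (h : 16 ≤ u n) (hlog : 3 ≤ Real.log (u n))
    (h1 : ENNReal.ofReal (2 ^ n / (8 * u n)) ≤
      ∑ j ∈ Finset.range (numBlocks u n), mass θ x (blockTop u n j))
    (h2 : ∑ j ∈ Finset.range (numBlocks u n), mass θ x (blockTop u n j) ^ 2 ≤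
      ENNReal.ofReal (2 ^ n / u n ^ 14)) :
    2 ^ n * u n ^ 12 / 256 ≤ (chargedBlocks θ u x n).card := by
  classical
  have h' : 1 < u n := by linarith
  have hu0 := hu.pos n
  set M := numBlocks u n
  have hfin : ∀ j ∈ Finset.range M, mass θ x (blockTop u n j) ≠ ∞ := by
    intro j hj htop
    have := (Finset.single_le_sum (f := fun j => mass θ x (blockTop u n j) ^ 2)
      (fun _ _ => zero_le) hj).trans h2
    simp [htop] at this
  have h1' : 2 ^ n / (8 * u n) ≤
      ∑ j ∈ Finset.range M, (mass θ x (blockTop u n j)).toReal := by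
    rw [← ENNReal.toReal_sum hfin]
    exact (ENNReal.ofReal_le_iff_le_toReal (by simpa using hfin)).1 h1
  have h2' : ∑ j ∈ Finset.range M, (mass θ x (blockTop u n j)).toReal ^ 2 ≤ 2 ^ n / u n ^ 14 := by
    simp_rw [← ENNReal.toReal_pow]
    rw [← ENNReal.toReal_sum fun j hj => ENNReal.pow_ne_top (hfin j hj)]
    exact ENNReal.toReal_le_of_le_ofReal (by positivity) h2
  have hM : (M : ℝ) ≤ 2 ^ n * u n ^ 16 := by
    have := numBlocks_mul_le h'
    have e : 6 * blockLen u n = 3 * Real.log (u n) / 8 / 2 ^ n := by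
      unfold blockLen; field_simp; norm_num
    rw [e] at this
    have h3 : 1 / 2 ^ n ≤ 3 * Real.log (u n) / 8 / 2 ^ n := by gcongr; linarith
    have h4 : (M : ℝ) * (1 / 2 ^ n) ≤ u n ^ 16 := le_trans (by gcongr) this
    rwa [mul_one_div, div_le_iff₀ (by positivity), mul_comm] at h4
  have key := card_large_terms_ge (Finset.range M) (fun j => (mass θ x (blockTop u n j)).toReal)
    (A := 2 ^ n / (8 * u n)) (B := 2 ^ n / u n ^ 14) (τ := 1 / u n ^ 18) (by positivity)
    (by positivity) h1' h2' (by
      rw [Finset.card_range]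
      calc (M : ℝ) * (1 / u n ^ 18) ≤ 2 ^ n * u n ^ 16 * (1 / u n ^ 18) := by gcongr
        _ = 2 ^ n / (16 * u n) * (16 / u n) := by field_simp
        _ ≤ 2 ^ n / (16 * u n) * 1 := by
          gcongr
          rw [div_le_one hu0]; exact h
        _ = _ := by field_simp; norm_num)
  have e : (2 ^ n / (8 * u n)) ^ 2 / (4 * (2 ^ n / u n ^ 14)) = 2 ^ n * u n ^ 12 / 256 := by
    field_simp; norm_num
  rw [e] at key
  refine key.trans ?_
  gcongr
  intro j hj
  rw [Finset.mem_filter] at hj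
  refine Finset.mem_filter.2 ⟨hj.1, ?_⟩
  exact (ENNReal.ofReal_le_iff_le_toReal (hfin j hj.1)).2 hj.2

/-- Almost surely, many blocks of each large scale are charged. -/
theorem IsAtomLaw.ae_card_chargedBlocks [IsProbabilityMeasure ρ] (hρ : IsAtomLaw θ ρ)
    (hθ : IsParameter θ) (hq : IsDyadicQuantile θ q) (hu : IsWindowScale θ q u) :
    ∀ᵐ x ∂ρ, ∀ᶠ n in atTop, 2 ^ n * u n ^ 12 / 256 ≤ ((chargedBlocks θ u x n).card : ℝ) := by
  have hut := hu.tendsto hθ hq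
  have hexp : ∀ᶠ n in atTop, Real.exp (-(u n / 2)) ≤ 1 / u n ^ 15 := by
    have h1 := (Real.tendsto_pow_mul_exp_neg_atTop_nhds_zero 15).comp
      (hut.atTop_div_const (show (0:ℝ) < 2 by norm_num))
    filter_upwards [h1.eventually (gt_mem_nhds (show (0:ℝ) < 1 / 2 ^ 15 by norm_num))] with n hn
    have := hu.pos n
    simp only [Function.comp_apply] at hn
    rw [le_div_iff₀ (by positivity)]
    have e : (u n / 2) ^ 15 = u n ^ 15 / 2 ^ 15 := by rw [div_pow]
    rw [e] at hn
    nlinarith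
  have hlog := (Real.tendsto_log_atTop.comp hut).eventually_ge_atTop 3
  have hV := ae_eventually_of_summable (ρ := ρ) (p := fun n x =>
    ENNReal.ofReal (2 ^ n / (8 * u n)) ≤
      ∑ j ∈ Finset.range (numBlocks u n), mass θ x (blockTop u n j)) (g := fun n => 320 / u n)
    (by simpa [div_eq_mul_inv] using (hu.summable_inv hθ hq).mul_left 320) (by
      filter_upwards [hexp, hut.eventually_ge_atTop 2, hu.mass_le] with n h1 h2 h3
      exact hρ.measure_sum_top_small_le hθ hq hu h2 h1 h3)
  have hQ := ae_eventually_of_summable (ρ := ρ) (p := fun n x =>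
    ∑ j ∈ Finset.range (numBlocks u n), mass θ x (blockTop u n j) ^ 2 ≤
      ENNReal.ofReal (2 ^ n / u n ^ 14)) (g := fun n => 7 / u n)
    (by simpa [div_eq_mul_inv] using (hu.summable_inv hθ hq).mul_left 7) (by
      filter_upwards [hexp, hut.eventually_ge_atTop 2] with n h1 h2
      exact hρ.measure_sum_sq_top_large_le hθ hq hu h2 h1)
  filter_upwards [hV, hQ] with x h1 h2
  filter_upwards [h1, h2, hut.eventually_ge_atTop 16, hlog] with n h3 h4 h5 h6
  exact card_chargedBlocks_ge hu h5 h6 h3 h4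

end

/-! ### Poisson point processes -/

theorem lintegral_poissonMeasure (r : ℝ≥0) : ∫⁻ n : ℕ, (n : ℝ≥0∞) ∂poissonMeasure r = r := by
  rw [lintegral_countable']
  simp_rw [poissonMeasure_singleton]
  rw [tsum_eq_zero_add' ENNReal.summable]
  simp only [Nat.cast_zero, zero_mul, zero_add]
  have h1 : ∀ n : ℕ, ((n + 1 : ℕ) : ℝ≥0∞) *
      ENNReal.ofReal (Real.exp (-r) * r ^ (n + 1) / (n + 1).factorial) =
      r * ENNReal.ofReal (Real.exp (-r) * r ^ n / n.factorial) := by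
    intro n
    rw [← ENNReal.ofReal_natCast, ← ENNReal.ofReal_mul (by positivity), ← ENNReal.ofReal_coe_nnreal,
      ← ENNReal.ofReal_mul (NNReal.coe_nonneg r)]
    congr 1
    rw [Nat.factorial_succ]
    push_cast
    have : (n : ℝ) + 1 ≠ 0 := by positivity
    field_simp
    ring
  simp_rw [h1]
  rw [ENNReal.tsum_mul_left, ← ENNReal.ofReal_tsum_of_nonneg (fun n => by positivity)
    (hasSum_one_poissonMeasure r).summable, (hasSum_one_poissonMeasure r).tsum_eq]
  simp

theorem count_eq_zero {A : Set ℝ} {y : ℕ → ℝ} : count A y = 0 ↔ ∀ i, y i ∉ A := by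
  rw [count, Set.encard_eq_zero, Set.eq_empty_iff_forall_notMem]
  rfl

namespace IsPoissonPointProcess

variable {Q : Measure (ℕ → ℝ)} {Λ : Measure ℝ}

theorem aemeasurable_count (h : IsPoissonPointProcess Q Λ) {A : Set ℝ} (hA : MeasurableSet A)
    (hfin : Λ A ≠ ∞) : AEMeasurable (count A) Q := by
  refine AEMeasurable.of_map_ne_zero ?_
  rw [h.law_count A hA hfin]
  intro h0
  have h1 := congrArg (fun m : Measure ℕ∞ => m univ) h0
  simp at h1

theorem measure_empty (h : IsPoissonPointProcess Q Λ) {A : Set ℝ} (hA : MeasurableSet A)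
    (hfin : Λ A ≠ ∞) : Q {y | ∀ i, y i ∉ A} = ENNReal.ofReal (Real.exp (-(Λ A).toReal)) := by
  have h1 : Q.map (count A) {0} = Q {y | ∀ i, y i ∉ A} := by
    rw [Measure.map_apply_of_aemeasurable (h.aemeasurable_count hA hfin)
      (measurableSet_singleton _)]
    congr 1
    ext y
    simp [count_eq_zero]
  rw [← h1, h.law_count A hA hfin, Measure.map_apply .of_discrete (measurableSet_singleton _)]
  have : (fun n : ℕ => (n : ℕ∞)) ⁻¹' {0} = {0} := by ext n; simp
  rw [this, poissonMeasure_singleton]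
  simp [ENNReal.coe_toNNReal_eq_toReal]

theorem measurableSet_empty {A : Set ℝ} (hA : MeasurableSet A) :
    MeasurableSet {y : ℕ → ℝ | ∀ i, y i ∉ A} := by
  have : {y : ℕ → ℝ | ∀ i, y i ∉ A} = ⋂ i, (fun y : ℕ → ℝ => y i) ⁻¹' Aᶜ := by ext; simp
  rw [this]
  exact MeasurableSet.iInter fun i => measurable_pi_apply i hA.compl

theorem ae_empty [IsProbabilityMeasure Q] (h : IsPoissonPointProcess Q Λ) {A : Set ℝ}
    (hA : MeasurableSet A) (h0 : Λ A = 0) : ∀ᵐ y ∂Q, ∀ i, y i ∉ A := by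
  have h1 := h.measure_empty hA (by simp [h0])
  rw [h0] at h1
  exact (mem_ae_iff_prob_eq_one (measurableSet_empty hA)).2 (by simpa using h1)

theorem lintegral_count (h : IsPoissonPointProcess Q Λ) {A : Set ℝ} (hA : MeasurableSet A)
    (hfin : Λ A ≠ ∞) : ∫⁻ y, (count A y : ℝ≥0∞) ∂Q = Λ A := by
  have h1 : ∫⁻ c, (c : ℝ≥0∞) ∂Q.map (count A) = ∫⁻ y, (count A y : ℝ≥0∞) ∂Q :=
    lintegral_map' (Measurable.of_discrete (f := fun c : ℕ∞ => (c : ℝ≥0∞))).aemeasurable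
      (h.aemeasurable_count hA hfin)
  rw [← h1, h.law_count A hA hfin, lintegral_map .of_discrete .of_discrete]
  simp only [ENat.toENNReal_coe]
  rw [lintegral_poissonMeasure, ENNReal.coe_toNNReal hfin]

theorem ae_count_ne_top (h : IsPoissonPointProcess Q Λ) {A : Set ℝ} (hA : MeasurableSet A)
    (hfin : Λ A ≠ ∞) : ∀ᵐ y ∂Q, count A y ≠ ⊤ := by
  have h2 : ∀ᵐ c ∂Q.map (count A), c ≠ ⊤ := by
    rw [h.law_count A hA hfin, ae_map_iff (by fun_prop) .of_discrete]
    exact ae_of_all _ fun n => ENat.natCast_ne_top n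
  exact ae_of_ae_map (h.aemeasurable_count hA hfin) h2

/-- For disjoint sets, the event that `A 0` contains a point and `A 1` none is independent of the
same event for `A 2` and `A 3`, and its probability is the product of those of its two parts. -/
theorem measure_hit_inter_empty (h : IsPoissonPointProcess Q Λ) {A : Fin 4 → Set ℝ}
    (hA : ∀ i, MeasurableSet (A i)) (hd : Pairwise fun i j => Disjoint (A i) (A j)) :
    Q ({y | (∃ i, y i ∈ A 0) ∧ ∀ i, y i ∉ A 1} ∩ {y | (∃ i, y i ∈ A 2) ∧ ∀ i, y i ∉ A 3}) =
      Q {y | (∃ i, y i ∈ A 0) ∧ ∀ i, y i ∉ A 1} * Q {y | (∃ i, y i ∈ A 2) ∧ ∀ i, y i ∉ A 3} ∧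
    Q {y | (∃ i, y i ∈ A 0) ∧ ∀ i, y i ∉ A 1} =
      Q {y | ∃ i, y i ∈ A 0} * Q {y | ∀ i, y i ∉ A 1} := by
  have hi := h.indep_count 4 A hA hd
  set S : Fin 4 → Set ℕ∞ := ![{0}ᶜ, {0}, {0}ᶜ, {0}] with hS
  have hm : ∀ (s : Finset (Fin 4)), ∀ i ∈ s, MeasurableSet (S i) := fun _ _ _ => .of_discrete
  have e0 : ∀ i, (count (A i)) ⁻¹' {0}ᶜ = {y | ∃ j, y j ∈ A i} := fun i => by
    ext y; simp [count_eq_zero]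
  have e1 : ∀ i, (count (A i)) ⁻¹' {0} = {y | ∀ j, y j ∉ A i} := fun i => by
    ext y; simp [count_eq_zero]
  have h4 := hi.measure_inter_preimage_eq_mul {0, 1, 2, 3} (hm _)
  have h01 := hi.measure_inter_preimage_eq_mul {0, 1} (hm _)
  have h23 := hi.measure_inter_preimage_eq_mul {2, 3} (hm _)
  simp [hS, e0, e1] at h4 h01 h23
  have i1 : {y : ℕ → ℝ | (∃ i, y i ∈ A 0) ∧ ∀ i, y i ∉ A 1} =
      {y | ∃ i, y i ∈ A 0} ∩ {y | ∀ i, y i ∉ A 1} := rfl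
  have i2 : {y : ℕ → ℝ | (∃ i, y i ∈ A 2) ∧ ∀ i, y i ∉ A 3} =
      {y | ∃ i, y i ∈ A 2} ∩ {y | ∀ i, y i ∉ A 3} := rfl
  rw [i1, i2, h01, h23, inter_assoc, h4, mul_assoc]
  exact ⟨rfl, rfl⟩

end IsPoissonPointProcess

/-! ### The intensity of the cuts -/

section Intensity

variable {θ x : ℕ → ℝ}

theorem mass_Icc_mono {a b : ℝ} (hab : a ≤ b) : mass θ x (Icc 0 a) ≤ mass θ x (Icc 0 b) :=
  measure_mono (Icc_subset_Icc_right hab)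

theorem cutIntensity_le {a b : ℝ} {A : Set ℝ} (hA : MeasurableSet A) (h : A ⊆ Icc a b) :
    cutIntensity θ x A ≤ ENNReal.ofReal (b - a) * mass θ x (Icc 0 b) := by
  rw [cutIntensity, withDensity_apply _ hA]
  calc _ ≤ ∫⁻ _ in A, mass θ x (Icc 0 b) ∂(volume.restrict (Ici 0)) :=
        setLIntegral_mono measurable_const fun t ht => mass_Icc_mono (h ht).2
    _ = mass θ x (Icc 0 b) * (volume.restrict (Ici 0)) A := by rw [setLIntegral_const]
    _ ≤ mass θ x (Icc 0 b) * volume (Icc a b) := by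
        gcongr
        exact Measure.restrict_le_self
    _ = _ := by rw [Real.volume_Icc, mul_comm]

theorem le_cutIntensity {a b : ℝ} (ha : 0 ≤ a) {A : Set ℝ}
    (h : Ioo a b ⊆ A) : ENNReal.ofReal (b - a) * mass θ x (Icc 0 a) ≤ cutIntensity θ x A := by
  refine le_trans ?_ (measure_mono h)
  rw [cutIntensity, withDensity_apply _ measurableSet_Ioo]
  have hsub : Ioo a b ⊆ Ici 0 := fun t ht => ha.trans ht.1.le
  calc _ = mass θ x (Icc 0 a) * (volume.restrict (Ici 0)) (Ioo a b) := by
        rw [Measure.restrict_apply measurableSet_Ioo, inter_eq_left.2 hsub, Real.volume_Ioo,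
          mul_comm]
    _ = ∫⁻ _ in Ioo a b, mass θ x (Icc 0 a) ∂(volume.restrict (Ici 0)) := by
        rw [setLIntegral_const]
    _ ≤ _ := setLIntegral_mono' measurableSet_Ioo fun t ht => mass_Icc_mono ht.1.le

theorem cutIntensity_ne_top (hfin : ∀ l, mass θ x (Icc 0 l) ≠ ∞) {a b : ℝ} {A : Set ℝ}
    (hA : MeasurableSet A) (h : A ⊆ Icc a b) : cutIntensity θ x A ≠ ∞ :=
  ne_top_of_le_ne_top (ENNReal.mul_ne_top ENNReal.ofReal_ne_top (hfin b)) (cutIntensity_le hA h)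

theorem cutIntensity_Iio_zero : cutIntensity θ x (Iio 0) = 0 := by
  rw [cutIntensity, withDensity_apply _ measurableSet_Iio,
    Measure.restrict_restrict measurableSet_Iio]
  have : Iio (0:ℝ) ∩ Ici 0 = ∅ := by ext; simp
  rw [this]
  simp

theorem ae_cuts_regular {Q : Measure (ℕ → ℝ)} [IsProbabilityMeasure Q]
    (h : IsPoissonPointProcess Q (cutIntensity θ x)) (hfin : ∀ l, mass θ x (Icc 0 l) ≠ ∞) :
    ∀ᵐ y ∂Q, StrictMono y ∧ (∀ i, 0 ≤ y i) ∧ Tendsto y atTop atTop := by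
  have h2 : ∀ᵐ y ∂Q, ∀ N : ℕ, count (Icc 0 (N : ℝ)) y ≠ ⊤ := ae_all_iff.2 fun N =>
    h.ae_count_ne_top measurableSet_Icc (cutIntensity_ne_top hfin measurableSet_Icc subset_rfl)
  filter_upwards [h.strictMono, h.ae_empty measurableSet_Iio cutIntensity_Iio_zero, h2]
    with y hy1 hy2 hy3
  have h0 : ∀ i, 0 ≤ y i := fun i => not_lt.1 (hy2 i)
  refine ⟨hy1, h0, tendsto_atTop_atTop_of_monotone hy1.monotone fun b => ?_⟩
  by_contra! hcon
  obtain ⟨N, hN⟩ := exists_nat_ge b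
  apply hy3 N
  have : {i | y i ∈ Icc (0:ℝ) N} = univ := eq_univ_of_forall fun i =>
    ⟨h0 i, (hcon i).le.trans hN⟩
  rw [count, this, Set.encard_univ]
  simp

end Intensity

/-! ### Long gaps between cuts in many blocks -/

section

variable {θ q u x : ℕ → ℝ} {Q : Measure (ℕ → ℝ)}

/-- Among pairwise independent events, each of probability at least `p`, a proportion `p / 2`
occurs with high probability. -/
theorem measure_card_filter_small_le {Ω : Type*} [MeasurableSpace Ω] {ρ : Measure Ω}
    [IsProbabilityMeasure ρ] (C : Finset ℕ) {s : ℕ → Set Ω} (hs : ∀ j, MeasurableSet (s j))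
    (hind : ∀ i ∈ C, ∀ j ∈ C, i ≠ j → ρ (s i ∩ s j) = ρ (s i) * ρ (s j)) {p : ℝ} (hp : 0 < p)
    (hps : ∀ j ∈ C, ENNReal.ofReal p ≤ ρ (s j)) (hC : 0 < C.card)
    [∀ ω, DecidablePred fun j => ω ∈ s j] :
    ρ {ω | ¬ p * C.card / 2 ≤ (C.filter fun j => ω ∈ s j).card} ≤
      ENNReal.ofReal (4 / (p * C.card)) := by
  classical
  have hC' : (0:ℝ) < C.card := by exact_mod_cast hC
  set a : ℕ → Ω → ℝ≥0∞ := fun j => if j ∈ C then (s j).indicator 1 else 0 with ha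
  have ham : ∀ j, Measurable (a j) := fun j => by
    by_cases hj : j ∈ C <;> simp only [ha, hj, if_true, if_false]
    · exact measurable_one.indicator (hs j)
    · exact measurable_zero
  have hint : ∀ j, ∫⁻ ω, a j ω ∂ρ = if j ∈ C then ρ (s j) else 0 := fun j => by
    by_cases hj : j ∈ C <;> simp [ha, hj, lintegral_indicator_one (hs j)]
  have hsq : ∀ j ω, a j ω ^ 2 = a j ω := fun j ω => by
    by_cases hj : j ∈ C <;> by_cases hω : ω ∈ s j <;> simp [ha, hj, hω]
  have hprod : ∀ i j, i ≠ j → ∫⁻ ω, a i ω * a j ω ∂ρ = (∫⁻ ω, a i ω ∂ρ) * ∫⁻ ω, a j ω ∂ρ := by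
    intro i j hij
    by_cases hi : i ∈ C
    swap
    · simp [ha, hi]
    by_cases hj : j ∈ C
    swap
    · simp [ha, hj]
    rw [hint, hint, if_pos hi, if_pos hj, ← hind i hi j hj hij,
      ← lintegral_indicator_one ((hs i).inter (hs j))]
    refine lintegral_congr fun ω => ?_
    by_cases h1 : ω ∈ s i <;> by_cases h2 : ω ∈ s j <;> simp [ha, hi, hj, h1, h2]
  have hsum : ∀ ω, 0 + ∑' j, a j ω = ((C.filter fun j => ω ∈ s j).card : ℝ≥0∞) := by
    intro ω
    rw [zero_add, tsum_eq_sum (s := C) (fun j hj => by simp [ha, hj]), Finset.card_filter,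
      Nat.cast_sum]
    refine Finset.sum_congr rfl fun j hj => ?_
    by_cases h1 : ω ∈ s j <;> simp [ha, hj, h1]
  set m : ℝ := ∑ j ∈ C, (ρ (s j)).toReal with hm
  have hpm : p * C.card ≤ m := by
    rw [hm, mul_comm, ← nsmul_eq_mul]
    exact Finset.card_nsmul_le_sum _ _ _ fun j hj =>
      (ENNReal.ofReal_le_iff_le_toReal (measure_ne_top _ _)).1 (hps j hj)
  have hm0 : 0 < m := lt_of_lt_of_le (by positivity) hpm
  have htot : ∑' j, ∫⁻ ω, a j ω ∂ρ = ENNReal.ofReal m := by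
    simp_rw [hint]
    rw [tsum_eq_sum (s := C) (fun j hj => by simp [hj]), hm,
      ENNReal.ofReal_sum_of_nonneg fun _ _ => ENNReal.toReal_nonneg]
    refine Finset.sum_congr rfl fun j hj => ?_
    rw [if_pos hj, ENNReal.ofReal_toReal (measure_ne_top _ _)]
  have hmean : ∫⁻ ω, (0 + ∑' j, a j ω) ∂ρ = ENNReal.ofReal m := by
    simp_rw [zero_add]
    rw [lintegral_tsum fun j => (ham j).aemeasurable, htot]
  have h2 := lintegral_const_add_tsum_sq_le (ρ := ρ) 0 ham hprod
  simp_rw [hsq] at h2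
  rw [hmean, htot] at h2
  have hcheb := measure_far_from_mean_le (ρ := ρ) (f := fun ω => 0 + ∑' j, a j ω)
    (measurable_const.add (Measurable.tsum ham)) (t := m / 2) hm0.le hm0.le (by positivity) hmean h2
  refine (measure_mono fun ω hω => ?_).trans (hcheb.trans (ENNReal.ofReal_le_ofReal ?_))
  · intro hω'
    refine hω ?_
    have h3 := hω'.1
    rw [hsum, ← ENNReal.ofReal_natCast, ENNReal.ofReal_le_ofReal_iff (by positivity)] at h3
    linarith
  · rw [div_le_div_iff₀ (by positivity) (by positivity)]
    nlinarith

/-- A block with a cut in its head and no cut in the rest. -/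
def IsCutBlock (u y : ℕ → ℝ) (n j : ℕ) : Prop :=
  (∃ i, y i ∈ blockHead u n j) ∧ ∀ i, y i ∉ blockTail u n j

open Classical in
/-- The set of the charged blocks of scale `n` with a cut in the head and no cut in the rest. -/
noncomputable def cutBlocks (θ u x y : ℕ → ℝ) (n : ℕ) : Finset ℕ :=
  (chargedBlocks θ u x n).filter (IsCutBlock u y n)

/-- The mass of `[0, 𝒳(2ⁿ)]` is comparable to `2ⁿ`. -/
def MassRegular (θ q x : ℕ → ℝ) (n : ℕ) : Prop :=
  ENNReal.ofReal (2 ^ n / 2) ≤ mass θ x (Icc 0 (q n)) ∧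
    mass θ x (Icc 0 (q n)) ≤ ENNReal.ofReal (2 * 2 ^ n)

theorem mass_ne_top (hθ : IsParameter θ) (hq : IsDyadicQuantile θ q)
    (hx : ∀ᶠ n in atTop, MassRegular θ q x n) (l : ℝ) : mass θ x (Icc 0 l) ≠ ∞ := by
  obtain ⟨n, h1, h2⟩ := (hx.and ((hq.tendsto hθ).eventually_ge_atTop l)).exists
  exact ne_top_of_le_ne_top ENNReal.ofReal_ne_top ((mass_Icc_mono h2).trans h1.2)

theorem isCutBlock_measurable (n j : ℕ) : MeasurableSet {y | IsCutBlock u y n j} := by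
  have h1 : MeasurableSet {y : ℕ → ℝ | ∃ i, y i ∈ blockHead u n j} := by
    have : {y : ℕ → ℝ | ∃ i, y i ∈ blockHead u n j} =
        ⋃ i, (fun y : ℕ → ℝ => y i) ⁻¹' blockHead u n j := by ext; simp
    rw [this]
    exact MeasurableSet.iUnion fun i => measurable_pi_apply i measurableSet_Ioc
  exact h1.inter (IsPoissonPointProcess.measurableSet_empty measurableSet_Ioc)

theorem disjoint_head_tail (n j : ℕ) : Disjoint (blockHead u n j) (blockTail u n j) := by
  rw [Set.disjoint_left]
  exact fun t h1 h2 => absurd h1.2 (not_le.2 h2.1)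

/-- The intensity of the cuts is of order `2ⁿ` on the window, and `blockLen` is chosen so small that
the tail of a block contains no cut with probability at least `1 / uₙ`. -/
theorem measure_isCutBlock_ge [IsProbabilityMeasure Q]
    (hQ : IsPoissonPointProcess Q (cutIntensity θ x)) (hθ : IsParameter θ)
    (hq : IsDyadicQuantile θ q) (hu : IsWindowScale θ q u) {n : ℕ}
    (hfin : ∀ l, mass θ x (Icc 0 l) ≠ ∞) (h1 : MassRegular θ q x n)
    (h2 : MassRegular θ q x (n + 2)) (hlog : 32 ≤ Real.log (u n)) {j : ℕ}
    (hj : j < numBlocks u n)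
    (hmul : Q {y | IsCutBlock u y n j} = Q {y | ∃ i, y i ∈ blockHead u n j} *
      Q {y | ∀ i, y i ∉ blockTail u n j}) :
    ENNReal.ofReal (1 / (2 * u n)) ≤ Q {y | IsCutBlock u y n j} := by
  have hu0 := hu.pos n
  have h' : 1 < u n := by
    by_contra! h
    have := Real.log_nonpos hu0.le h
    linarith
  have hl := blockLen_pos h'
  have hs := blockStart_ge h' j
  have he := blockEnd_le h' hj
  have hqn := hu.le_pow n
  have hq0 := hq.pos hθ n
  have e1 : blockLen u n * (2 ^ n / 2) = Real.log (u n) / 32 := by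
    unfold blockLen; field_simp; norm_num
  have e2 : 2 * blockLen u n * (2 * 2 ^ (n + 2)) = Real.log (u n) := by
    unfold blockLen; field_simp; ring
  have htail : cutIntensity θ x (blockTail u n j) ≤ ENNReal.ofReal (Real.log (u n)) := by
    refine (cutIntensity_le measurableSet_Ioc Ioc_subset_Icc_self).trans ?_
    rw [← e2, ENNReal.ofReal_mul (by positivity)]
    gcongr
    · linarith
    · exact (mass_Icc_mono (he.trans (hu.pow_le_quantile hθ hq n))).trans h2.2
  have hhead : ENNReal.ofReal (Real.log (u n) / 32) ≤ cutIntensity θ x (blockHead u n j) := by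
    refine le_trans ?_ (le_cutIntensity (a := blockStart u n j) (by linarith) Ioo_subset_Ioc_self)
    rw [← e1, ENNReal.ofReal_mul (by positivity)]
    gcongr
    · linarith
    · exact h1.1.trans (mass_Icc_mono (by linarith))
  have hm1 : MeasurableSet (blockHead u n j) := measurableSet_Ioc
  have hm2 : MeasurableSet (blockTail u n j) := measurableSet_Ioc
  have hf1 : cutIntensity θ x (blockHead u n j) ≠ ∞ :=
    cutIntensity_ne_top hfin measurableSet_Ioc Ioc_subset_Icc_self
  have p1 : ENNReal.ofReal (1 / 2) ≤ Q {y | ∃ i, y i ∈ blockHead u n j} := by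
    have hc : {y : ℕ → ℝ | ∃ i, y i ∈ blockHead u n j} =
        {y | ∀ i, y i ∉ blockHead u n j}ᶜ := by ext; simp
    rw [hc, measure_compl (IsPoissonPointProcess.measurableSet_empty hm1)
      (measure_ne_top _ _), measure_univ, hQ.measure_empty hm1 hf1,
      ← ENNReal.ofReal_one, ← ENNReal.ofReal_sub _ (Real.exp_pos _).le]
    refine ENNReal.ofReal_le_ofReal ?_
    have h3 : 1 ≤ (cutIntensity θ x (blockHead u n j)).toReal := by
      rw [← ENNReal.ofReal_le_iff_le_toReal hf1]
      exact (ENNReal.ofReal_le_ofReal (by linarith)).trans hhead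
    have h4 : Real.exp (-(cutIntensity θ x (blockHead u n j)).toReal) ≤ Real.exp (-1) :=
      Real.exp_le_exp.2 (by linarith)
    have h5 : Real.exp (-1) < 1 / 2 := lt_trans Real.exp_neg_one_lt_d9 (by norm_num)
    linarith
  have p2 : ENNReal.ofReal (1 / u n) ≤ Q {y | ∀ i, y i ∉ blockTail u n j} := by
    rw [hQ.measure_empty hm2
      (cutIntensity_ne_top hfin measurableSet_Ioc Ioc_subset_Icc_self)]
    refine ENNReal.ofReal_le_ofReal ?_
    have h3 := ENNReal.toReal_le_of_le_ofReal (by linarith) htail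
    calc 1 / u n = Real.exp (-Real.log (u n)) := by rw [Real.exp_neg, Real.exp_log hu0, one_div]
      _ ≤ _ := Real.exp_le_exp.2 (by linarith)
  have e : 1 / (2 * u n) = 1 / 2 * (1 / u n) := by field_simp
  rw [hmul, e, ENNReal.ofReal_mul (by norm_num)]
  gcongr

/-- Almost surely, at each large scale many charged blocks have a cut in the head and none in the
rest. -/
theorem ae_card_cutBlocks [IsProbabilityMeasure Q]
    (hQ : IsPoissonPointProcess Q (cutIntensity θ x)) (hθ : IsParameter θ)
    (hq : IsDyadicQuantile θ q) (hu : IsWindowScale θ q u)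
    (hx : ∀ᶠ n in atTop, MassRegular θ q x n)
    (hc : ∀ᶠ n in atTop, 2 ^ n * u n ^ 12 / 256 ≤ ((chargedBlocks θ u x n).card : ℝ)) :
    ∀ᵐ y ∂Q, ∀ᶠ n in atTop, 2 ^ n * u n ^ 11 / 1024 ≤ ((cutBlocks θ u x y n).card : ℝ) := by
  classical
  have hfin := mass_ne_top hθ hq hx
  have hlog := (Real.tendsto_log_atTop.comp (hu.tendsto hθ hq)).eventually_ge_atTop 32
  refine ae_eventually_of_summable (g := fun n => 2048 / u n)
    (by simpa [div_eq_mul_inv] using (hu.summable_inv hθ hq).mul_left 2048) ?_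
  filter_upwards [hx, (tendsto_add_atTop_nat 2).eventually hx, hc, hlog] with n h1 h2 h3 h4
  simp only [Function.comp_apply] at h4
  have hu0 := hu.pos n
  have h' : 1 < u n := by
    by_contra! h
    have := Real.log_nonpos hu0.le h
    linarith
  have hind : ∀ i j, i ≠ j → Q ({y | IsCutBlock u y n i} ∩ {y | IsCutBlock u y n j}) =
      Q {y | IsCutBlock u y n i} * Q {y | IsCutBlock u y n j} ∧
      Q {y | IsCutBlock u y n i} = Q {y | ∃ k, y k ∈ blockHead u n i} *
        Q {y | ∀ k, y k ∉ blockTail u n i} := by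
    intro i j hij
    have := hQ.measure_hit_inter_empty (A := ![blockHead u n i, blockTail u n i, blockHead u n j,
      blockTail u n j]) (by intro k; fin_cases k <;> exact measurableSet_Ioc) (by
        have hS : ∀ {A B : ℕ → Set ℝ}, (∀ k, A k ⊆ Ioc (blockStart u n k) (blockStart u n k +
            3 * blockLen u n)) → (∀ k, B k ⊆ Ioc (blockStart u n k) (blockStart u n k +
            3 * blockLen u n)) → Disjoint (A i) (B j) := fun hA hB =>
          disjoint_of_blocks h' hij (hA i) (hB j)
        have d1 := disjoint_head_tail (u := u) n i
        have d2 := disjoint_head_tail (u := u) n j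
        have d3 := hS (blockHead_subset h') (blockHead_subset h')
        have d4 := hS (blockHead_subset h') (blockTail_subset h')
        have d5 := hS (blockTail_subset h') (blockHead_subset h')
        have d6 := hS (blockTail_subset h') (blockTail_subset h')
        intro k l hkl
        fin_cases k <;> fin_cases l <;> first | exact absurd rfl hkl | skip
        exacts [d1, d3, d4, d1.symm, d5, d6, d3.symm, d5.symm, d2, d4.symm, d6.symm, d2.symm])
    exact this
  have hu12 : 0 < 2 ^ n * u n ^ 12 / 256 := by positivity
  have hcard : 0 < (chargedBlocks θ u x n).card := by
    have : (0:ℝ) < (chargedBlocks θ u x n).card := hu12.trans_le h3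
    exact_mod_cast this
  have key := measure_card_filter_small_le (ρ := Q) (chargedBlocks θ u x n)
    (s := fun j => {y | IsCutBlock u y n j}) (fun j => isCutBlock_measurable n j)
    (fun i _ j _ hij => (hind i j hij).1) (p := 1 / (2 * u n)) (by positivity)
    (fun j hj => measure_isCutBlock_ge hQ hθ hq hu hfin h1 h2 h4
      (Finset.mem_range.1 (Finset.mem_filter.1 hj).1) (hind j (j + 1) (by omega)).2) hcard
  refine le_trans (measure_mono ?_) (key.trans (ENNReal.ofReal_le_ofReal ?_))
  · intro y hy hy'
    refine hy ?_
    have e : 2 ^ n * u n ^ 11 / 1024 = 1 / (2 * u n) * (2 ^ n * u n ^ 12 / 256) / 2 := by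
      field_simp; norm_num
    rw [e]
    refine le_trans (by gcongr) (hy'.trans (le_of_eq ?_))
    unfold cutBlocks
    congr!
  · calc 4 / (1 / (2 * u n) * ((chargedBlocks θ u x n).card : ℝ)) ≤
        4 / (1 / (2 * u n) * (2 ^ n * u n ^ 12 / 256)) := by gcongr
      _ = 2048 / u n * (1 / (2 ^ n * u n ^ 10)) := by field_simp; norm_num
      _ ≤ 2048 / u n := by
        refine mul_le_of_le_one_right (by positivity) ?_
        rw [div_le_one (by positivity)]
        exact one_le_mul_of_one_le_of_one_le (one_le_pow₀ (by norm_num)) (one_le_pow₀ h'.le)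

end

/-! ### Gaps between cuts, seen from the mass measure -/

section

variable {θ q u x : ℕ → ℝ} {Q : Measure (ℕ → ℝ)}

/-- A discretized version of `exp (2ⁿ φ / 4)`, where `φ` is the distance from `t` to the last cut
before `t`, or to `l` if there is no cut in between. It is written in terms of the events that
intervals contain no cut. -/
noncomputable def gapWeight (l : ℝ) (n : ℕ) (y : ℕ → ℝ) (t : ℝ) : ℝ≥0∞ :=
  ∑' k : ℕ, {y : ℕ → ℝ | l ≤ t - k / 2 ^ n ∧ ∀ i, y i ∉ Ioo (t - k / 2 ^ n) t}.indicator
    (fun _ => ENNReal.ofReal (Real.exp ((k + 1) / 4))) y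

theorem measurable_gapWeight (l : ℝ) (n : ℕ) :
    Measurable fun p : ℝ × (ℕ → ℝ) => gapWeight l n p.2 p.1 := by
  refine Measurable.tsum fun k => ?_
  have e : ∀ p : ℝ × (ℕ → ℝ), {y : ℕ → ℝ | l ≤ p.1 - k / 2 ^ n ∧ ∀ i, y i ∉ Ioo (p.1 - k / 2 ^ n)
      p.1}.indicator (fun _ => ENNReal.ofReal (Real.exp ((k + 1) / 4))) p.2 =
      ({p : ℝ × (ℕ → ℝ) | l ≤ p.1 - k / 2 ^ n} ∩ ⋂ i, ({p : ℝ × (ℕ → ℝ) | p.1 - k / 2 ^ n < p.2 i} ∩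
        {p : ℝ × (ℕ → ℝ) | p.2 i < p.1})ᶜ).indicator
        (fun _ => ENNReal.ofReal (Real.exp ((k + 1) / 4))) p := by
    intro p
    have : p.2 ∈ {y : ℕ → ℝ | l ≤ p.1 - k / 2 ^ n ∧ ∀ i, y i ∉ Ioo (p.1 - k / 2 ^ n) p.1} ↔
      p ∈ ({p : ℝ × (ℕ → ℝ) | l ≤ p.1 - k / 2 ^ n} ∩
        ⋂ i, ({p : ℝ × (ℕ → ℝ) | p.1 - k / 2 ^ n < p.2 i} ∩ {p : ℝ × (ℕ → ℝ) | p.2 i < p.1})ᶜ) := by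
      simp [mem_Ioo]
    by_cases h : p.2 ∈ {y : ℕ → ℝ | l ≤ p.1 - k / 2 ^ n ∧ ∀ i, y i ∉ Ioo (p.1 - k / 2 ^ n) p.1}
    · rw [indicator_of_mem h, indicator_of_mem (this.1 h)]
    · rw [indicator_of_notMem h, indicator_of_notMem (fun h' => h (this.2 h'))]
  simp_rw [e]
  refine measurable_const.indicator ?_
  refine (measurableSet_le measurable_const (by fun_prop)).inter (MeasurableSet.iInter fun i => ?_)
  have hi : Measurable fun p : ℝ × (ℕ → ℝ) => p.2 i := (measurable_pi_apply i).comp measurable_snd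
  exact ((measurableSet_lt (by fun_prop) hi).inter (measurableSet_lt hi measurable_fst)).compl

theorem lintegral_gapWeight_le [IsProbabilityMeasure Q]
    (hQ : IsPoissonPointProcess Q (cutIntensity θ x)) (hfin : ∀ l, mass θ x (Icc 0 l) ≠ ∞)
    {n : ℕ} {l : ℝ} (hl : 0 ≤ l) (hm : ENNReal.ofReal (2 ^ n / 2) ≤ mass θ x (Icc 0 l)) (t : ℝ) :
    ∫⁻ y, gapWeight l n y t ∂Q ≤ 6 := by
  have hmeas : ∀ k : ℕ, MeasurableSet {y : ℕ → ℝ | l ≤ t - k / 2 ^ n ∧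
      ∀ i, y i ∉ Ioo (t - k / 2 ^ n) t} := fun k =>
    (MeasurableSet.const _).inter (IsPoissonPointProcess.measurableSet_empty measurableSet_Ioo)
  have hterm : ∀ k : ℕ, ∫⁻ y, {y : ℕ → ℝ | l ≤ t - k / 2 ^ n ∧
      ∀ i, y i ∉ Ioo (t - k / 2 ^ n) t}.indicator
      (fun _ => ENNReal.ofReal (Real.exp ((k + 1) / 4))) y ∂Q ≤
      ENNReal.ofReal (Real.exp (1 / 4) * Real.exp (-(1 / 4)) ^ k) := by
    intro k
    rw [lintegral_indicator_const (hmeas k)]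
    by_cases hk : l ≤ t - k / 2 ^ n
    · have hsub : {y : ℕ → ℝ | l ≤ t - k / 2 ^ n ∧ ∀ i, y i ∉ Ioo (t - k / 2 ^ n) t} ⊆
          {y | ∀ i, y i ∉ Ioo (t - k / 2 ^ n) t} := fun y hy => hy.2
      have hne := cutIntensity_ne_top hfin (A := Ioo (t - k / 2 ^ n) t) measurableSet_Ioo
        Ioo_subset_Icc_self
      have hΛ : (k : ℝ) / 2 ≤ (cutIntensity θ x (Ioo (t - k / 2 ^ n) t)).toReal := by
        rw [← ENNReal.ofReal_le_iff_le_toReal hne]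
        refine le_trans ?_ (le_cutIntensity (a := t - k / 2 ^ n) (hl.trans hk) subset_rfl)
        have e : (k : ℝ) / 2 = (t - (t - k / 2 ^ n)) * (2 ^ n / 2) := by field_simp; ring
        rw [e, ENNReal.ofReal_mul (by rw [sub_sub_cancel]; positivity)]
        gcongr
        exact hm.trans (mass_Icc_mono hk)
      calc _ ≤ ENNReal.ofReal (Real.exp ((k + 1) / 4)) *
            ENNReal.ofReal (Real.exp (-(cutIntensity θ x (Ioo (t - k / 2 ^ n) t)).toReal)) := by
            rw [← hQ.measure_empty measurableSet_Ioo hne]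
            gcongr
        _ ≤ _ := by
            rw [← ENNReal.ofReal_mul (Real.exp_pos _).le, ← Real.exp_add, ← Real.exp_nat_mul,
              ← Real.exp_add]
            refine ENNReal.ofReal_le_ofReal (Real.exp_le_exp.2 ?_)
            linarith
    · have : {y : ℕ → ℝ | l ≤ t - k / 2 ^ n ∧ ∀ i, y i ∉ Ioo (t - k / 2 ^ n) t} = ∅ := by
        ext y; simp [hk]
      rw [this]
      simp
  unfold gapWeight
  rw [lintegral_tsum fun k => (measurable_const.indicator (hmeas k)).aemeasurable]
  refine (ENNReal.tsum_le_tsum hterm).trans ?_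
  have hr1 : Real.exp (-(1 / 4)) ≤ 0.78 := by
    refine le_of_pow_le_pow_left₀ (n := 4) (by norm_num) (by norm_num) ?_
    rw [← Real.exp_nat_mul]
    have := Real.exp_neg_one_lt_d9
    norm_num at this ⊢
    linarith
  have hr2 : Real.exp (1 / 4) ≤ 1.3 := by
    refine le_of_pow_le_pow_left₀ (n := 4) (by norm_num) (by norm_num) ?_
    rw [← Real.exp_nat_mul]
    have := Real.exp_one_lt_d9
    norm_num at this ⊢
    linarith
  have hlt : Real.exp (-(1 / 4)) < 1 := by linarith
  rw [← ENNReal.ofReal_tsum_of_nonneg (fun k => by positivity)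
    ((summable_geometric_of_lt_one (Real.exp_pos _).le hlt).mul_left _), tsum_mul_left,
    tsum_geometric_of_lt_one (Real.exp_pos _).le hlt]
  have : (6 : ℝ≥0∞) = ENNReal.ofReal 6 := by simp
  rw [this]
  refine ENNReal.ofReal_le_ofReal ?_
  rw [← div_eq_mul_inv, div_le_iff₀ (by linarith)]
  linarith

/-- Almost surely, the integral of the weights `exp (2ⁿ φ / 4)` over `(𝒳(2ⁿ), 𝒳(2ⁿ⁺¹)]` against
`μ` is at most `n² 2ⁿ` for `n` large. -/
theorem ae_lintegral_gapWeight_le [IsProbabilityMeasure Q]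
    (hQ : IsPoissonPointProcess Q (cutIntensity θ x)) (hθ : IsParameter θ)
    (hq : IsDyadicQuantile θ q) (hx : ∀ᶠ n in atTop, MassRegular θ q x n) :
    ∀ᵐ y ∂Q, ∀ᶠ n : ℕ in atTop, ∫⁻ t in Ioc (q n) (q (n + 1)), gapWeight (q n) n y t ∂mass θ x ≤
      ENNReal.ofReal (n ^ 2 * 2 ^ n) := by
  have hfin := mass_ne_top hθ hq hx
  refine ae_eventually_of_summable (g := fun n : ℕ => 24 * (1 / (n : ℝ) ^ 2))
    ((Real.summable_one_div_nat_pow.2 (by norm_num)).mul_left 24) ?_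
  filter_upwards [hx, (tendsto_add_atTop_nat 1).eventually hx, eventually_gt_atTop 0]
    with n h1 h2 h3
  have hn : (0:ℝ) < n := by exact_mod_cast h3
  have hW : mass θ x (Ioc (q n) (q (n + 1))) ≤ ENNReal.ofReal (2 * 2 ^ (n + 1)) :=
    (measure_mono (Ioc_subset_Icc_self.trans (Icc_subset_Icc_left (hq n).1))).trans h2.2
  have hF : IsFiniteMeasure ((mass θ x).restrict (Ioc (q n) (q (n + 1)))) :=
    isFiniteMeasure_restrict.2 (ne_top_of_le_ne_top ENNReal.ofReal_ne_top hW)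
  have hint : ∫⁻ y, ∫⁻ t in Ioc (q n) (q (n + 1)), gapWeight (q n) n y t ∂mass θ x ∂Q ≤
      ENNReal.ofReal (24 * 2 ^ n) := by
    rw [lintegral_lintegral_swap
      ((measurable_gapWeight (q n) n).comp measurable_swap).aemeasurable]
    calc _ ≤ ∫⁻ t in Ioc (q n) (q (n + 1)), 6 ∂mass θ x :=
          lintegral_mono fun t => lintegral_gapWeight_le hQ hfin (hq n).1 h1.1 t
      _ = 6 * mass θ x (Ioc (q n) (q (n + 1))) := by rw [setLIntegral_const]
      _ ≤ ENNReal.ofReal 6 * ENNReal.ofReal (2 * 2 ^ (n + 1)) := by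
          gcongr
          simp
      _ = _ := by
          rw [← ENNReal.ofReal_mul (by norm_num)]
          congr 1
          ring
  have hmeas : Measurable fun y => ∫⁻ t in Ioc (q n) (q (n + 1)), gapWeight (q n) n y t ∂mass θ x :=
    Measurable.lintegral_prod_right' ((measurable_gapWeight (q n) n).comp measurable_swap)
  refine (measure_gt_ofReal_le hmeas.aemeasurable (by positivity) hint).trans
    (ENNReal.ofReal_le_ofReal (le_of_eq ?_))
  field_simp

/-- Almost surely, there are at most `𝒳(2ⁿ⁺¹)³` cuts before `𝒳(2ⁿ⁺¹)`, for `n` large. -/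
theorem ae_count_le [IsProbabilityMeasure Q]
    (hQ : IsPoissonPointProcess Q (cutIntensity θ x)) (hθ : IsParameter θ)
    (hq : IsDyadicQuantile θ q) (hx : ∀ᶠ n in atTop, MassRegular θ q x n) :
    ∀ᵐ y ∂Q, ∀ᶠ n : ℕ in atTop, (count (Icc 0 (q (n + 1))) y : ℝ≥0∞) ≤
      ENNReal.ofReal (q (n + 1) ^ 3) := by
  have hfin := mass_ne_top hθ hq hx
  refine ae_eventually_of_summable (g := fun n : ℕ => (1 / 2 : ℝ) ^ n)
    (summable_geometric_of_lt_one (by norm_num) (by norm_num)) ?_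
  filter_upwards [(tendsto_add_atTop_nat 1).eventually hx] with n h2
  have hp := hq.pos hθ (n + 1)
  have hne := cutIntensity_ne_top hfin (a := 0) (b := q (n + 1)) measurableSet_Icc subset_rfl
  have hint : ∫⁻ y, (count (Icc 0 (q (n + 1))) y : ℝ≥0∞) ∂Q ≤
      ENNReal.ofReal (q (n + 1) * (2 * 2 ^ (n + 1))) := by
    rw [hQ.lintegral_count measurableSet_Icc hne]
    refine (cutIntensity_le measurableSet_Icc subset_rfl).trans ?_
    rw [sub_zero, ENNReal.ofReal_mul hp.le]
    gcongr
    exact h2.2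
  have hm : AEMeasurable (fun y => (count (Icc 0 (q (n + 1))) y : ℝ≥0∞)) Q :=
    (Measurable.of_discrete (f := fun c : ℕ∞ => (c : ℝ≥0∞))).comp_aemeasurable
      (hQ.aemeasurable_count measurableSet_Icc hne)
  refine (measure_gt_ofReal_le hm (by positivity) hint).trans (ENNReal.ofReal_le_ofReal ?_)
  have h3 := hq.two_pow_le hθ (n + 1)
  have e : q (n + 1) * (2 * 2 ^ (n + 1)) / q (n + 1) ^ 3 = 2 * 2 ^ (n + 1) / q (n + 1) ^ 2 := by
    field_simp
  rw [e, one_div_pow, div_le_div_iff₀ (by positivity) (by positivity)]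
  have h4 : (2 ^ (n + 1)) ^ 2 ≤ q (n + 1) ^ 2 := by gcongr
  have h5 : ((2:ℝ) ^ (n + 1)) ^ 2 = 2 * 2 ^ (n + 1) * 2 ^ n := by ring
  linarith

/-- The length of the cells of the interval `(𝒳(2ⁿ), 𝒳(2ⁿ⁺¹)]`: long enough for all of them to
contain a cut. -/
noncomputable def cellLen (q : ℕ → ℝ) (n : ℕ) : ℝ := 6 * Real.log (q (n + 1)) / 2 ^ n

theorem log_quantile_ge (hθ : IsParameter θ) (hq : IsDyadicQuantile θ q) (n : ℕ) :
    0.69 * (n + 1) ≤ Real.log (q (n + 1)) := by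
  have h1 := hq.log_ge hθ (n + 1)
  have h2 := Real.log_two_gt_d9
  push_cast at h1
  nlinarith [show (0:ℝ) ≤ n from n.cast_nonneg]

theorem cellLen_pos (hθ : IsParameter θ) (hq : IsDyadicQuantile θ q) (n : ℕ) : 0 < cellLen q n := by
  have h := log_quantile_ge hθ hq n
  have : 0 < Real.log (q (n + 1)) := lt_of_lt_of_le (by positivity) h
  unfold cellLen
  positivity

/-- All the cells of scale `n` contain a cut. -/
def CellsHit (q y : ℕ → ℝ) (n : ℕ) : Prop :=
  ∀ j : ℕ, q n + (j + 1) * cellLen q n ≤ q (n + 1) →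
    ∃ i, y i ∈ Ioc (q n + j * cellLen q n) (q n + (j + 1) * cellLen q n)

theorem ae_cellsHit [IsProbabilityMeasure Q]
    (hQ : IsPoissonPointProcess Q (cutIntensity θ x)) (hθ : IsParameter θ)
    (hq : IsDyadicQuantile θ q) (hx : ∀ᶠ n in atTop, MassRegular θ q x n) :
    ∀ᵐ y ∂Q, ∀ᶠ n : ℕ in atTop, CellsHit q y n := by
  have hfin := mass_ne_top hθ hq hx
  refine ae_eventually_of_summable (g := fun n : ℕ => (1 / 2 : ℝ) ^ n)
    (summable_geometric_of_lt_one (by norm_num) (by norm_num)) ?_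
  filter_upwards [hx] with n h1
  have hp := hq.pos hθ (n + 1)
  have hD := cellLen_pos hθ hq n
  set D := cellLen q n
  set a := Real.log (q (n + 1)) with ha
  have ha1 : 0.69 ≤ a := by
    have := log_quantile_ge hθ hq n
    nlinarith [show (0:ℝ) ≤ n from n.cast_nonneg]
  set N := ⌊q (n + 1) ^ 2⌋₊
  have hsub : {y : ℕ → ℝ | ¬ CellsHit q y n} ⊆ ⋃ j ∈ Finset.range N,
      {y | ∀ i, y i ∉ Ioc (q n + j * D) (q n + (j + 1) * D)} := by
    intro y hy
    have hy' : ∃ j : ℕ, q n + (j + 1) * D ≤ q (n + 1) ∧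
        ∀ i, y i ∉ Ioc (q n + j * D) (q n + (j + 1) * D) := by
      have hy'' : ¬ CellsHit q y n := hy
      unfold CellsHit at hy''
      push Not at hy''
      exact hy''
    obtain ⟨j, hj, hjy⟩ := hy'
    refine mem_biUnion (x := j) ?_ hjy
    refine Finset.mem_coe.2 (Finset.mem_range.2 ?_)
    have : ((j + 1 : ℕ) : ℝ) ≤ q (n + 1) ^ 2 := by
      push_cast
      have h2 : (j + 1) * D ≤ q (n + 1) := by linarith [(hq n).1]
      have h3 : 1 / 2 ^ n ≤ D := by
        simp only [D, cellLen]
        gcongr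
        linarith
      have h4 : ((j:ℝ) + 1) * (1 / 2 ^ n) ≤ q (n + 1) := le_trans (by gcongr) h2
      rw [mul_one_div, div_le_iff₀ (by positivity)] at h4
      have h5 : (2:ℝ) ^ n ≤ q (n + 1) :=
        (pow_le_pow_right₀ (by norm_num) (by omega)).trans (hq.two_pow_le hθ (n + 1))
      nlinarith
    have := Nat.le_floor this
    omega
  have hcell : ∀ j ∈ Finset.range N, Q {y | ∀ i, y i ∉ Ioc (q n + j * D) (q n + (j + 1) * D)} ≤
      ENNReal.ofReal (1 / q (n + 1) ^ 3) := by
    intro j _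
    have hm : MeasurableSet (Ioc (q n + j * D) (q n + (j + 1) * D)) := measurableSet_Ioc
    have hne := cutIntensity_ne_top hfin hm Ioc_subset_Icc_self
    rw [hQ.measure_empty hm hne]
    refine ENNReal.ofReal_le_ofReal ?_
    have hjD : 0 ≤ j * D := by positivity
    have hΛ : 3 * a ≤ (cutIntensity θ x (Ioc (q n + j * D) (q n + (j + 1) * D))).toReal := by
      rw [← ENNReal.ofReal_le_iff_le_toReal hne]
      refine le_trans ?_ (le_cutIntensity (a := q n + j * D) (b := q n + (j + 1) * D)
        (by linarith [(hq n).1]) Ioo_subset_Ioc_self)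
      have e : 3 * a = (q n + (j + 1) * D - (q n + j * D)) * (2 ^ n / 2) := by
        have : D * (2 ^ n / 2) = 3 * a := by
          simp only [D, cellLen]; field_simp; ring
        rw [← this]; ring
      rw [e, ENNReal.ofReal_mul (by nlinarith)]
      gcongr
      exact h1.1.trans (mass_Icc_mono (by linarith))
    calc _ ≤ Real.exp (-(3 * a)) := Real.exp_le_exp.2 (by linarith)
      _ = _ := by
        rw [Real.exp_neg, one_div, show (3:ℝ) * a = (3:ℕ) * a by norm_num, Real.exp_nat_mul,
          Real.exp_log hp]
  refine (measure_mono hsub).trans ((measure_biUnion_finset_le _ _).trans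
    ((Finset.sum_le_sum hcell).trans ?_))
  rw [Finset.sum_const, Finset.card_range, nsmul_eq_mul, ← ENNReal.ofReal_natCast,
    ← ENNReal.ofReal_mul (by positivity)]
  refine ENNReal.ofReal_le_ofReal ?_
  have hN : (N : ℝ) ≤ q (n + 1) ^ 2 := Nat.floor_le (by positivity)
  calc (N : ℝ) * (1 / q (n + 1) ^ 3) ≤ q (n + 1) ^ 2 * (1 / q (n + 1) ^ 3) := by gcongr
    _ = 1 / q (n + 1) := by field_simp
    _ ≤ 1 / 2 ^ n := by
      gcongr
      exact (pow_le_pow_right₀ (by norm_num) (by omega)).trans (hq.two_pow_le hθ (n + 1))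
    _ = _ := by rw [one_div_pow]

end

/-! ### Distances to the initial subtrees -/

section Sticks

variable {y z : ℕ → ℝ}

theorem exists_mem_stick (h : IsStickData y z) {t : ℝ} (ht : 0 < t) :
    ∃ n, t ∈ Ioc (withZero y n) (withZero y (n + 1)) := by
  classical
  have hex := exists_le_withZero h t
  have h0 : Nat.find hex ≠ 0 := by
    intro h0
    have := Nat.find_spec hex
    rw [h0] at this
    exact absurd this (not_le.2 ht)
  obtain ⟨n, hn⟩ := Nat.exists_eq_succ_of_ne_zero h0
  refine ⟨n, not_le.1 (Nat.find_min hex (m := n) (by omega)), ?_⟩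
  have := Nat.find_spec hex
  rwa [hn] at this

theorem stick_unique {w : ℕ → ℝ} (hw : Monotone w) {m n : ℕ} {t : ℝ}
    (hm : t ∈ Ioc (w m) (w (m + 1))) (hn : t ∈ Ioc (w n) (w (n + 1))) : m = n := by
  rcases lt_trichotomy m n with h | h | h
  · exact absurd (hm.2.trans (hw (Nat.succ_le_of_lt h))) (not_le.2 hn.1)
  · exact h
  · exact absurd (hn.2.trans (hw (Nat.succ_le_of_lt h))) (not_le.2 hm.1)

theorem lineDist_old (h : IsStickData y z) {n : ℕ} {t s : ℝ}
    (ht : t ∈ Ioc (withZero y n) (withZero y (n + 1))) (hs : s ≤ withZero y n) :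
    lineDist y z t s = lineDist y z (withZero z n) s + (t - withZero y n) := by
  rw [lineDist_eq h ht.2 (hs.trans (ht.1.le.trans ht.2)), stickDist_comm, stickDist_mid hs ht.1,
    lineDist_eq h (withZero_glue h n).2 hs, stickDist_comm n s]

theorem lineDist_new (h : IsStickData y z) {n : ℕ} {t s : ℝ}
    (ht : t ∈ Ioc (withZero y n) (withZero y (n + 1))) (hs : withZero y n < s) (hst : s ≤ t) :
    lineDist y z t s = t - s := by
  rw [lineDist_eq h ht.2 (hst.trans ht.2), stickDist_new ht.1 hs, abs_of_nonneg (by linarith)]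

/-- The length of the path from the glue point of index `n` down to `[0, l]`, which goes down the
stick `m < n` of the glue point and on from the glue point of this stick. Written as a sum over all
`m < n`, with one nonzero term at most, it is visibly measurable. -/
noncomputable def climb (l : ℝ) (y z : ℕ → ℝ) (n : ℕ) : ℝ :=
  ∑ m : Fin n, if l < withZero z n ∧ withZero z n ∈ Ioc (withZero y m) (withZero y (m + 1)) then
    withZero z n - max (withZero y m) l + climb l y z m else 0
termination_by n
decreasing_by exact m.2

theorem climb_def (l : ℝ) (y z : ℕ → ℝ) (n : ℕ) : climb l y z n = ∑ m ∈ Finset.range n,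
    if l < withZero z n ∧ withZero z n ∈ Ioc (withZero y m) (withZero y (m + 1)) then
      withZero z n - max (withZero y m) l + climb l y z m else 0 := by
  rw [climb, Finset.sum_range]

theorem climb_of_mem {l : ℝ} (hy : Monotone (withZero y)) {m n : ℕ} (hmn : m < n)
    (hl : l < withZero z n) (hm : withZero z n ∈ Ioc (withZero y m) (withZero y (m + 1))) :
    climb l y z n = withZero z n - max (withZero y m) l + climb l y z m := by
  rw [climb_def, Finset.sum_eq_single_of_mem m (Finset.mem_range.2 hmn), if_pos ⟨hl, hm⟩]
  intro k _ hk
  rw [if_neg]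
  exact fun h => hk (stick_unique hy h.2 hm)

theorem climb_of_le {l : ℝ} {n : ℕ} (hl : withZero z n ≤ l) : climb l y z n = 0 := by
  rw [climb_def]
  exact Finset.sum_eq_zero fun m _ => if_neg fun h => absurd h.1 (not_lt.2 hl)

theorem climb_congr {l : ℝ} {z z' : ℕ → ℝ} {n : ℕ} (h : ∀ i < n, z i = z' i) :
    climb l y z n = climb l y z' n := by
  induction n using Nat.strong_induction_on with
  | _ n ih =>
    have e : withZero z n = withZero z' n := by
      cases n with
      | zero => rfl
      | succ n => exact h n (by omega)
    rw [climb_def, climb_def, e]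
    refine Finset.sum_congr rfl fun m hm => ?_
    have hm := Finset.mem_range.1 hm
    rw [ih m hm fun i hi => h i (by omega)]

theorem measurable_withZero (n : ℕ) : Measurable fun y : ℕ → ℝ => withZero y n := by
  cases n with
  | zero => exact measurable_const
  | succ n => exact measurable_pi_apply n

theorem measurable_climb (l : ℝ) (n : ℕ) :
    Measurable fun p : (ℕ → ℝ) × (ℕ → ℝ) => climb l p.1 p.2 n := by
  induction n using Nat.strong_induction_on with
  | _ n ih =>
    simp_rw [climb_def l _ _ n]
    have hy : ∀ k, Measurable fun p : (ℕ → ℝ) × (ℕ → ℝ) => withZero p.1 k := fun k =>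
      (measurable_withZero k).comp measurable_fst
    have hz : Measurable fun p : (ℕ → ℝ) × (ℕ → ℝ) => withZero p.2 n :=
      (measurable_withZero n).comp measurable_snd
    refine Finset.measurable_fun_sum _ fun m hm => Measurable.ite ?_ ?_ measurable_const
    · exact (measurableSet_lt measurable_const hz).inter
        ((measurableSet_lt (hy m) hz).inter (measurableSet_le hz (hy (m + 1))))
    · exact (hz.sub ((hy m).max measurable_const)).add (ih m (Finset.mem_range.1 hm))

/-- Every point is within the length of its path of the initial subtree `[0, l]`. -/
theorem exists_lineDist_le (h : IsStickData y z) {l : ℝ} (hl : 0 ≤ l) (n : ℕ) {t : ℝ}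
    (ht : t ∈ Ioc (withZero y n) (withZero y (n + 1))) (hlt : l < t) :
    ∃ s ∈ Icc 0 l, lineDist y z t s ≤ t - max (withZero y n) l + climb l y z n := by
  induction n using Nat.strong_induction_on generalizing t with
  | _ n ih =>
    rcases lt_or_ge (withZero y n) l with hn | hn
    · refine ⟨l, ⟨hl, le_rfl⟩, ?_⟩
      rw [lineDist_new h ht hn hlt.le, max_eq_right hn.le,
        climb_of_le ((withZero_glue h n).2.trans hn.le), add_zero]
    rw [max_eq_left hn]
    rcases le_or_gt (withZero z n) l with hz | hz
    · refine ⟨withZero z n, ⟨(withZero_glue h n).1, hz⟩, ?_⟩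
      rw [lineDist_old h ht (withZero_glue h n).2, climb_of_le hz,
        lineDist_eq h (withZero_glue h n).2 (withZero_glue h n).2, (stickDist_metric h n).1]
      linarith
    · obtain ⟨m, hm⟩ := exists_mem_stick h (hl.trans_lt hz)
      have hmn : m < n := by
        by_contra! hmn
        exact absurd ((withZero_glue h n).2.trans (withZero_mono h hmn)) (not_le.2 hm.1)
      obtain ⟨s, hs, hle⟩ := ih m hmn hm hz
      refine ⟨s, hs, ?_⟩
      rw [lineDist_old h ht (hs.2.trans hn), climb_of_mem (withZero_mono h) hmn hz hm]
      linarith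

/-- A branch glued at a point far from `[0, l]` is far from `[0, l]`. -/
theorem le_lineDist_of_glue (h : IsStickData y z) {l H : ℝ} {n : ℕ} {t : ℝ}
    (ht : t ∈ Ioc (withZero y n) (withZero y (n + 1))) (hl : l ≤ withZero y n)
    (hH : ∀ s ∈ Icc 0 l, H ≤ lineDist y z (withZero z n) s) :
    ∀ s ∈ Icc 0 l, H + (t - withZero y n) ≤ lineDist y z t s := by
  intro s hs
  rw [lineDist_old h ht (hs.2.trans hl)]
  linarith [hH s hs]

theorem lineDist_nonneg (h : IsStickData y z) {a b : ℝ} (ha : 0 ≤ a) (hb : 0 ≤ b) :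
    0 ≤ lineDist y z a b := by
  obtain ⟨n, hn⟩ := exists_le_withZero h (max a b)
  rw [lineDist_eq h ((le_max_left _ _).trans hn) ((le_max_right _ _).trans hn)]
  exact ((stickDist_metric h n).2 a ⟨ha, (le_max_left _ _).trans hn⟩ b
    ⟨hb, (le_max_right _ _).trans hn⟩).1

end Sticks

/-! ### Exponential moments of the distances -/

section

variable {θ q u x y : ℕ → ℝ} {ρ : Measure (ℕ → ℝ)}

/-- A law of the sequence of the glue points, given the atoms `x` and the cuts `y`. -/
structure IsGlueLaw (θ x y : ℕ → ℝ) (ρ : Measure (ℕ → ℝ)) : Prop where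
  indep : iIndepFun (fun i (z : ℕ → ℝ) => z i) ρ
  law : ∀ i, ρ.map (fun z => z i) = cond (mass θ x) (Icc 0 (y i))

theorem IsGlueLaw.ae_mem (hR : IsGlueLaw θ x y ρ) : ∀ᵐ z ∂ρ, ∀ i, z i ∈ Icc 0 (y i) := by
  refine ae_all_iff.2 fun i => ?_
  have h : ∀ᵐ t ∂ρ.map (fun z => z i), t ∈ Icc 0 (y i) := by
    rw [hR.law i]
    exact ae_cond_mem measurableSet_Icc
  exact ae_of_ae_map (measurable_pi_apply i).aemeasurable h

theorem IsGlueLaw.lintegral_coord (hR : IsGlueLaw θ x y ρ) (i : ℕ) {f : ℝ → ℝ≥0∞}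
    (hf : Measurable f) : ∫⁻ z, f (z i) ∂ρ =
      (mass θ x (Icc 0 (y i)))⁻¹ * ∫⁻ t in Icc 0 (y i), f t ∂mass θ x := by
  rw [← lintegral_map hf (measurable_pi_apply i), hR.law i, ProbabilityTheory.cond,
    lintegral_smul_measure, smul_eq_mul]

/-- The integral over the stick of index `m`, beyond `l`, of the exponential of the distance to the
base of the stick. -/
noncomputable def stickWeight (θ x y : ℕ → ℝ) (l s : ℝ) (m : ℕ) : ℝ≥0∞ :=
  ∫⁻ t in Ioc (max (withZero y m) l) (withZero y (m + 1)),
    ENNReal.ofReal (Real.exp (s * (t - max (withZero y m) l))) ∂mass θ x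

theorem prod_one_add_range (ν : ℕ → ℝ≥0∞) (n : ℕ) :
    ∏ m ∈ Finset.range n, (1 + ν m) =
      1 + ∑ m ∈ Finset.range n, ν m * ∏ k ∈ Finset.range m, (1 + ν k) := by
  induction n with
  | zero => simp
  | succ n ih =>
    rw [Finset.prod_range_succ, Finset.sum_range_succ, mul_add, mul_one, ← add_assoc, ← ih,
      mul_comm (ν n)]

theorem prod_one_add_le_exp {ν : ℕ → ℝ≥0∞} {n : ℕ} {c : ℝ}
    (h : ∑ m ∈ Finset.range n, ν m ≤ ENNReal.ofReal c) (hc : 0 ≤ c) :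
    ∏ m ∈ Finset.range n, (1 + ν m) ≤ ENNReal.ofReal (Real.exp c) := by
  have hfin : ∀ m ∈ Finset.range n, ν m ≠ ∞ := fun m hm =>
    ne_top_of_le_ne_top ENNReal.ofReal_ne_top
      ((Finset.single_le_sum (f := ν) (fun _ _ => zero_le) hm).trans h)
  have h1 : ∏ m ∈ Finset.range n, (1 + ν m) =
      ENNReal.ofReal (∏ m ∈ Finset.range n, (1 + (ν m).toReal)) := by
    rw [ENNReal.ofReal_prod_of_nonneg fun m _ => by positivity]
    refine Finset.prod_congr rfl fun m hm => ?_
    rw [ENNReal.ofReal_add zero_le_one ENNReal.toReal_nonneg, ENNReal.ofReal_one,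
      ENNReal.ofReal_toReal (hfin m hm)]
  rw [h1]
  refine ENNReal.ofReal_le_ofReal ?_
  calc _ ≤ ∏ m ∈ Finset.range n, Real.exp (ν m).toReal :=
        Finset.prod_le_prod (fun m _ => by positivity) fun m _ => by
          rw [add_comm]; exact Real.add_one_le_exp _
    _ = Real.exp (∑ m ∈ Finset.range n, (ν m).toReal) := (Real.exp_sum _ _).symm
    _ ≤ _ := by
        rw [← ENNReal.toReal_sum hfin]
        exact Real.exp_le_exp.2 (ENNReal.toReal_le_of_le_ofReal hc h)

theorem withZero_monotone (hy : StrictMono y) (hy0 : ∀ i, 0 ≤ y i) : Monotone (withZero y) := by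
  refine monotone_nat_of_le_succ fun n => ?_
  cases n with
  | zero => exact hy0 0
  | succ n => exact (hy (Nat.lt_succ_self n)).le

/-- The exponential of the length of a path, as a function of its first stick. -/
theorem exp_climb_le (l s : ℝ) (hy : Monotone (withZero y)) (z : ℕ → ℝ) (n : ℕ) :
    ENNReal.ofReal (Real.exp (s * climb l y z n)) ≤ 1 + ∑ m ∈ Finset.range n,
      (Ioc (max (withZero y m) l) (withZero y (m + 1))).indicator (fun t => ENNReal.ofReal
        (Real.exp (s * (t - max (withZero y m) l)))) (withZero z n) *
      ENNReal.ofReal (Real.exp (s * climb l y z m)) := by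
  by_cases h : ∃ m < n, l < withZero z n ∧ withZero z n ∈ Ioc (withZero y m) (withZero y (m + 1))
  · obtain ⟨m, hmn, hl, hm⟩ := h
    rw [climb_of_mem hy hmn hl hm, mul_add, Real.exp_add, ENNReal.ofReal_mul (Real.exp_pos _).le]
    refine le_trans (le_trans ?_ (Finset.single_le_sum (fun _ _ => zero_le)
      (Finset.mem_range.2 hmn))) le_add_self
    have : withZero z n ∈ Ioc (max (withZero y m) l) (withZero y (m + 1)) :=
      ⟨max_lt hm.1 hl, hm.2⟩
    rw [indicator_of_mem this]
  · have : climb l y z n = 0 := by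
      rw [climb_def]
      refine Finset.sum_eq_zero fun m hm => if_neg fun h' => h ⟨m, Finset.mem_range.1 hm, h'⟩
    rw [this]
    simp

theorem measurable_climb_right (l : ℝ) (y : ℕ → ℝ) (n : ℕ) :
    Measurable fun z : ℕ → ℝ => climb l y z n :=
  (measurable_climb l n).comp (f := fun z : ℕ → ℝ => (y, z)) (by fun_prop)

/-- The glue point of index `n + 1` is independent of the lengths of the paths of smaller index. -/
theorem IsGlueLaw.indepFun_climb (hR : IsGlueLaw θ x y ρ) (l : ℝ) {m n : ℕ} (hmn : m ≤ n) :
    IndepFun (fun z : ℕ → ℝ => z n) (fun z => climb l y z m) ρ := by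
  have h := hR.indep.indepFun_finset {n} (Finset.range m) (by simpa using hmn)
    (fun i => measurable_pi_apply i)
  set ext : ((i : Finset.range m) → ℝ) → ℕ → ℝ := fun w i =>
    if hi : i ∈ Finset.range m then w ⟨i, hi⟩ else 0 with hext
  have hextm : Measurable ext := measurable_pi_lambda _ fun i => by
    by_cases hi : i ∈ Finset.range m
    · simp only [hext, hi, dite_true]; exact measurable_pi_apply _
    · simp only [hext, hi, dite_false]; exact measurable_const
  have hφ : Measurable fun w : ({n} : Finset ℕ) → ℝ => w ⟨n, Finset.mem_singleton_self n⟩ :=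
    measurable_pi_apply _
  have h2 := h.comp (ψ := fun w => climb l y (ext w) m) hφ
    ((measurable_climb_right l y m).comp hextm)
  have e : (fun z : ℕ → ℝ => climb l y z m) = (fun w => climb l y (ext w) m) ∘
      fun z (i : Finset.range m) => z i := by
    funext z
    exact climb_congr fun i hi => by simp [hext, hi]
  rw [e]
  exact h2

/-- The exponential moment of the length of a path, by induction over the sticks it runs through. -/
theorem IsGlueLaw.lintegral_exp_climb_le [IsProbabilityMeasure ρ] (hR : IsGlueLaw θ x y ρ)
    (hy : StrictMono y) (hy0 : ∀ i, 0 ≤ y i) (l s : ℝ) (n : ℕ) :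
    ∫⁻ z, ENNReal.ofReal (Real.exp (s * climb l y z n)) ∂ρ ≤
      ∏ m ∈ Finset.range n, (1 + (mass θ x (Icc 0 l))⁻¹ * stickWeight θ x y l s m) := by
  have hmono := withZero_monotone hy hy0
  induction n using Nat.strong_induction_on with
  | _ n ih =>
    rcases le_or_gt (withZero y n) l with hn | hn
    · -- below `l`, a stick of index `< n` carries no path
      refine (lintegral_mono fun z => exp_climb_le l s hmono z n).trans ?_
      have : ∀ z : ℕ → ℝ, ∑ m ∈ Finset.range n,
          (Ioc (max (withZero y m) l) (withZero y (m + 1))).indicator (fun t => ENNReal.ofReal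
            (Real.exp (s * (t - max (withZero y m) l)))) (withZero z n) *
          ENNReal.ofReal (Real.exp (s * climb l y z m)) = 0 := fun z =>
        Finset.sum_eq_zero fun m hm => by
          rw [Ioc_eq_empty]
          · simp
          · exact not_lt.2 (((hmono (Finset.mem_range.1 hm)).trans hn).trans (le_max_right _ _))
      simp_rw [this]
      simp only [add_zero, lintegral_const, measure_univ, mul_one]
      exact Finset.one_le_prod' fun m _ => le_self_add
    · cases n with
      | zero =>
        have : ∀ z, climb l y z 0 = 0 := fun z => by rw [climb_def]; simp
        simp [this]
      | succ n =>
        have hym : ∀ m, Measurable fun t : ℝ => (Ioc (max (withZero y m) l)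
            (withZero y (m + 1))).indicator (fun t => ENNReal.ofReal
            (Real.exp (s * (t - max (withZero y m) l)))) t := fun m =>
          Measurable.indicator (by fun_prop) measurableSet_Ioc
        have hcm : ∀ m, Measurable fun z : ℕ → ℝ =>
            ENNReal.ofReal (Real.exp (s * climb l y z m)) := fun m =>
          ENNReal.measurable_ofReal.comp (Real.measurable_exp.comp
            ((measurable_climb_right l y m).const_mul s))
        have hzm : ∀ m, Measurable fun z : ℕ → ℝ => (Ioc (max (withZero y m) l)
            (withZero y (m + 1))).indicator (fun t => ENNReal.ofReal
            (Real.exp (s * (t - max (withZero y m) l)))) (z n) := fun m =>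
          (hym m).comp (measurable_pi_apply n)
        have hprod : ∀ m ∈ Finset.range (n + 1), Measurable fun z : ℕ → ℝ =>
            (Ioc (max (withZero y m) l) (withZero y (m + 1))).indicator (fun t => ENNReal.ofReal
              (Real.exp (s * (t - max (withZero y m) l)))) (withZero z (n + 1)) *
            ENNReal.ofReal (Real.exp (s * climb l y z m)) := fun m _ => (hzm m).mul (hcm m)
        refine (lintegral_mono fun z => exp_climb_le l s hmono z (n + 1)).trans ?_
        rw [lintegral_add_left measurable_const, lintegral_const, measure_univ, mul_one,
          lintegral_finsetSum _ hprod, prod_one_add_range]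
        gcongr with m hm
        have hm' : m < n + 1 := Finset.mem_range.1 hm
        have hindep := (hR.indepFun_climb l (Nat.lt_succ_iff.1 hm')).comp (hym m)
          (ψ := fun c => ENNReal.ofReal (Real.exp (s * c))) (by fun_prop)
        have hmul := lintegral_mul_eq_lintegral_mul_lintegral_of_indepFun (hzm m) (hcm m) hindep
        refine (le_of_eq hmul).trans ?_
        refine mul_le_mul' ?_ (ih m hm')
        rw [hR.lintegral_coord n (hym m)]
        have h1 : mass θ x (Icc 0 l) ≤ mass θ x (Icc 0 (y n)) := mass_Icc_mono hn.le
        gcongr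
        rw [stickWeight, ← lintegral_indicator measurableSet_Ioc]
        exact setLIntegral_le_lintegral _ _

/-- On the stick of index `m` beyond `l`, the gap between `t` and the last cut is
`t - max (withZero y m) l`. -/
theorem exp_le_gapWeight {l t : ℝ} {N m : ℕ} (hy : StrictMono y) (hy0 : ∀ i, 0 ≤ y i)
    (ht : t ∈ Ioc (max (withZero y m) l) (withZero y (m + 1))) :
    ENNReal.ofReal (Real.exp (2 ^ N / 4 * (t - max (withZero y m) l))) ≤ gapWeight l N y t := by
  have hmono := withZero_monotone hy hy0
  set φ := t - max (withZero y m) l with hφ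
  have hφ0 : 0 < φ := sub_pos.2 ht.1
  set k := ⌊φ * 2 ^ N⌋₊
  have hk1 : (k : ℝ) ≤ φ * 2 ^ N := Nat.floor_le (by positivity)
  have hk2 : φ * 2 ^ N < k + 1 := Nat.lt_floor_add_one _
  have hk3 : (k : ℝ) / 2 ^ N ≤ φ := (div_le_iff₀ (by positivity)).2 hk1
  have hmax1 := le_max_left (withZero y m) l
  have hmax2 := le_max_right (withZero y m) l
  have hmem : y ∈ {y : ℕ → ℝ | l ≤ t - k / 2 ^ N ∧ ∀ i, y i ∉ Ioo (t - k / 2 ^ N) t} := by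
    refine ⟨by linarith, fun i hi => ?_⟩
    have h1 : withZero y m < withZero y (i + 1) := by
      have : withZero y (i + 1) = y i := rfl
      linarith [hi.1]
    have h2 : withZero y (i + 1) < withZero y (m + 1) := lt_of_lt_of_le hi.2 ht.2
    have h3 := hmono.reflect_lt h1
    have h4 := hmono.reflect_lt h2
    omega
  refine le_trans ?_ (ENNReal.le_tsum k)
  rw [indicator_of_mem hmem]
  refine ENNReal.ofReal_le_ofReal (Real.exp_le_exp.2 ?_)
  nlinarith

/-- The weights of the sticks, summed over the sticks that start before `l'`. -/
theorem sum_stickWeight_le {l l' : ℝ} {N n : ℕ} (hN : 0 < N) (hy : StrictMono y)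
    (hy0 : ∀ i, 0 ≤ y i) (hn : withZero y n ≤ l') :
    ∑ m ∈ Finset.range n, stickWeight θ x y l (2 ^ N / 8) m ≤
      ENNReal.ofReal N * mass θ x (Ioc l l') +
      ENNReal.ofReal (1 / N) * ∫⁻ t in Ioc l l', gapWeight l N y t ∂mass θ x := by
  have hmono := withZero_monotone hy hy0
  have hN' : (0:ℝ) < N := by exact_mod_cast hN
  have hW : Measurable fun t => gapWeight l N y t :=
    (measurable_gapWeight l N).comp (f := fun t : ℝ => (t, y)) (by fun_prop)
  have hterm : ∀ m ∈ Finset.range n, stickWeight θ x y l (2 ^ N / 8) m ≤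
      ∫⁻ t in Ioc (max (withZero y m) l) (withZero y (m + 1)),
        (ENNReal.ofReal N + ENNReal.ofReal (1 / N) * gapWeight l N y t) ∂mass θ x := by
    intro m _
    refine setLIntegral_mono' measurableSet_Ioc fun t ht => ?_
    refine le_trans ?_ (add_le_add_right (mul_le_mul_right
      (exp_le_gapWeight (N := N) hy hy0 ht) _) _)
    rw [← ENNReal.ofReal_mul (by positivity), ← ENNReal.ofReal_add (by positivity) (by positivity)]
    refine ENNReal.ofReal_le_ofReal ?_
    set e := Real.exp (2 ^ N / 8 * (t - max (withZero y m) l))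
    have he : Real.exp (2 ^ N / 4 * (t - max (withZero y m) l)) = e ^ 2 := by
      rw [← Real.exp_nat_mul]; congr 1; push_cast; ring
    rw [he]
    -- the inequality `e ≤ N + e² / N` lowers the exponential moment to the one that is bounded
    have e1 : (N:ℝ) + 1 / N * e ^ 2 - e = ((N - e / 2) ^ 2 + 3 / 4 * e ^ 2) / N := by
      field_simp; ring
    have : 0 ≤ (N:ℝ) + 1 / N * e ^ 2 - e := by rw [e1]; positivity
    linarith
  refine (Finset.sum_le_sum hterm).trans ?_
  rw [← lintegral_biUnion_finset (t := fun m => Ioc (max (withZero y m) l) (withZero y (m + 1)))]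
  · calc _ ≤ ∫⁻ t in Ioc l l', (ENNReal.ofReal N + ENNReal.ofReal (1 / N) * gapWeight l N y t)
          ∂mass θ x := by
          refine lintegral_mono_set (iUnion₂_subset fun m hm => ?_)
          exact Ioc_subset_Ioc (le_max_right _ _) ((hmono (Finset.mem_range.1 hm)).trans hn)
      _ = _ := by
          rw [lintegral_add_left measurable_const, setLIntegral_const, lintegral_const_mul _ hW]
  · intro i _ j _ hij
    rw [Function.onFun, Set.disjoint_left]
    intro t h1 h2
    exact hij (stick_unique hmono ⟨(le_max_left _ _).trans_lt h1.1, h1.2⟩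
      ⟨(le_max_left _ _).trans_lt h2.1, h2.2⟩)
  · exact fun _ _ => measurableSet_Ioc

/-- The bound for the lengths of the paths from `[0, 𝒳(2ⁿ⁺¹)]` down to `[0, 𝒳(2ⁿ)]`. -/
noncomputable def climbBound (q : ℕ → ℝ) (n : ℕ) : ℝ := 152 * Real.log (q (n + 1)) / 2 ^ n

/-- Almost surely, for `n` large all the cuts before `𝒳(2ⁿ⁺¹)` are glued close to `[0, 𝒳(2ⁿ)]`. The
exponential moments of order `2ⁿ / 8` of the path lengths are at most `e^(10n)`, which a union bound
over the at most `𝒳(2ⁿ⁺¹)³` cuts turns into a uniform bound. -/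
theorem IsGlueLaw.ae_climb_le [IsProbabilityMeasure ρ] (hR : IsGlueLaw θ x y ρ)
    (hθ : IsParameter θ) (hq : IsDyadicQuantile θ q)
    (hx : ∀ᶠ n in atTop, MassRegular θ q x n) (hy : StrictMono y) (hy0 : ∀ i, 0 ≤ y i)
    (hW : ∀ᶠ n : ℕ in atTop, ∫⁻ t in Ioc (q n) (q (n + 1)), gapWeight (q n) n y t ∂mass θ x ≤
      ENNReal.ofReal (n ^ 2 * 2 ^ n))
    (hc : ∀ᶠ n : ℕ in atTop, (count (Icc 0 (q (n + 1))) y : ℝ≥0∞) ≤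
      ENNReal.ofReal (q (n + 1) ^ 3)) :
    ∀ᵐ z ∂ρ, ∀ᶠ n : ℕ in atTop, ∀ i, y i ≤ q (n + 1) →
      climb (q n) y z (i + 1) ≤ climbBound q n := by
  refine ae_eventually_of_summable (g := fun n : ℕ => (1 / 2 : ℝ) ^ n)
    (summable_geometric_of_lt_one (by norm_num) (by norm_num)) ?_
  filter_upwards [hx, (tendsto_add_atTop_nat 1).eventually hx, hW, hc, eventually_gt_atTop 0]
    with n h1 h2 h3 h4 h5
  have hn : (0:ℝ) < n := by exact_mod_cast h5
  have hp := hq.pos hθ (n + 1)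
  set a := Real.log (q (n + 1)) with ha
  have ha1 : 0.69 * (n + 1) ≤ a := log_quantile_ge hθ hq n
  -- exponential moments, uniformly in the index
  have hmom : ∀ i, y i ≤ q (n + 1) →
      ∫⁻ z, ENNReal.ofReal (Real.exp (2 ^ n / 8 * climb (q n) y z (i + 1))) ∂ρ ≤
        ENNReal.ofReal (Real.exp (10 * n)) := by
    intro i hi
    refine (hR.lintegral_exp_climb_le hy hy0 (q n) (2 ^ n / 8) (i + 1)).trans
      (prod_one_add_le_exp ?_ (by positivity))
    rw [← Finset.mul_sum]
    have hs := sum_stickWeight_le (θ := θ) (x := x) (l := q n) (l' := q (n + 1)) (n := i + 1) h5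
      hy hy0 hi
    have hm : mass θ x (Ioc (q n) (q (n + 1))) ≤ ENNReal.ofReal (2 * 2 ^ (n + 1)) :=
      (measure_mono (Ioc_subset_Icc_self.trans (Icc_subset_Icc_left (hq n).1))).trans h2.2
    calc _ ≤ (ENNReal.ofReal (2 ^ n / 2))⁻¹ * (ENNReal.ofReal n * ENNReal.ofReal (2 * 2 ^ (n + 1)) +
          ENNReal.ofReal (1 / n) * ENNReal.ofReal (n ^ 2 * 2 ^ n)) := by
          refine mul_le_mul' (ENNReal.inv_le_inv.2 h1.1) (hs.trans ?_)
          gcongr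
      _ = _ := by
          rw [← ENNReal.ofReal_inv_of_pos (by positivity), ← ENNReal.ofReal_mul (by positivity),
            ← ENNReal.ofReal_mul (by positivity), ← ENNReal.ofReal_add (by positivity)
            (by positivity), ← ENNReal.ofReal_mul (by positivity)]
          congr 1
          field_simp
          ring
  have hsingle : ∀ i, y i ≤ q (n + 1) → ρ {z | ¬ climb (q n) y z (i + 1) ≤ climbBound q n} ≤
      ENNReal.ofReal (Real.exp (10 * n) / Real.exp (19 * a)) := by
    intro i hi
    have hmeas : Measurable fun z : ℕ → ℝ =>
        ENNReal.ofReal (Real.exp (2 ^ n / 8 * climb (q n) y z (i + 1))) :=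
      ENNReal.measurable_ofReal.comp (Real.measurable_exp.comp
        ((measurable_climb_right (q n) y (i + 1)).const_mul _))
    refine le_trans (measure_mono fun z hz => ?_)
      (measure_gt_ofReal_le hmeas.aemeasurable (Real.exp_pos (19 * a)) (hmom i hi))
    have hz' : climbBound q n < climb (q n) y z (i + 1) := not_le.1 hz
    refine not_le.2 ((ENNReal.ofReal_lt_ofReal_iff (Real.exp_pos _)).2 (Real.exp_lt_exp.2 ?_))
    have e : 19 * a = 2 ^ n / 8 * climbBound q n := by
      simp only [climbBound, ha]; field_simp; ring
    rw [e]
    gcongr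
  -- union bound over the cuts before `𝒳(2ⁿ⁺¹)`
  have hfinite : {i | y i ∈ Icc 0 (q (n + 1))}.Finite := by
    rw [← Set.encard_ne_top_iff]
    intro htop
    rw [count, htop] at h4
    simp at h4
  set I := hfinite.toFinset with hI
  have hcard : (I.card : ℝ) ≤ q (n + 1) ^ 3 := by
    rw [count, hfinite.encard_eq_coe_toFinset_card, ENat.toENNReal_coe, ← ENNReal.ofReal_natCast,
      ENNReal.ofReal_le_ofReal_iff (by positivity)] at h4
    exact h4
  have hsub : {z : ℕ → ℝ | ¬ ∀ i, y i ≤ q (n + 1) → climb (q n) y z (i + 1) ≤ climbBound q n} ⊆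
      ⋃ i ∈ I, {z | ¬ climb (q n) y z (i + 1) ≤ climbBound q n} := by
    intro z hz
    have hz' : ¬ ∀ i, y i ≤ q (n + 1) → climb (q n) y z (i + 1) ≤ climbBound q n := hz
    push Not at hz'
    obtain ⟨i, hi, hlt⟩ := hz'
    refine mem_biUnion (x := i) ?_ (not_le.2 hlt)
    exact Finset.mem_coe.2 (hfinite.mem_toFinset.2 ⟨hy0 i, hi⟩)
  refine (measure_mono hsub).trans ((measure_biUnion_finset_le _ _).trans
    ((Finset.sum_le_sum fun i hi => hsingle i (hfinite.mem_toFinset.1 hi).2).trans ?_))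
  rw [Finset.sum_const, nsmul_eq_mul, ← ENNReal.ofReal_natCast,
    ← ENNReal.ofReal_mul (by positivity)]
  refine ENNReal.ofReal_le_ofReal ?_
  have hexp : q (n + 1) = Real.exp a := (Real.exp_log hp).symm
  calc (I.card : ℝ) * (Real.exp (10 * n) / Real.exp (19 * a)) ≤
      q (n + 1) ^ 3 * (Real.exp (10 * n) / Real.exp (19 * a)) := by gcongr
    _ = Real.exp (3 * a + 10 * n - 19 * a) := by
      rw [Real.exp_sub, Real.exp_add, hexp, ← Real.exp_nat_mul]
      push_cast
      ring
    _ ≤ Real.exp (-a) := Real.exp_le_exp.2 (by linarith)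
    _ = 1 / q (n + 1) := by rw [Real.exp_neg, ← hexp, one_div]
    _ ≤ 1 / 2 ^ n := by
      gcongr
      exact (pow_le_pow_right₀ (by norm_num) (by omega)).trans (hq.two_pow_le hθ (n + 1))
    _ = _ := by rw [one_div_pow]

end

/-! ### Gluing branches on the tops of the blocks -/

section

variable {θ q u x y : ℕ → ℝ} {ρ : Measure (ℕ → ℝ)}

/-- The probability that none of the glue points of index in `I` lies in a set `A`. -/
theorem IsGlueLaw.measure_forall_notMem_le [IsProbabilityMeasure ρ] (hR : IsGlueLaw θ x y ρ)
    {A : Set ℝ} (hA : MeasurableSet A) (I : Finset ℕ) {w m : ℝ} (hm : 0 < m) (hw : 0 ≤ w)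
    (hAw : ENNReal.ofReal w ≤ mass θ x A)
    (hI : ∀ i ∈ I, A ⊆ Icc 0 (y i) ∧ mass θ x (Icc 0 (y i)) ≤ ENNReal.ofReal m) :
    ρ {z | ∀ i ∈ I, z i ∉ A} ≤ ENNReal.ofReal (Real.exp (-(w / m * I.card))) := by
  have hset : {z : ℕ → ℝ | ∀ i ∈ I, z i ∉ A} = ⋂ i ∈ I, (fun z : ℕ → ℝ => z i) ⁻¹' Aᶜ := by
    ext z; simp
  have hterm : ∀ i ∈ I, ρ ((fun z : ℕ → ℝ => z i) ⁻¹' Aᶜ) ≤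
      ENNReal.ofReal (Real.exp (-(w / m))) := by
    intro i hi
    obtain ⟨h1, h2⟩ := hI i hi
    have h3 : ENNReal.ofReal (w / m) ≤ ρ ((fun z : ℕ → ℝ => z i) ⁻¹' A) := by
      rw [← Measure.map_apply (measurable_pi_apply i) hA, hR.law i, cond_apply measurableSet_Icc,
        inter_eq_self_of_subset_right h1, div_eq_inv_mul, ENNReal.ofReal_mul (by positivity),
        ENNReal.ofReal_inv_of_pos hm]
      gcongr
    rw [preimage_compl, prob_compl_eq_one_sub (measurable_pi_apply i hA)]
    calc _ ≤ 1 - ENNReal.ofReal (w / m) := tsub_le_tsub_left h3 _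
      _ = ENNReal.ofReal (1 - w / m) := by
        rw [ENNReal.ofReal_sub _ (by positivity), ENNReal.ofReal_one]
      _ ≤ _ := ENNReal.ofReal_le_ofReal (Real.one_sub_le_exp_neg _)
  rw [hset, hR.indep.measure_inter_preimage_eq_mul I fun i _ => hA.compl]
  refine (Finset.prod_le_pow_card _ _ _ hterm).trans (le_of_eq ?_)
  rw [← ENNReal.ofReal_pow (Real.exp_pos _).le, ← Real.exp_nat_mul]
  congr 2
  ring

/-- In a block with a cut in its head and none in the rest, the last cut of the head starts a stick
that covers the rest of the block. -/
theorem IsCutBlock.exists_last {n j : ℕ} (h : IsCutBlock u y n j) (hy : StrictMono y)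
    (hy' : Tendsto y atTop atTop) :
    ∃ i, y i ∈ blockHead u n j ∧ blockStart u n j + 3 * blockLen u n < y (i + 1) := by
  classical
  obtain ⟨⟨i, hi⟩, ht⟩ := h
  have hex : ∃ k, blockStart u n j + blockLen u n < y k :=
    (hy'.eventually_gt_atTop _).exists
  have hk := Nat.find_spec hex
  have hik : i < Nat.find hex := by
    rw [← hy.lt_iff_lt]
    exact hi.2.trans_lt hk
  obtain ⟨m, hm⟩ := Nat.exists_eq_succ_of_ne_zero (n := Nat.find hex) (by omega)
  have hm' : ¬ blockStart u n j + blockLen u n < y m := Nat.find_min hex (by omega)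
  refine ⟨m, ⟨hi.1.trans_le (hy.monotone (by omega)), not_lt.1 hm'⟩, ?_⟩
  have h2 := ht (Nat.find hex)
  rw [hm] at h2 hk
  by_contra! h3
  exact h2 ⟨hk, h3⟩

/-- Some branch of scale `n` is glued on the top of the block `j` of scale `p`: the branch covers
the last two thirds of a charged block of scale `n`. -/
def IsAttached (θ u x y z : ℕ → ℝ) (n p j : ℕ) : Prop :=
  ∃ j' ∈ cutBlocks θ u x y n, ∃ i, y i ∈ blockHead u n j' ∧
    blockStart u n j' + 3 * blockLen u n < y (i + 1) ∧ z i ∈ blockTop u p j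

/-- There are about `2ⁿ uₙ¹¹` branches of scale `n`, each glued on the given top with probability at
least a constant times `2⁻ⁿ uₙ⁻¹⁰`. -/
theorem IsGlueLaw.measure_not_isAttached_le [IsProbabilityMeasure ρ] (hR : IsGlueLaw θ x y ρ)
    (hθ : IsParameter θ) (hq : IsDyadicQuantile θ q) (hu : IsWindowScale θ q u)
    (hy : StrictMono y) (hy' : Tendsto y atTop atTop) {n p j : ℕ} (hun : 1 < u n) (hup : 1 < u p)
    (hpn : u p ^ 16 ≤ u n ^ 16 / 2) (hx : MassRegular θ q x (n + 2))
    (hcard : 2 ^ n * u n ^ 11 / 1024 ≤ ((cutBlocks θ u x y n).card : ℝ))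
    (hgood : u p ^ 18 ≤ u n ^ 10) (hj : j < numBlocks u p) (hch : IsCharged θ u x p j) :
    ρ {z | ¬ IsAttached θ u x y z n p j} ≤ ENNReal.ofReal (Real.exp (-(u n / 8192))) := by
  classical
  have hex : ∀ j' ∈ cutBlocks θ u x y n, ∃ i, y i ∈ blockHead u n j' ∧
      blockStart u n j' + 3 * blockLen u n < y (i + 1) := fun j' hj' =>
    (Finset.mem_filter.1 hj').2.exists_last hy hy'
  choose! f hf1 hf2 using hex
  set I := (cutBlocks θ u x y n).image f with hI
  have hinj : I.card = (cutBlocks θ u x y n).card := by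
    refine Finset.card_image_of_injOn fun a ha b hb hab => ?_
    by_contra hne
    have hab' : f a = f b := hab
    have h1 := hf1 a ha
    rw [hab'] at h1
    exact Set.disjoint_left.1 (disjoint_of_blocks hun hne (blockHead_subset hun a)
      (blockHead_subset hun b)) h1 (hf1 b hb)
  have hsub : {z : ℕ → ℝ | ¬ IsAttached θ u x y z n p j} ⊆
      {z | ∀ i ∈ I, z i ∉ blockTop u p j} := by
    intro z hz i hi hzi
    obtain ⟨j', hj', rfl⟩ := Finset.mem_image.1 hi
    exact hz ⟨j', hj', f j', hf1 j' hj', hf2 j' hj', hzi⟩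
  have hu0 := hu.pos n
  have hp0 := hu.pos p
  have hIb : ∀ i ∈ I, blockTop u p j ⊆ Icc 0 (y i) ∧
      mass θ x (Icc 0 (y i)) ≤ ENNReal.ofReal (2 * 2 ^ (n + 2)) := by
    intro i hi
    obtain ⟨j', hj', rfl⟩ := Finset.mem_image.1 hi
    have hj'' : j' < numBlocks u n := Finset.mem_range.1
      (Finset.mem_filter.1 (Finset.mem_filter.1 hj').1).1
    have hw := block_subset_window hun hj'' (blockHead_subset hun j' (hf1 j' hj'))
    refine ⟨fun t ht => ?_, ?_⟩
    · have ht' := block_subset_window hup hj (blockTop_subset hup j ht)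
      have : 0 < u p ^ 16 := by positivity
      exact ⟨by linarith [ht'.1], by linarith [ht'.2, hw.1]⟩
    · exact (mass_Icc_mono (hw.2.trans (hu.pow_le_quantile hθ hq n))).trans hx.2
  refine (measure_mono hsub).trans ((hR.measure_forall_notMem_le (blockTop_measurable p j) I
    (w := 1 / u p ^ 18) (m := 2 * 2 ^ (n + 2)) (by positivity) (by positivity) hch hIb).trans ?_)
  refine ENNReal.ofReal_le_ofReal (Real.exp_le_exp.2 (neg_le_neg ?_))
  rw [hinj]
  calc u n / 8192 = 1 / u n ^ 10 / (2 * 2 ^ (n + 2)) * (2 ^ n * u n ^ 11 / 1024) := by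
        field_simp; ring
    _ ≤ _ := by gcongr

/-- The scales at which the sequence `bₙ = uₙ¹⁶` grows fast, `bₙ ≥ bₙ₋₁^(9/5)`. The exponent is so
large that the branches of scale `n` reach all the charged blocks of the previous scales, and being
less than `2` it makes `log bₙ / 2ⁿ` decrease geometrically along the other scales. At `n = 0` the
condition, with the truncated index, is harmless as there are no previous scales. -/
def IsFastScale (u : ℕ → ℝ) (n : ℕ) : Prop := u (n - 1) ^ 9 ≤ u n ^ 5

theorem numBlocks_le {p : ℕ} (h : 3 ≤ u p) : (numBlocks u p : ℝ) ≤ 3 * 2 ^ p * u p ^ 16 := by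
  have h1 : 1 ≤ Real.log (u p) := by
    rw [Real.le_log_iff_exp_le (by linarith)]
    linarith [Real.exp_one_lt_d9]
  have hb := blockLen_pos (u := u) (n := p) (by linarith)
  refine (Nat.floor_le (by positivity)).trans ?_
  have h2 : 1 / (16 * 2 ^ p) ≤ blockLen u p := by unfold blockLen; gcongr
  rw [div_le_iff₀ (by positivity)]
  have h3 : 0 < u p ^ 16 := by positivity
  calc u p ^ 16 ≤ 3 * 2 ^ p * u p ^ 16 * (6 * (1 / (16 * 2 ^ p))) := by
        have : 3 * 2 ^ p * u p ^ 16 * (6 * (1 / (16 * 2 ^ p))) = 9 / 8 * u p ^ 16 := by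
          field_simp; norm_num
        rw [this]; linarith
    _ ≤ _ := by gcongr

/-- Almost surely, at each large fast scale branches are glued on all the charged blocks of the
previous scales with `u p ≥ 3`. -/
theorem IsGlueLaw.ae_isAttached [IsProbabilityMeasure ρ] (hR : IsGlueLaw θ x y ρ)
    (hθ : IsParameter θ) (hq : IsDyadicQuantile θ q) (hu : IsWindowScale θ q u)
    (hx : ∀ᶠ n in atTop, MassRegular θ q x n) (hy : StrictMono y) (hy' : Tendsto y atTop atTop)
    (hc : ∀ᶠ n in atTop, 2 ^ n * u n ^ 11 / 1024 ≤ ((cutBlocks θ u x y n).card : ℝ)) :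
    ∀ᵐ z ∂ρ, ∀ᶠ n : ℕ in atTop, IsFastScale u n → ∀ p < n, 3 ≤ u p →
      ∀ j < numBlocks u p, IsCharged θ u x p j → IsAttached θ u x y z n p j := by
  have hut := hu.tendsto hθ hq
  refine ae_eventually_of_summable (g := fun n => 3 * (u n)⁻¹)
    ((hu.summable_inv hθ hq).mul_left 3) ?_
  have hexp : ∀ᶠ n in atTop, u n ^ 49 * Real.exp (-(u n / 8192)) ≤ 1 := by
    have h1 := (Real.tendsto_pow_mul_exp_neg_atTop_nhds_zero 49).comp
      (hut.atTop_div_const (show (0:ℝ) < 8192 by norm_num))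
    filter_upwards [h1.eventually (gt_mem_nhds (show (0:ℝ) < 1 / 8192 ^ 49 by positivity))]
      with n hn
    simp only [Function.comp_apply] at hn
    have e : (u n / 8192) ^ 49 = u n ^ 49 / 8192 ^ 49 := by rw [div_pow]
    rw [e, lt_div_iff₀ (by positivity)] at hn
    calc _ = u n ^ 49 / 8192 ^ 49 * Real.exp (-(u n / 8192)) * 8192 ^ 49 := by field_simp
      _ ≤ _ := hn.le
  filter_upwards [(tendsto_add_atTop_nat 2).eventually hx, hc, hexp] with n h1 h2 h3
  by_cases hF : IsFastScale u n
  swap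
  · have : {z : ℕ → ℝ | ¬ (IsFastScale u n → ∀ p < n, 3 ≤ u p →
      ∀ j < numBlocks u p, IsCharged θ u x p j → IsAttached θ u x y z n p j)} = ∅ := by
      ext z; simp [hF]
    rw [this]
    simp
  have hu0 := hu.pos n
  have hsub : {z : ℕ → ℝ | ¬ (IsFastScale u n → ∀ p < n, 3 ≤ u p →
      ∀ j < numBlocks u p, IsCharged θ u x p j → IsAttached θ u x y z n p j)} ⊆
      ⋃ p ∈ Finset.range n, ⋃ j ∈ Finset.range (numBlocks u p),
        {z | 3 ≤ u p ∧ IsCharged θ u x p j ∧ ¬ IsAttached θ u x y z n p j} := by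
    intro z hz
    have hz' : ¬ (IsFastScale u n → ∀ p < n, 3 ≤ u p →
      ∀ j < numBlocks u p, IsCharged θ u x p j → IsAttached θ u x y z n p j) := hz
    push Not at hz'
    obtain ⟨-, p, hp, hup, j, hj, hch, hna⟩ := hz'
    exact mem_biUnion (x := p) (Finset.mem_coe.2 (Finset.mem_range.2 hp))
      (mem_biUnion (x := j) (Finset.mem_coe.2 (Finset.mem_range.2 hj)) ⟨hup, hch, hna⟩)
  have hsingle : ∀ p ∈ Finset.range n, ∀ j ∈ Finset.range (numBlocks u p),
      ρ {z | 3 ≤ u p ∧ IsCharged θ u x p j ∧ ¬ IsAttached θ u x y z n p j} ≤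
        ENNReal.ofReal (Real.exp (-(u n / 8192))) := by
    intro p hp j hj
    by_cases hcond : 3 ≤ u p ∧ IsCharged θ u x p j
    swap
    · have : {z : ℕ → ℝ | 3 ≤ u p ∧ IsCharged θ u x p j ∧ ¬ IsAttached θ u x y z n p j} = ∅ := by
        ext z
        simp only [mem_ofPred_eq, mem_empty_iff_false, iff_false]
        exact fun h => hcond ⟨h.1, h.2.1⟩
      rw [this]
      simp
    have hp' := Finset.mem_range.1 hp
    have hle : u p ≤ u (n - 1) := hu.mono (by omega)
    have hle' : u (n - 1) ≤ u n := hu.mono (by omega)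
    have hp3 := hcond.1
    have hgood : u p ^ 18 ≤ u n ^ 10 := by
      calc u p ^ 18 ≤ u (n - 1) ^ 18 := by gcongr
        _ = (u (n - 1) ^ 9) ^ 2 := by ring
        _ ≤ (u n ^ 5) ^ 2 := pow_le_pow_left₀ (pow_nonneg (hu.pos _).le 9) hF 2
        _ = _ := by ring
    have hhalf : u p ^ 16 ≤ u n ^ 16 / 2 := by
      by_contra! hlt
      have h5 : u n ^ 80 < 32 * u p ^ 80 := by
        calc u n ^ 80 = (u n ^ 16) ^ 5 := by ring
          _ < (2 * u p ^ 16) ^ 5 := by gcongr; linarith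
          _ = _ := by ring
      have h6 : u p ^ 144 ≤ u n ^ 80 := by
        calc u p ^ 144 = (u p ^ 18) ^ 8 := by ring
          _ ≤ (u n ^ 10) ^ 8 := by gcongr
          _ = _ := by ring
      have h7 : (32 : ℝ) ≤ u p ^ 64 :=
        calc (32:ℝ) ≤ 3 ^ 64 := by norm_num
          _ ≤ _ := by gcongr
      have h8 : u p ^ 144 = u p ^ 64 * u p ^ 80 := by ring
      have h9 : 0 < u p ^ 80 := by positivity
      nlinarith
    refine (measure_mono fun z hz => hz.2.2).trans (hR.measure_not_isAttached_le hθ hq hu hy hy'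
      (by linarith) (by linarith) hhalf h1 h2 hgood (Finset.mem_range.1 hj) hcond.2)
  have hinner : ∀ p ∈ Finset.range n, ρ (⋃ j ∈ Finset.range (numBlocks u p),
      {z | 3 ≤ u p ∧ IsCharged θ u x p j ∧ ¬ IsAttached θ u x y z n p j}) ≤
      ENNReal.ofReal (3 * u n ^ 32 * Real.exp (-(u n / 8192))) := by
    intro p hp
    by_cases h3p : 3 ≤ u p
    swap
    · simp [h3p]
    refine (measure_biUnion_finset_le _ _).trans ((Finset.sum_le_sum (hsingle p hp)).trans ?_)
    rw [Finset.sum_const, Finset.card_range, nsmul_eq_mul, ← ENNReal.ofReal_natCast,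
      ← ENNReal.ofReal_mul (by positivity)]
    refine ENNReal.ofReal_le_ofReal (mul_le_mul_of_nonneg_right ?_ (Real.exp_pos _).le)
    have hle : u p ≤ u n := hu.mono (Finset.mem_range.1 hp).le
    have h2p : (2:ℝ) ^ p ≤ u n ^ 16 :=
      (pow_le_pow_right₀ (by norm_num) (by have := Finset.mem_range.1 hp; omega)).trans
        (hu.two_pow_le hθ hq n)
    calc _ ≤ 3 * 2 ^ p * u p ^ 16 := numBlocks_le h3p
      _ ≤ 3 * u n ^ 16 * u n ^ 16 := by
        have := hu.pos p
        gcongr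
      _ = _ := by ring
  refine (measure_mono hsub).trans ((measure_biUnion_finset_le _ _).trans
    ((Finset.sum_le_sum hinner).trans ?_))
  rw [Finset.sum_const, Finset.card_range, nsmul_eq_mul, ← ENNReal.ofReal_natCast,
    ← ENNReal.ofReal_mul (by positivity)]
  refine ENNReal.ofReal_le_ofReal ?_
  have hn : (n : ℝ) ≤ u n ^ 16 := by
    refine le_trans ?_ (hu.two_pow_le hθ hq n)
    have : n < 2 ^ (n + 1) :=
      Nat.lt_two_pow_self.trans (Nat.pow_lt_pow_right (by norm_num) (by omega))
    exact_mod_cast this.le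
  calc (n : ℝ) * (3 * u n ^ 32 * Real.exp (-(u n / 8192))) ≤
      u n ^ 16 * (3 * u n ^ 32 * Real.exp (-(u n / 8192))) := by gcongr
    _ = 3 * (u n)⁻¹ * (u n ^ 49 * Real.exp (-(u n / 8192))) := by field_simp
    _ ≤ 3 * (u n)⁻¹ * 1 := by gcongr
    _ = _ := mul_one _

end

/-! ### The Hausdorff distance to the initial subtrees -/

section

variable {θ q u x y z : ℕ → ℝ}

/-- The tail `∑_{n > k} log 𝒳(2ⁿ) / 2ⁿ`. -/
noncomputable def tailSum (q : ℕ → ℝ) (k : ℕ) : ℝ≥0∞ :=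
  ∑' n : {n : ℕ // k < n}, ENNReal.ofReal (Real.log (q n) / 2 ^ (n : ℕ))

theorem tailSum_eq_indicator (q : ℕ → ℝ) (k : ℕ) : tailSum q k =
    ∑' n : ℕ, (Ioi k).indicator (fun n => ENNReal.ofReal (Real.log (q n) / 2 ^ n)) n :=
  tsum_subtype (Ioi k) fun n => ENNReal.ofReal (Real.log (q n) / 2 ^ n)

theorem sum_Ioc_le_tailSum (hq : ∀ n, 0 ≤ Real.log (q n)) (k N : ℕ) :
    ENNReal.ofReal (∑ n ∈ Finset.Ioc k N, Real.log (q n) / 2 ^ n) ≤ tailSum q k := by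
  rw [tailSum_eq_indicator, ENNReal.ofReal_sum_of_nonneg fun n _ => by
    have := hq n; positivity]
  refine le_trans (le_of_eq (Finset.sum_congr rfl fun n hn => ?_))
    (ENNReal.sum_le_tsum (Finset.Ioc k N))
  rw [indicator_of_mem (mem_Ioi.2 (Finset.mem_Ioc.1 hn).1)]

theorem tailSum_le (hq : ∀ n, 0 ≤ Real.log (q n)) {k : ℕ} {r : ℝ≥0∞}
    (h : ∀ N, ENNReal.ofReal (∑ n ∈ Finset.Ioc k N, Real.log (q n) / 2 ^ n) ≤ r) :
    tailSum q k ≤ r := by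
  rw [tailSum_eq_indicator]
  refine ENNReal.tsum_le_of_sum_range_le fun N => le_trans ?_ (h N)
  rw [ENNReal.ofReal_sum_of_nonneg fun n _ => by have := hq n; positivity,
    Finset.sum_indicator_eq_sum_filter]
  refine Finset.sum_le_sum_of_subset fun n hn => ?_
  rw [Finset.mem_filter, Finset.mem_range] at hn
  exact Finset.mem_Ioc.2 ⟨hn.2, hn.1.le⟩

theorem edist_coe (h : IsStickData y z) (a b : Line h) :
    edist (a : SB h) (b : SB h) = ENNReal.ofReal (lineDist y z a.val b.val) := by
  rw [UniformSpace.Completion.edist_eq, edist_dist]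
  rfl

/-- On the event that the branches are glued as expected, the top of some block is at distance at
least `∑ blockLen / 10` of the subtree `[0, 𝒳(2ᵏ)]`. It is reached through a chain of branches, one
for the scale `k + 1` and each fast scale beyond. The terms of the sum decrease geometrically along
the other scales, and the summand `9 * blockLen u N` accounts for the terms to come before the next
fast scale. -/
theorem exists_block_far (h : IsStickData y z) (hθ : IsParameter θ) (hq : IsDyadicQuantile θ q)
    (hu : IsWindowScale θ q u) {k : ℕ} (h3 : ∀ n > k, 3 ≤ u n)
    (hcut : ∀ n > k, (cutBlocks θ u x y n).Nonempty)
    (hatt : ∀ n > k, IsFastScale u n → ∀ p < n, 3 ≤ u p →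
      ∀ j < numBlocks u p, IsCharged θ u x p j → IsAttached θ u x y z n p j)
    {N : ℕ} (hN : k + 1 ≤ N) :
    ∃ p ∈ Ioc k N, ∃ j < numBlocks u p, IsCharged θ u x p j ∧ ∃ G : ℝ,
      (∀ t ∈ blockTop u p j, ∀ s ∈ Icc 0 (q k), G ≤ lineDist y z t s) ∧
      ∑ n ∈ Finset.Ioc k N, blockLen u n + 9 * blockLen u N ≤ 10 * G := by
  -- the stick of a cut block raises its top
  have hraise : ∀ n > k, ∀ j ∈ cutBlocks θ u x y n, ∀ i, y i ∈ blockHead u n j →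
      blockStart u n j + 3 * blockLen u n < y (i + 1) → ∀ G : ℝ,
      (∀ s ∈ Icc 0 (q k), G ≤ lineDist y z (z i) s) →
      j < numBlocks u n ∧ IsCharged θ u x n j ∧
        ∀ t ∈ blockTop u n j, ∀ s ∈ Icc 0 (q k), G + blockLen u n ≤ lineDist y z t s := by
    intro n hn j hj i hi hi' G hG
    classical
    have hch := Finset.mem_filter.1 (Finset.mem_filter.1 hj).1
    have hun : 1 < u n := by linarith [h3 n hn]
    have hb := blockLen_pos hun
    refine ⟨Finset.mem_range.1 hch.1, hch.2, fun t ht s hs => ?_⟩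
    have hqk : q k ≤ withZero y (i + 1) := by
      have h1 := blockStart_ge hun j
      have h2 := hu.le_pow n
      have h4 := (hq.strictMono hθ).monotone hn.le
      change q k ≤ y i
      linarith [hi.1]
    have hstick : t ∈ Ioc (withZero y (i + 1)) (withZero y (i + 1 + 1)) := by
      refine ⟨?_, (ht.2.trans hi'.le)⟩
      change y i < t
      linarith [hi.2, ht.1]
    have h5 := le_lineDist_of_glue h hstick hqk hG s hs
    have h6 : withZero y (i + 1) = y i := rfl
    rw [h6] at h5
    linarith [hi.2, ht.1]
  induction N, hN using Nat.le_induction with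
  | base =>
    classical
    obtain ⟨j, hj⟩ := hcut (k + 1) (by omega)
    obtain ⟨i, hi, hi'⟩ := (Finset.mem_filter.1 hj).2.exists_last h.strictMono h.tendsto
    obtain ⟨h1, h2, h4⟩ := hraise (k + 1) (by omega) j hj i hi hi' 0 fun s hs =>
      lineDist_nonneg h (h.glue_nonneg i) hs.1
    refine ⟨k + 1, ⟨by omega, le_rfl⟩, j, h1, h2, _, h4, ?_⟩
    rw [Nat.Ioc_succ_singleton, Finset.sum_singleton]
    linarith
  | succ N hN ih =>
    obtain ⟨p, hp, j, hj, hch, G, hG, hsum⟩ := ih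
    have hN1 := blockLen_pos (u := u) (n := N) (by linarith [h3 N (by omega)])
    have hN2 := blockLen_pos (u := u) (n := N + 1) (by linarith [h3 (N + 1) (by omega)])
    rw [← Finset.sum_Ioc_consecutive _ (show k ≤ N by omega) (Nat.le_succ N),
      Nat.succ_eq_add_one, Nat.Ioc_succ_singleton, Finset.sum_singleton]
    by_cases hF : IsFastScale u (N + 1)
    · obtain ⟨j', hj', i, hi, hi', hzi⟩ := hatt (N + 1) (by omega) hF p (by have := hp.2; omega)
        (h3 p hp.1) j hj hch
      obtain ⟨h1, h2, h4⟩ := hraise (N + 1) (by omega) j' hj' i hi hi' G (hG _ hzi)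
      exact ⟨N + 1, ⟨by omega, le_rfl⟩, j', h1, h2, _, h4, by linarith⟩
    · refine ⟨p, ⟨hp.1, hp.2.trans (Nat.le_succ N)⟩, j, hj, hch, G, hG, ?_⟩
      have hlog : 5 * Real.log (u (N + 1)) ≤ 9 * Real.log (u N) := by
        have h5 : u (N + 1) ^ 5 ≤ u N ^ 9 := (not_le.1 hF).le
        have h6 := Real.log_le_log (pow_pos (hu.pos _) 5) h5
        rw [Real.log_pow, Real.log_pow] at h6
        exact_mod_cast h6
      have : 10 * blockLen u (N + 1) ≤ 9 * blockLen u N := by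
        unfold blockLen
        rw [mul_div_assoc', mul_div_assoc', div_le_div_iff₀ (by positivity) (by positivity)]
        have h7 : (0:ℝ) < 16 * 2 ^ N := by positivity
        have h8 : (16:ℝ) * 2 ^ (N + 1) = 2 * (16 * 2 ^ N) := by ring
        rw [h8]
        nlinarith
      linarith

theorem log_quantile_le_blockLen (hθ : IsParameter θ) (hq : IsDyadicQuantile θ q)
    (hu : IsWindowScale θ q u) (n : ℕ) : Real.log (q n) / 2 ^ n ≤ 256 * blockLen u n := by
  have h1 : Real.log (q n) ≤ 16 * Real.log (u n) := by
    have h2 := Real.log_le_log (hq.pos hθ n) (show q n ≤ u n ^ 16 by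
      linarith [hu.le_pow n, hq.pos hθ n])
    rwa [Real.log_pow] at h2
  calc _ ≤ 16 * Real.log (u n) / 2 ^ n := by gcongr
    _ = _ := by unfold blockLen; field_simp; ring

theorem tailSum_le_hausdorffEDist (h : IsStickData y z) (hθ : IsParameter θ)
    (hq : IsDyadicQuantile θ q) (hu : IsWindowScale θ q u) {k : ℕ} (h3 : ∀ n > k, 3 ≤ u n)
    (hcut : ∀ n > k, (cutBlocks θ u x y n).Nonempty)
    (hatt : ∀ n > k, IsFastScale u n → ∀ p < n, 3 ≤ u p →
      ∀ j < numBlocks u p, IsCharged θ u x p j → IsAttached θ u x y z n p j) :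
    ENNReal.ofReal (1 / 2560) * tailSum q k ≤ Metric.hausdorffEDist (subtree h (q k)) univ := by
  have hc : ENNReal.ofReal (1 / 2560) ≠ 0 := by simp
  rw [mul_comm, ← ENNReal.le_div_iff_mul_le (.inl hc) (.inl ENNReal.ofReal_ne_top)]
  refine tailSum_le (hq.log_nonneg hθ) fun N => ?_
  rw [ENNReal.le_div_iff_mul_le (.inl hc) (.inl ENNReal.ofReal_ne_top)]
  rcases le_or_gt N k with hN | hN
  · simp [Finset.Ioc_eq_empty (not_lt.2 hN)]
  obtain ⟨p, hp, j, hj, hch, G, hG, hsum⟩ := exists_block_far h hθ hq hu h3 hcut hatt hN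
  have hup : 1 < u p := by linarith [h3 p hp.1]
  have hb := blockLen_pos hup
  have hbN := blockLen_pos (u := u) (n := N) (by linarith [h3 N hN])
  have ht : blockStart u p j + 3 * blockLen u p ∈ blockTop u p j := ⟨by linarith, le_rfl⟩
  set t := blockStart u p j + 3 * blockLen u p with ht'
  have ht0 : 0 ≤ t := by
    have := blockStart_ge hup j
    have : 0 < u p ^ 16 := by positivity
    linarith
  rw [Metric.hausdorffEDist_comm]
  refine le_trans ?_ (Metric.infEDist_le_hausdorffEDist_of_mem
    (mem_univ ((⟨⟨t, ht0⟩⟩ : Line h) : SB h)))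
  refine Metric.le_infEDist.2 ?_
  rintro _ ⟨s, hs, rfl⟩
  rw [edist_coe, ← ENNReal.ofReal_mul (Finset.sum_nonneg fun n _ => by
    have := hq.log_nonneg hθ n; positivity)]
  refine ENNReal.ofReal_le_ofReal (le_trans ?_ (hG t ht s.val ⟨s.val.2, hs⟩))
  have h5 : ∑ n ∈ Finset.Ioc k N, Real.log (q n) / 2 ^ n ≤
      256 * ∑ n ∈ Finset.Ioc k N, blockLen u n := by
    rw [Finset.mul_sum]
    exact Finset.sum_le_sum fun n _ => log_quantile_le_blockLen hθ hq hu n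
  linarith

/-- On the event that the cells contain cuts, no point is far from the last cut. -/
theorem CellsHit.gap_le (h : IsStickData y z) {n m : ℕ} (hc : CellsHit q y n)
    (hD : 0 < cellLen q n) {t : ℝ} (ht : t ∈ Ioc (withZero y m) (withZero y (m + 1)))
    (htq : t ≤ q (n + 1)) : t - max (withZero y m) (q n) ≤ 2 * cellLen q n := by
  by_contra! hlt
  set w := max (withZero y m) (q n)
  have hw1 : withZero y m ≤ w := le_max_left _ _
  have hw2 : q n ≤ w := le_max_right _ _
  set D := cellLen q n
  set j := ⌈(w - q n) / D⌉₊
  have hj1 : (w - q n) / D ≤ j := Nat.le_ceil _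
  have hj2 : (j : ℝ) < (w - q n) / D + 1 := Nat.ceil_lt_add_one (div_nonneg (by linarith) hD.le)
  rw [div_le_iff₀ hD] at hj1
  have hj3 : (j : ℝ) * D < w - q n + D := by
    have := mul_lt_mul_of_pos_right hj2 hD
    rwa [add_mul, div_mul_cancel₀ _ hD.ne', one_mul] at this
  obtain ⟨i, hi⟩ := hc j (by nlinarith)
  have hi1 : withZero y m < withZero y (i + 1) := by
    change withZero y m < y i
    linarith [hi.1]
  have hi2 : withZero y (i + 1) < withZero y (m + 1) := by
    refine lt_of_lt_of_le ?_ ht.2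
    change y i < t
    nlinarith [hi.2]
  have h1 := (withZero_mono h).reflect_lt hi1
  have h2 := (withZero_mono h).reflect_lt hi2
  omega

/-- Every point of `[0, 𝒳(2ᴺ)]` is close to the subtree `[0, 𝒳(2ᵏ)]`. -/
theorem exists_lineDist_le_sum (h : IsStickData y z) (hθ : IsParameter θ)
    (hq : IsDyadicQuantile θ q) {k : ℕ} (hcell : ∀ n ≥ k, CellsHit q y n)
    (hclimb : ∀ n ≥ k, ∀ i, y i ≤ q (n + 1) → climb (q n) y z (i + 1) ≤ climbBound q n)
    {N : ℕ} (hN : k ≤ N) {t : ℝ} (ht0 : 0 ≤ t) (ht : t ≤ q N) :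
    ∃ s ∈ Icc 0 (q k),
      lineDist y z t s ≤ 328 * ∑ n ∈ Finset.Ioc k N, Real.log (q n) / 2 ^ n := by
  induction N, hN using Nat.le_induction generalizing t with
  | base =>
    refine ⟨t, ⟨ht0, ht⟩, ?_⟩
    obtain ⟨n, hn⟩ := exists_le_withZero h t
    rw [lineDist_eq h hn hn, (stickDist_metric h n).1]
    simp
  | succ N hN ih =>
    have hmono : ∑ n ∈ Finset.Ioc k (N + 1), Real.log (q n) / 2 ^ n =
        ∑ n ∈ Finset.Ioc k N, Real.log (q n) / 2 ^ n + Real.log (q (N + 1)) / 2 ^ (N + 1) := by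
      rw [← Finset.sum_Ioc_consecutive _ hN (Nat.le_succ N), Nat.succ_eq_add_one,
        Nat.Ioc_succ_singleton, Finset.sum_singleton]
    have hnn : 0 ≤ Real.log (q (N + 1)) / 2 ^ (N + 1) := by
      have := hq.log_nonneg hθ (N + 1); positivity
    rw [hmono]
    rcases le_or_gt t (q N) with htN | htN
    · obtain ⟨s, hs, hle⟩ := ih ht0 htN
      exact ⟨s, hs, by linarith⟩
    obtain ⟨m, hm⟩ := exists_mem_stick h (lt_of_le_of_lt (hq N).1 htN)
    have hgap := (hcell N hN).gap_le h (cellLen_pos hθ hq N) hm ht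
    obtain ⟨s', hs', hle'⟩ := exists_lineDist_le h (hq N).1 m hm htN
    have hcl : climb (q N) y z m ≤ climbBound q N := by
      cases m with
      | zero =>
        rw [climb_of_le (hq N).1]
        have := hq.log_nonneg hθ (N + 1)
        unfold climbBound
        positivity
      | succ m => exact hclimb N hN m (hm.1.le.trans ht)
    obtain ⟨s, hs, hle⟩ := ih hs'.1 hs'.2
    refine ⟨s, hs, ?_⟩
    have htri : lineDist y z t s ≤ lineDist y z t s' + lineDist y z s' s :=
      dist_triangle (⟨⟨t, ht0⟩⟩ : Line h) ⟨⟨s', hs'.1⟩⟩ ⟨⟨s, hs.1⟩⟩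
    have e : 2 * cellLen q N + climbBound q N = 328 * (Real.log (q (N + 1)) / 2 ^ (N + 1)) := by
      unfold cellLen climbBound
      rw [pow_succ]
      field_simp
      ring
    linarith

theorem hausdorffEDist_le_tailSum (h : IsStickData y z) (hθ : IsParameter θ)
    (hq : IsDyadicQuantile θ q) {k : ℕ} (hcell : ∀ n ≥ k, CellsHit q y n)
    (hclimb : ∀ n ≥ k, ∀ i, y i ≤ q (n + 1) → climb (q n) y z (i + 1) ≤ climbBound q n) :
    Metric.hausdorffEDist (subtree h (q k)) univ ≤ ENNReal.ofReal 328 * tailSum q k := by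
  refine Metric.hausdorffEDist_le_of_infEDist (fun a _ => ?_) fun a ha => ?_
  · rw [Metric.infEDist_zero_of_mem (mem_univ a)]
    exact zero_le
  · clear ha
    have hcl : IsClosed {a : SB h | Metric.infEDist a (subtree h (q k)) ≤
        ENNReal.ofReal 328 * tailSum q k} :=
      isClosed_le Metric.continuous_infEDist continuous_const
    induction a using UniformSpace.Completion.induction_on with
    | hp => exact hcl
    | ih t =>
      obtain ⟨N, hkN, hN⟩ := ((eventually_ge_atTop k).and
        ((hq.tendsto hθ).eventually_ge_atTop (t.val : ℝ))).exists
      obtain ⟨s, hs, hle⟩ := exists_lineDist_le_sum h hθ hq hcell hclimb hkN t.val.2 hN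
      refine (Metric.infEDist_le_edist_of_mem (s := subtree h (q k))
        (y := ((⟨⟨s, hs.1⟩⟩ : Line h) : SB h)) ⟨_, hs.2, rfl⟩).trans ?_
      rw [edist_coe]
      refine (ENNReal.ofReal_le_ofReal hle).trans ?_
      rw [ENNReal.ofReal_mul (by norm_num)]
      gcongr
      exact sum_Ioc_le_tailSum (hq.log_nonneg hθ) k N

/-! ### Compactness -/

theorem totallyBounded_initial (h : IsStickData y z) (n : ℕ) :
    TotallyBounded {a : Line h | (a.val : ℝ) ≤ withZero y n} := by
  induction n with
  | zero =>
    refine (finite_singleton (⟨0⟩ : Line h)).totallyBounded.subset ?_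
    rintro ⟨a⟩ ha
    have ha' : (a : ℝ) ≤ 0 := ha
    have : a = 0 := le_antisymm (by exact_mod_cast ha') zero_le
    rw [this]
    rfl
  | succ n ih =>
    have hw : 0 ≤ withZero y n := (withZero_glue h n).1.trans (withZero_glue h n).2
    set S := Ioc (withZero y n) (withZero y (n + 1))
    set f : S → Line h := fun t => ⟨⟨t, hw.trans t.2.1.le⟩⟩ with hf
    have hiso : Isometry f := Isometry.of_dist_eq fun a b => by
      change lineDist y z a b = |(a : ℝ) - b|
      rw [lineDist_eq h a.2.2 b.2.2, stickDist_new a.2.1 b.2.1]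
    have hS : TotallyBounded (univ : Set S) := by
      have h1 := totallyBounded_preimage (f := (Subtype.val : S → ℝ))
        isUniformEmbedding_subtype_val.isUniformInducing (totallyBounded_Ioc (withZero y n)
          (withZero y (n + 1)))
      refine h1.subset fun a _ => a.2
    refine (ih.union (hS.image hiso.uniformContinuous)).subset fun a ha => ?_
    rcases le_or_gt (a.val : ℝ) (withZero y n) with h1 | h1
    · exact .inl h1
    · exact .inr ⟨⟨a.val, h1, ha⟩, mem_univ _, rfl⟩

theorem totallyBounded_subtree (h : IsStickData y z) (l : ℝ) : TotallyBounded (subtree h l) := by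
  obtain ⟨n, hn⟩ := exists_le_withZero h l
  refine ((totallyBounded_initial h n).image
    (UniformSpace.Completion.uniformContinuous_coe (Line h))).subset ?_
  rintro _ ⟨a, ha, rfl⟩
  exact ⟨a, le_trans ha hn, rfl⟩

/-- The tree is compact as soon as it is approximated by its initial subtrees. -/
theorem compactSpace_of_tendsto (h : IsStickData y z) {l : ℕ → ℝ}
    (hl : Tendsto (fun k => Metric.hausdorffEDist (subtree h (l k)) univ) atTop (𝓝 0)) :
    CompactSpace (SB h) := by
  refine ⟨isCompact_iff_totallyBounded_isComplete.2 ⟨?_, isClosed_univ.isComplete⟩⟩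
  rw [EMetric.totallyBounded_iff]
  intro ε hε
  obtain ⟨k, hk⟩ := (hl.eventually (gt_mem_nhds (ENNReal.half_pos hε.ne'))).exists
  obtain ⟨t, ht, hcov⟩ := EMetric.totallyBounded_iff.1 (totallyBounded_subtree h (l k)) (ε / 2)
    (ENNReal.half_pos hε.ne')
  refine ⟨t, ht, fun a _ => ?_⟩
  obtain ⟨b, hb, hab⟩ := Metric.exists_edist_lt_of_hausdorffEDist_lt (mem_univ a)
    (by rwa [Metric.hausdorffEDist_comm] at hk)
  obtain ⟨c, hc, hbc⟩ := mem_iUnion₂.1 (hcov hb)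
  refine mem_iUnion₂.2 ⟨c, hc, ?_⟩
  rw [Metric.mem_eball] at hbc ⊢
  calc edist a c ≤ edist a b + edist b c := edist_triangle _ _ _
    _ < ε / 2 + ε / 2 := ENNReal.add_lt_add hab hbc
    _ = ε := ENNReal.add_halves ε

theorem hausdorffEDist_ne_top (h : IsStickData y z) [CompactSpace (SB h)] {l : ℝ} (hl : 0 ≤ l) :
    Metric.hausdorffEDist (subtree h l) univ ≠ ∞ := by
  have h0 : (subtree h l).Nonempty := ⟨_, (⟨0⟩ : Line h), hl, rfl⟩
  have hb : Bornology.IsBounded (univ : Set (SB h)) := isCompact_univ.isBounded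
  exact Metric.hausdorffEDist_ne_top_of_nonempty_of_bounded h0 (h0.mono (subset_univ _))
    (hb.subset (subset_univ _)) hb

end

/-! ### The integral criterion -/

section

variable {θ q : ℕ → ℝ}

theorem lintegral_inv_Ioc {a b : ℝ} (ha : 0 < a) (hab : a ≤ b) :
    ∫⁻ l in Ioc a b, ENNReal.ofReal l⁻¹ = ENNReal.ofReal (Real.log b - Real.log a) := by
  have hint : IntervalIntegrable (fun l : ℝ => l⁻¹) volume a b :=
    intervalIntegral.intervalIntegrable_inv (fun l hl => by
      rw [uIcc_of_le hab] at hl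
      exact (ha.trans_le hl.1).ne') continuousOn_id
  rw [intervalIntegrable_iff_integrableOn_Ioc_of_le hab] at hint
  rw [← ofReal_integral_eq_lintegral_ofReal hint
    ((ae_restrict_iff' measurableSet_Ioc).2 (.of_forall fun l hl =>
      inv_nonneg.2 (ha.trans hl.1).le)), ← intervalIntegral.integral_of_le hab,
    integral_inv_of_pos ha (ha.trans_le hab), Real.log_div (ha.trans_le hab).ne' ha.ne']

/-- Summation by parts. -/
theorem sum_range_sub_div_two_pow (a : ℕ → ℝ) (N : ℕ) :
    ∑ n ∈ Finset.range N, (a (n + 1) - a n) / 2 ^ n =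
      ∑ n ∈ Finset.Ioc 0 N, a n / 2 ^ n + a N / 2 ^ N - a 0 := by
  induction N with
  | zero => simp
  | succ N ih =>
    rw [Finset.sum_range_succ, ih, Finset.sum_Ioc_succ_top (Nat.zero_le N), pow_succ]
    field_simp
    ring

theorem inv_mul_mass_eq {l c : ℝ} (hl : 0 < l) (hc : 0 < c) :
    (ENNReal.ofReal l * ENNReal.ofReal c)⁻¹ = ENNReal.ofReal c⁻¹ * ENNReal.ofReal l⁻¹ := by
  rw [← ENNReal.ofReal_mul hl.le, ← ENNReal.ofReal_inv_of_pos (by positivity),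
    ← ENNReal.ofReal_mul (by positivity), mul_inv, mul_comm]

theorem lintegral_step_eq {a b c : ℝ} (ha : 0 < a) (hab : a ≤ b) (hc : 0 < c) :
    ∫⁻ l in Ioc a b, (ENNReal.ofReal l * ENNReal.ofReal c)⁻¹ =
      ENNReal.ofReal ((Real.log b - Real.log a) / c) := by
  rw [setLIntegral_congr_fun measurableSet_Ioc
    (fun l hl => inv_mul_mass_eq (ha.trans hl.1) hc), lintegral_const_mul _ (by fun_prop),
    lintegral_inv_Ioc ha hab, ← ENNReal.ofReal_mul (by positivity), div_eq_inv_mul]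

theorem IsDyadicQuantile.lintegral_step_le (hq : IsDyadicQuantile θ q) (hθ : IsParameter θ)
    (n : ℕ) : ∫⁻ l in Ioc (q n) (q (n + 1)), (ENNReal.ofReal l * ENNReal.ofReal (meanFun θ l))⁻¹ ≤
      ENNReal.ofReal ((Real.log (q (n + 1)) - Real.log (q n)) / 2 ^ n) := by
  rw [← lintegral_step_eq (hq.pos hθ n) ((hq.strictMono hθ).monotone n.le_succ) (by positivity)]
  refine setLIntegral_mono' measurableSet_Ioc fun l hl => ?_
  gcongr
  rw [← (hq n).2]
  exact meanFun_mono hθ (hq n).1 hl.1.le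

theorem IsDyadicQuantile.le_lintegral_step (hq : IsDyadicQuantile θ q) (hθ : IsParameter θ)
    (n : ℕ) : ENNReal.ofReal ((Real.log (q (n + 1)) - Real.log (q n)) / 2 ^ (n + 1)) ≤
      ∫⁻ l in Ioc (q n) (q (n + 1)), (ENNReal.ofReal l * ENNReal.ofReal (meanFun θ l))⁻¹ := by
  rw [← lintegral_step_eq (hq.pos hθ n) ((hq.strictMono hθ).monotone n.le_succ) (by positivity)]
  refine setLIntegral_mono' measurableSet_Ioc fun l hl => ?_
  gcongr
  rw [← (hq (n + 1)).2]
  exact meanFun_mono hθ ((hq n).1.trans hl.1.le) hl.2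

theorem IsDyadicQuantile.iUnion_Ioc (hq : IsDyadicQuantile θ q) (hθ : IsParameter θ) :
    Ioi (1 : ℝ) = Ioc 1 (q 0) ∪ ⋃ n, Ioc (q n) (q (n + 1)) := by
  have hmono := (hq.strictMono hθ).monotone
  ext l
  constructor
  · intro hl
    rcases le_or_gt l (q 0) with h0 | h0
    · exact .inl ⟨hl, h0⟩
    · right
      classical
      have hex := ((hq.tendsto hθ).eventually_ge_atTop l).exists
      obtain ⟨m, hm⟩ := Nat.exists_eq_succ_of_ne_zero (n := Nat.find hex) (by
        intro h
        have := Nat.find_spec hex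
        rw [h] at this
        linarith)
      refine mem_iUnion.2 ⟨m, not_le.1 (Nat.find_min hex (by omega)), ?_⟩
      have := Nat.find_spec hex
      rwa [hm] at this
  · rintro (hl | hl)
    · exact hl.1
    · obtain ⟨n, hn⟩ := mem_iUnion.1 hl
      exact lt_of_le_of_lt (hq.one_le hθ n) hn.1

theorem log_diff_nonneg (hq : IsDyadicQuantile θ q) (hθ : IsParameter θ) (n : ℕ) :
    0 ≤ Real.log (q (n + 1)) - Real.log (q n) :=
  sub_nonneg.2 (Real.log_le_log (hq.pos hθ n) ((hq.strictMono hθ).monotone n.le_succ))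

/-- The integral criterion in terms of the quantiles of the mean mass: on `(𝒳(2ⁿ), 𝒳(2ⁿ⁺¹)]` the
mean mass is between `2ⁿ` and `2ⁿ⁺¹`. -/
theorem lintegral_inv_lt_top_iff (hq : IsDyadicQuantile θ q) (hθ : IsParameter θ) :
    ∫⁻ l in Ioi (1 : ℝ), (ENNReal.ofReal l * ENNReal.ofReal (meanFun θ l))⁻¹ < ∞ ↔
      tailSum q 0 < ∞ := by
  set f : ℝ → ℝ≥0∞ := fun l => (ENNReal.ofReal l * ENNReal.ofReal (meanFun θ l))⁻¹ with hf
  have hdisj : Pairwise (Function.onFun Disjoint fun n => Ioc (q n) (q (n + 1))) := by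
    intro i j hij
    rw [Function.onFun, Set.disjoint_left]
    exact fun t h1 h2 => hij (stick_unique (hq.strictMono hθ).monotone h1 h2)
  have hsplit : ∫⁻ l in ⋃ n, Ioc (q n) (q (n + 1)), f l =
      ∑' n, ∫⁻ l in Ioc (q n) (q (n + 1)), f l :=
    lintegral_iUnion (fun n => measurableSet_Ioc) hdisj f
  have habel := sum_range_sub_div_two_pow fun n => Real.log (q n)
  have hnn := hq.log_nonneg hθ
  have hd := log_diff_nonneg hq hθ
  rw [hq.iUnion_Ioc hθ]
  constructor
  · intro h
    have hI : ∑' n, ∫⁻ l in Ioc (q n) (q (n + 1)), f l < ∞ := by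
      rw [← hsplit]
      exact lt_of_le_of_lt (lintegral_mono_set subset_union_right) h
    refine lt_of_le_of_lt (b := ENNReal.ofReal (Real.log (q 0)) +
      2 * ∑' n, ∫⁻ l in Ioc (q n) (q (n + 1)), f l) (tailSum_le hnn fun N => ?_)
      (ENNReal.add_lt_top.2 ⟨ENNReal.ofReal_lt_top, ENNReal.mul_lt_top (by simp) hI⟩)
    calc _ ≤ ENNReal.ofReal (Real.log (q 0) + 2 * ∑ n ∈ Finset.range N,
          (Real.log (q (n + 1)) - Real.log (q n)) / 2 ^ (n + 1)) := by
          refine ENNReal.ofReal_le_ofReal ?_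
          have e : 2 * ∑ n ∈ Finset.range N,
              (Real.log (q (n + 1)) - Real.log (q n)) / 2 ^ (n + 1) =
              ∑ n ∈ Finset.range N, (Real.log (q (n + 1)) - Real.log (q n)) / 2 ^ n := by
            rw [Finset.mul_sum]
            refine Finset.sum_congr rfl fun n _ => ?_
            rw [pow_succ]
            field_simp
          rw [e, habel]
          have : 0 ≤ Real.log (q N) / 2 ^ N := by have := hnn N; positivity
          linarith
      _ ≤ _ := by
          rw [ENNReal.ofReal_add (hnn 0) (by
            refine mul_nonneg (by norm_num) (Finset.sum_nonneg fun n _ => ?_)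
            have := hd n; positivity), ENNReal.ofReal_mul (by norm_num),
            ENNReal.ofReal_sum_of_nonneg fun n _ => by have := hd n; positivity]
          gcongr
          · simp
          · exact (Finset.sum_le_sum fun n _ => hq.le_lintegral_step hθ n).trans
              (ENNReal.sum_le_tsum _)
  · intro h
    refine lt_of_le_of_lt (lintegral_union_le f _ _) (ENNReal.add_lt_top.2 ⟨?_, ?_⟩)
    · -- the mean mass is bounded below on `(1, 𝒳(1)]`
      have hm1 : 0 < meanFun θ 1 := by
        rw [← meanFun_zero (θ := θ)]
        exact meanFun_strictMonoOn hθ (mem_Ici.2 le_rfl) (mem_Ici.2 zero_le_one) one_pos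
      refine lt_of_le_of_lt (b := ∫⁻ l in Ioc 1 (q 0),
        (ENNReal.ofReal l * ENNReal.ofReal (meanFun θ 1))⁻¹)
        (setLIntegral_mono' measurableSet_Ioc fun l hl => ?_) ?_
      · simp only [hf]
        gcongr
        exact meanFun_mono hθ zero_le_one hl.1.le
      · rw [lintegral_step_eq one_pos (hq.one_le hθ 0) hm1]
        exact ENNReal.ofReal_lt_top
    · rw [hsplit]
      refine lt_of_le_of_lt (b := 2 * tailSum q 0) (ENNReal.tsum_le_of_sum_range_le fun N => ?_)
        (ENNReal.mul_lt_top (by simp) h)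
      refine (Finset.sum_le_sum fun n _ => hq.lintegral_step_le hθ n).trans ?_
      rw [← ENNReal.ofReal_sum_of_nonneg fun n _ => by have := hd n; positivity, habel]
      rcases Nat.eq_zero_or_pos N with rfl | hN
      · simp
      calc _ ≤ ENNReal.ofReal (2 * ∑ n ∈ Finset.Ioc 0 N, Real.log (q n) / 2 ^ n) := by
            refine ENNReal.ofReal_le_ofReal ?_
            have h1 : Real.log (q N) / 2 ^ N ≤ ∑ n ∈ Finset.Ioc 0 N, Real.log (q n) / 2 ^ n :=
              Finset.single_le_sum (f := fun n => Real.log (q n) / 2 ^ n)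
                (fun n _ => by have := hnn n; positivity) (Finset.mem_Ioc.2 ⟨hN, le_rfl⟩)
            linarith [hnn 0]
        _ ≤ _ := by
            rw [ENNReal.ofReal_mul (by norm_num)]
            gcongr
            · simp
            · exact sum_Ioc_le_tailSum hnn 0 N

theorem tailSum_lt_top_iff (q : ℕ → ℝ) (k : ℕ) : tailSum q k < ∞ ↔ tailSum q 0 < ∞ := by
  rw [tailSum_eq_indicator, tailSum_eq_indicator]
  constructor
  · intro h
    refine lt_of_le_of_lt (b := ∑' n : ℕ, ((Ioi k).indicator (fun n => ENNReal.ofReal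
      (Real.log (q n) / 2 ^ n)) n + (Iic k).indicator (fun n => ENNReal.ofReal
      (Real.log (q n) / 2 ^ n)) n)) (ENNReal.tsum_le_tsum fun n => ?_) ?_
    · rcases le_or_gt n k with hn | hn
      · rw [indicator_of_mem (mem_Iic.2 hn)]
        exact (indicator_le_self _ _ n).trans le_add_self
      · rw [indicator_of_mem (mem_Ioi.2 hn) (f := fun n => ENNReal.ofReal
          (Real.log (q n) / 2 ^ n))]
        exact (indicator_le_self _ _ n).trans le_self_add
    · rw [ENNReal.tsum_add]
      refine ENNReal.add_lt_top.2 ⟨h, ?_⟩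
      rw [tsum_eq_sum (s := Finset.Iic k) fun n hn => indicator_of_notMem (by simpa using hn) _]
      refine ENNReal.sum_lt_top.2 fun n _ =>
        (indicator_le_self _ _ n).trans_lt ENNReal.ofReal_lt_top
  · refine lt_of_le_of_lt (ENNReal.tsum_le_tsum fun n => ?_)
    exact indicator_le_indicator_of_subset (Ioi_subset_Ioi (Nat.zero_le k)) (fun _ => zero_le) n

theorem tendsto_tailSum {q : ℕ → ℝ} (h : tailSum q 0 < ∞) :
    Tendsto (tailSum q) atTop (𝓝 0) := by
  rw [tailSum_eq_indicator] at h
  have h1 := (ENNReal.tendsto_tsum_compl_atTop_zero h.ne).comp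
    (tendsto_finset_range.comp (tendsto_add_atTop_nat 1))
  refine h1.congr fun k => ?_
  simp only [Function.comp_apply]
  have e := tsum_subtype {n : ℕ | n ∉ Finset.range (k + 1)} ((Ioi 0).indicator fun n =>
    ENNReal.ofReal (Real.log (q n) / 2 ^ n))
  refine e.trans ?_
  rw [tailSum_eq_indicator, indicator_indicator]
  congr 1
  have : {n : ℕ | n ∉ Finset.range (k + 1)} ∩ Ioi 0 = Ioi k := by
    ext n
    simp
    omega
  rw [this]

end

/-! ### Almost sure events of the three layers of randomness -/

section

variable {θ q u x y z : ℕ → ℝ}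

/-- The almost sure properties of the atoms. -/
structure AtomsRegular (θ q u x : ℕ → ℝ) : Prop where
  mass : ∀ᶠ n in atTop, MassRegular θ q x n
  charged : ∀ᶠ n in atTop, 2 ^ n * u n ^ 12 / 256 ≤ ((chargedBlocks θ u x n).card : ℝ)

/-- The almost sure properties of the cuts. -/
structure CutsRegular (θ q u x y : ℕ → ℝ) : Prop where
  lt_succ : ∀ i, y i < y (i + 1)
  nonneg : ∀ i, 0 ≤ y i
  unbounded : ∀ m : ℕ, ∃ i, (m : ℝ) ≤ y i
  card : ∀ᶠ n in atTop, 2 ^ n * u n ^ 11 / 1024 ≤ ((cutBlocks θ u x y n).card : ℝ)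
  gap : ∀ᶠ n : ℕ in atTop, ∫⁻ t in Ioc (q n) (q (n + 1)), gapWeight (q n) n y t ∂mass θ x ≤
    ENNReal.ofReal (n ^ 2 * 2 ^ n)
  count : ∀ᶠ n : ℕ in atTop, (count (Icc 0 (q (n + 1))) y : ℝ≥0∞) ≤ ENNReal.ofReal (q (n + 1) ^ 3)
  cells : ∀ᶠ n : ℕ in atTop, CellsHit q y n

/-- The almost sure properties of the glue points. -/
structure GlueRegular (θ q u x y z : ℕ → ℝ) : Prop where
  mem : ∀ i, z i ∈ Icc 0 (y i)
  climb : ∀ᶠ n : ℕ in atTop, ∀ i, y i ≤ q (n + 1) → climb (q n) y z (i + 1) ≤ climbBound q n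
  attached : ∀ᶠ n : ℕ in atTop, IsFastScale u n → ∀ p < n, 3 ≤ u p →
    ∀ j < numBlocks u p, IsCharged θ u x p j → IsAttached θ u x y z n p j

theorem CutsRegular.strictMono (h : CutsRegular θ q u x y) : StrictMono y :=
  strictMono_nat_of_lt_succ h.lt_succ

theorem CutsRegular.tendsto (h : CutsRegular θ q u x y) : Tendsto y atTop atTop :=
  tendsto_atTop_mono' _ (.of_forall fun _ => le_rfl)
    (tendsto_atTop_atTop_of_monotone h.strictMono.monotone fun b => by
      obtain ⟨m, hm⟩ := exists_nat_ge b
      obtain ⟨i, hi⟩ := h.unbounded m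
      exact ⟨i, hm.trans hi⟩)

theorem GlueRegular.isStickData (hz : GlueRegular θ q u x y z) (hy : CutsRegular θ q u x y) :
    IsStickData y z :=
  ⟨hy.nonneg, hy.strictMono, hy.tendsto, fun i => (hz.mem i).1, fun i => (hz.mem i).2⟩

/-- The bounds for the Hausdorff distances, on the intersection of the almost sure events. -/
theorem GlueRegular.hausdorffEDist_bounds (hz : GlueRegular θ q u x y z)
    (hy : CutsRegular θ q u x y) (hθ : IsParameter θ) (hq : IsDyadicQuantile θ q)
    (hu : IsWindowScale θ q u) (h : IsStickData y z) : ∀ᶠ k in atTop,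
      ENNReal.ofReal (1 / 2560) * tailSum q k ≤ Metric.hausdorffEDist (subtree h (q k)) univ ∧
      Metric.hausdorffEDist (subtree h (q k)) univ ≤ ENNReal.ofReal 328 * tailSum q k := by
  have h3 := (hu.tendsto hθ hq).eventually_ge_atTop 3
  obtain ⟨N, hN⟩ := eventually_atTop.1 (h3.and (hy.card.and (hy.cells.and
    (hz.climb.and hz.attached))))
  refine eventually_atTop.2 ⟨N, fun k hk => ⟨?_, ?_⟩⟩
  · refine tailSum_le_hausdorffEDist h hθ hq hu (fun n hn => (hN n (by omega)).1) (fun n hn => ?_)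
      fun n hn => (hN n (by omega)).2.2.2.2
    have h1 := (hN n (by omega)).2.1
    have h2 := hu.pos n
    have h4 : (0:ℝ) < (cutBlocks θ u x y n).card := lt_of_lt_of_le (by positivity) h1
    exact Finset.card_pos.1 (by exact_mod_cast h4)
  · exact hausdorffEDist_le_tailSum h hθ hq (fun n hn => (hN n (by omega)).2.2.1)
      fun n hn => (hN n (by omega)).2.2.2.1

section Measurability

variable {α : Type*} [MeasurableSpace α]

theorem measurable_eventually_atTop {p : ℕ → α → Prop} (hp : ∀ n, Measurable (p n)) :
    Measurable fun a => ∀ᶠ n in atTop, p n a := by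
  simp_rw [eventually_atTop]
  exact Measurable.exists fun N => Measurable.forall fun n => measurable_const.imp (hp n)

theorem measurable_prop_le {β : Type*} [TopologicalSpace β] [LinearOrder β] [OrderClosedTopology β]
    [SecondCountableTopology β] [MeasurableSpace β] [OpensMeasurableSpace β] {f g : α → β}
    (hf : Measurable f) (hg : Measurable g) : Measurable fun a => f a ≤ g a :=
  measurableSet_setOfPred.1 (measurableSet_le hf hg)

theorem measurable_prop_mem {f : α → ℝ} (hf : Measurable f) {A : Set ℝ} (hA : MeasurableSet A) :
    Measurable fun a => f a ∈ A :=
  measurableSet_setOfPred.1 (hf hA)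

variable {f g k : α → ℕ → ℝ}

theorem measurable_isCharged (hf : Measurable f) (n j : ℕ) :
    Measurable fun a => IsCharged θ u (f a) n j :=
  measurable_prop_le measurable_const ((measurable_mass (blockTop_measurable n j)).comp hf)

theorem measurable_isCutBlock (hg : Measurable g) (n j : ℕ) :
    Measurable fun a => IsCutBlock u (g a) n j :=
  measurableSet_setOfPred.1 (hg (isCutBlock_measurable n j))

theorem measurable_mem_cutBlocks (hf : Measurable f) (hg : Measurable g) (n j : ℕ) :
    Measurable fun a => j ∈ cutBlocks θ u (f a) (g a) n := by
  classical
  simp_rw [cutBlocks, chargedBlocks, Finset.mem_filter]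
  exact (measurable_const.and (measurable_isCharged hf n j)).and (measurable_isCutBlock hg n j)

theorem measurable_card_cutBlocks (hf : Measurable f) (hg : Measurable g) (n : ℕ) :
    Measurable fun a => ((cutBlocks θ u (f a) (g a) n).card : ℝ) := by
  classical
  have e : ∀ a, ((cutBlocks θ u (f a) (g a) n).card : ℝ) = ∑ j ∈ Finset.range (numBlocks u n),
      if j ∈ cutBlocks θ u (f a) (g a) n then (1:ℝ) else 0 := by
    intro a
    rw [← Finset.sum_filter, Finset.sum_const, nsmul_eq_mul, mul_one]
    congr 2
    ext j
    simp only [Finset.mem_filter]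
    exact ⟨fun h => ⟨(Finset.mem_filter.1 (Finset.mem_filter.1 h).1).1, h⟩, fun h => h.2⟩
  simp_rw [e]
  exact Finset.measurable_fun_sum _ fun j _ => Measurable.ite
    (measurableSet_setOfPred.2 (measurable_mem_cutBlocks hf hg n j)) measurable_const
    measurable_const

/-- The integral against the mass measure, written so as to be visibly measurable in the atoms. -/
theorem lintegral_mass (x : ℕ → ℝ) {A : Set ℝ} (hA : MeasurableSet A) {w : ℝ → ℝ≥0∞}
    (hw : Measurable w) : ∫⁻ t in A, w t ∂mass θ x =
      ENNReal.ofReal (θ 0 ^ 2) * (∫⁻ t in Ici 0, A.indicator w t) +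
        ∑' i, ENNReal.ofReal (θ (i + 1)) * A.indicator w (x i) := by
  rw [← lintegral_indicator hA, mass, lintegral_add_measure, lintegral_smul_measure,
    lintegral_sum_measure]
  simp_rw [lintegral_smul_measure, lintegral_dirac' _ (hw.indicator hA), smul_eq_mul]

theorem measurable_lintegral_gapWeight (hf : Measurable f) (hg : Measurable g) (l : ℝ) (n : ℕ)
    {A : Set ℝ} (hA : MeasurableSet A) :
    Measurable fun a => ∫⁻ t in A, gapWeight l n (g a) t ∂mass θ (f a) := by
  have hW : ∀ y, Measurable fun t => gapWeight l n y t := fun y =>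
    (measurable_gapWeight l n).comp (f := fun t : ℝ => (t, y)) (by fun_prop)
  simp_rw [fun a => lintegral_mass (θ := θ) (f a) hA (hW (g a))]
  have hind : Measurable fun p : α × ℝ => A.indicator (fun t => gapWeight l n (g p.1) t) p.2 := by
    have e : (fun p : α × ℝ => A.indicator (fun t => gapWeight l n (g p.1) t) p.2) =
        (Prod.snd ⁻¹' A).indicator fun p : α × ℝ => gapWeight l n (g p.1) p.2 := by
      ext p
      by_cases h : p.2 ∈ A
      · rw [indicator_of_mem h, indicator_of_mem (mem_preimage.2 h)]
      · rw [indicator_of_notMem h, indicator_of_notMem (fun h' => h (mem_preimage.1 h'))]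
    rw [e]
    exact ((measurable_gapWeight l n).comp
      (measurable_snd.prodMk (hg.comp measurable_fst))).indicator (measurable_snd hA)
  refine ((hind.lintegral_prod_right').const_mul _).add (Measurable.tsum fun i => ?_)
  have hi : Measurable fun a => f a i := (measurable_pi_apply i).comp hf
  exact (hind.comp (measurable_id.prodMk hi)).const_mul _

theorem measurable_count (hg : Measurable g) {A : Set ℝ} (hA : MeasurableSet A) :
    Measurable fun a => (count A (g a) : ℝ≥0∞) := by
  have e : ∀ a, (count A (g a) : ℝ≥0∞) = ∑' i, A.indicator 1 (g a i) := by
    intro a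
    rw [count, ← ENNReal.tsum_set_one, tsum_subtype {i | g a i ∈ A} fun _ => (1 : ℝ≥0∞)]
    refine tsum_congr fun i => ?_
    by_cases h : g a i ∈ A
    · rw [indicator_of_mem (show i ∈ {i | g a i ∈ A} from h), indicator_of_mem h, Pi.one_apply]
    · rw [indicator_of_notMem (show i ∉ {i | g a i ∈ A} from h), indicator_of_notMem h]
  simp_rw [e]
  exact Measurable.tsum fun i => (measurable_one.indicator hA).comp
    ((measurable_pi_apply i).comp hg)

theorem measurable_cutsRegular (hf : Measurable f) (hg : Measurable g) :
    Measurable fun a => CutsRegular θ q u (f a) (g a) := by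
  have hi : ∀ i, Measurable fun a => g a i := fun i => (measurable_pi_apply i).comp hg
  have e : ∀ a, CutsRegular θ q u (f a) (g a) ↔ _ := fun a =>
    ⟨fun h => And.intro h.1 (And.intro h.2 (And.intro h.3 (And.intro h.4 (And.intro h.5
      (And.intro h.6 h.7))))), fun h => ⟨h.1, h.2.1, h.2.2.1, h.2.2.2.1, h.2.2.2.2.1,
      h.2.2.2.2.2.1, h.2.2.2.2.2.2⟩⟩
  simp_rw [e]
  refine (Measurable.forall fun i => measurableSet_setOfPred.1 (measurableSet_lt (hi i) (hi _))).and
    ((Measurable.forall fun i => measurable_prop_le measurable_const (hi i)).and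
    ((Measurable.forall fun m => Measurable.exists fun i =>
      measurable_prop_le measurable_const (hi i)).and ?_))
  refine (measurable_eventually_atTop fun n => measurable_prop_le measurable_const
    (measurable_card_cutBlocks hf hg n)).and ?_
  refine (measurable_eventually_atTop fun n => measurable_prop_le
    (measurable_lintegral_gapWeight hf hg (q n) n measurableSet_Ioc) measurable_const).and ?_
  refine (measurable_eventually_atTop fun n => measurable_prop_le
    (measurable_count hg measurableSet_Icc) measurable_const).and ?_
  exact measurable_eventually_atTop fun n => Measurable.forall fun j => measurable_const.imp
    (Measurable.exists fun i => measurable_prop_mem (hi i) measurableSet_Ioc)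

theorem measurable_isAttached (hf : Measurable f) (hg : Measurable g) (hk : Measurable k)
    (n p j : ℕ) : Measurable fun a => IsAttached θ u (f a) (g a) (k a) n p j := by
  have hi : ∀ i, Measurable fun a => g a i := fun i => (measurable_pi_apply i).comp hg
  have hki : ∀ i, Measurable fun a => k a i := fun i => (measurable_pi_apply i).comp hk
  refine Measurable.exists fun j' => (measurable_mem_cutBlocks hf hg n j').and
    (Measurable.exists fun i => (measurable_prop_mem (hi i) measurableSet_Ioc).and
    ((measurableSet_setOfPred.1 (measurableSet_lt measurable_const (hi _))).and
    (measurable_prop_mem (hki i) (blockTop_measurable p j))))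

theorem measurable_glueRegular (hf : Measurable f) (hg : Measurable g) (hk : Measurable k) :
    Measurable fun a => GlueRegular θ q u (f a) (g a) (k a) := by
  have hi : ∀ i, Measurable fun a => g a i := fun i => (measurable_pi_apply i).comp hg
  have hki : ∀ i, Measurable fun a => k a i := fun i => (measurable_pi_apply i).comp hk
  have e : ∀ a, GlueRegular θ q u (f a) (g a) (k a) ↔ _ := fun a =>
    ⟨fun h => And.intro h.1 (And.intro h.2 h.3), fun h => ⟨h.1, h.2.1, h.2.2⟩⟩
  simp_rw [e]
  refine (Measurable.forall fun i => (measurable_prop_le measurable_const (hki i)).and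
    (measurable_prop_le (hki i) (hi i))).and ?_
  refine (measurable_eventually_atTop fun n => Measurable.forall fun i =>
    (measurable_prop_le (hi i) measurable_const).imp (measurable_prop_le
      ((measurable_climb (q n) (i + 1)).comp (hg.prodMk hk)) measurable_const)).and ?_
  exact measurable_eventually_atTop fun n => measurable_const.imp (Measurable.forall fun p =>
    measurable_const.imp (measurable_const.imp (Measurable.forall fun j => measurable_const.imp
      ((measurable_isCharged hf p j).imp (measurable_isAttached hf hg hk n p j)))))

end Measurability

section Data

variable {Ω : Type*} [MeasurableSpace Ω] {P : Measure Ω} [IsProbabilityMeasure P]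
  {X Y Z : Ω → ℕ → ℝ}

theorem IsICRTData.isAtomLaw (h : IsICRTData P θ X Y Z) : IsAtomLaw θ (P.map X) where
  indep := by
    rw [iIndepFun_iff_measure_inter_preimage_eq_mul]
    intro S sets hsets
    have h1 := h.indep_X.measure_inter_preimage_eq_mul S hsets
    rw [Measure.map_apply h.measurable_X (Finset.measurableSet_biInter S fun i hi =>
      measurable_pi_apply i (hsets i hi))]
    refine Eq.trans (by congr 1; ext; simp) (h1.trans (Finset.prod_congr rfl fun i hi => ?_))
    rw [Measure.map_apply h.measurable_X (measurable_pi_apply i (hsets i hi))]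
    rfl
  law i hi := by
    rw [Measure.map_map (measurable_pi_apply i) h.measurable_X]
    exact h.law_X i hi

theorem IsICRTData.meanMass_eq (h : IsICRTData P θ X Y Z) (hθ : IsParameter θ) {l : ℝ}
    (hl : 0 ≤ l) : meanMass P θ X l = ENNReal.ofReal (meanFun θ l) := by
  have := Measure.isProbabilityMeasure_map (μ := P) h.measurable_X.aemeasurable
  rw [← h.isAtomLaw.lintegral_mass_Icc hθ hl,
    lintegral_map (measurable_mass measurableSet_Icc) h.measurable_X]
  rfl

/-- The events of the three layers hold almost surely. -/
theorem IsICRTData.ae_regular (h : IsICRTData P θ X Y Z) (hθ : IsParameter θ)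
    (hq : IsDyadicQuantile θ q) (hu : IsWindowScale θ q u) :
    ∀ᵐ ω ∂P, CutsRegular θ q u (X ω) (Y ω) ∧ GlueRegular θ q u (X ω) (Y ω) (Z ω) := by
  have := Measure.isProbabilityMeasure_map (μ := P) h.measurable_X.aemeasurable
  have hXY : Measurable fun ω => (X ω, Y ω) := h.measurable_X.prodMk h.measurable_Y
  have hatoms : ∀ᵐ x ∂P.map X, AtomsRegular θ q u x := by
    filter_upwards [h.isAtomLaw.ae_mass_quantile hθ hq,
      h.isAtomLaw.ae_card_chargedBlocks hθ hq hu] with x h1 h2 using ⟨h1, h2⟩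
  have hcuts : ∀ᵐ p ∂P.map (fun ω => (X ω, Y ω)), CutsRegular θ q u p.1 p.2 := by
    rw [← compProd_map_condDistrib h.measurable_Y.aemeasurable]
    refine Measure.ae_compProd_of_ae_ae (measurableSet_setOfPred.2
      (measurable_cutsRegular measurable_fst measurable_snd)) ?_
    filter_upwards [hatoms, h.law_Y] with x hx hQ
    filter_upwards [ae_cuts_regular hQ (mass_ne_top hθ hq hx.mass),
      ae_card_cutBlocks hQ hθ hq hu hx.mass hx.charged,
      ae_lintegral_gapWeight_le hQ hθ hq hx.mass, ae_count_le hQ hθ hq hx.mass,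
      ae_cellsHit hQ hθ hq hx.mass] with y h1 h2 h3 h4 h5
    exact ⟨fun i => h1.1 i.lt_succ_self, h1.2.1,
      fun m => (h1.2.2.eventually_ge_atTop (m : ℝ)).exists, h2, h3, h4, h5⟩
  have hatoms' : ∀ᵐ p ∂P.map (fun ω => (X ω, Y ω)), AtomsRegular θ q u p.1 := by
    have e : (P.map fun ω => (X ω, Y ω)).map Prod.fst = P.map X :=
      Measure.map_map measurable_fst hXY
    rw [← e] at hatoms
    exact ae_of_ae_map measurable_fst.aemeasurable hatoms
  have hglue : ∀ᵐ r ∂P.map (fun ω => ((X ω, Y ω), Z ω)),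
      GlueRegular θ q u r.1.1 r.1.2 r.2 := by
    rw [← compProd_map_condDistrib h.measurable_Z.aemeasurable]
    refine Measure.ae_compProd_of_ae_ae (measurableSet_setOfPred.2 (measurable_glueRegular
      (measurable_fst.comp measurable_fst) (measurable_snd.comp measurable_fst)
      measurable_snd)) ?_
    filter_upwards [hatoms', hcuts, h.law_Z] with p hx hy hZ
    have hR : IsGlueLaw θ p.1 p.2 (condDistrib Z (fun ω => (X ω, Y ω)) P p) := ⟨hZ.1, hZ.2⟩
    filter_upwards [hR.ae_mem,
      hR.ae_climb_le hθ hq hx.mass hy.strictMono hy.nonneg hy.gap hy.count,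
      hR.ae_isAttached hθ hq hu hx.mass hy.strictMono hy.tendsto hy.card] with z h1 h2 h3
    exact ⟨h1, h2, h3⟩
  filter_upwards [ae_of_ae_map hXY.aemeasurable hcuts,
    ae_of_ae_map (hXY.prodMk h.measurable_Z).aemeasurable hglue] with ω h1 h2 using ⟨h1, h2⟩

/-- The tree is compact exactly when the tails of the series are finite. -/
theorem IsICRTData.ae_compactSpace_iff (h : IsICRTData P θ X Y Z) (hθ : IsParameter θ)
    (hq : IsDyadicQuantile θ q) (hu : IsWindowScale θ q u) :
    (∀ᵐ ω ∂P, ∃ h : IsStickData (Y ω) (Z ω), CompactSpace (SB h)) ↔ tailSum q 0 < ∞ := by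
  have hreg := h.ae_regular hθ hq hu
  constructor
  · intro hc
    obtain ⟨ω, ⟨hd, hcomp⟩, hy, hz⟩ := (hc.and hreg).exists
    obtain ⟨k, hk, -⟩ := (hz.hausdorffEDist_bounds hy hθ hq hu hd).exists
    rw [← tailSum_lt_top_iff q k]
    refine lt_top_iff_ne_top.2 fun htop => hausdorffEDist_ne_top hd (hq k).1 ?_
    rw [htop, ENNReal.mul_top (by simp), top_le_iff] at hk
    exact hk
  · intro htail
    filter_upwards [hreg] with ω hω
    have hd := hω.2.isStickData hω.1
    refine ⟨hd, compactSpace_of_tendsto hd (l := q) ?_⟩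
    have h0 : Tendsto (fun k => ENNReal.ofReal 328 * tailSum q k) atTop (𝓝 0) := by
      have h1 := ENNReal.Tendsto.const_mul (a := ENNReal.ofReal 328) (tendsto_tailSum htail)
        (.inr ENNReal.ofReal_ne_top)
      rwa [mul_zero] at h1
    exact tendsto_of_tendsto_of_tendsto_of_le_of_le' tendsto_const_nhds h0
      (.of_forall fun _ => zero_le)
      ((hω.2.hausdorffEDist_bounds hω.1 hθ hq hu hd).mono fun _ hk => hk.2)

end Data

end

end ICRT

theorem theorem2 :
    ∃ c C : ℝ, 0 < c ∧ 0 < C ∧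
      ∀ {Ω : Type*} [MeasurableSpace Ω] (P : Measure Ω) [IsProbabilityMeasure P]
        (θ : ℕ → ℝ) (X Y Z : Ω → ℕ → ℝ), ICRT.IsParameter θ → ICRT.IsICRTData P θ X Y Z →
        ((∀ᵐ ω ∂P, ∃ h : ICRT.IsStickData (Y ω) (Z ω), CompactSpace (ICRT.SB h)) ↔
          ∫⁻ l in Ioi (1 : ℝ), (ENNReal.ofReal l * ICRT.meanMass P θ X l)⁻¹ < ∞) ∧
        ∃ 𝒳 : ℝ → ℝ,
          (∀ l, 0 ≤ l → 0 ≤ 𝒳 l ∧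
            ∀ x, 0 ≤ x → (ICRT.meanMass P θ X x = ENNReal.ofReal l ↔ x = 𝒳 l)) ∧
          ∀ᵐ ω ∂P, ∃ h : ICRT.IsStickData (Y ω) (Z ω), ∀ᶠ k : ℕ in atTop,
            ENNReal.ofReal c *
                (∑' n : {n : ℕ // k < n}, ENNReal.ofReal (Real.log (𝒳 (2 ^ (n : ℕ))) / 2 ^ (n : ℕ)))
              ≤ Metric.hausdorffEDist (ICRT.subtree h (𝒳 (2 ^ k))) univ ∧
            Metric.hausdorffEDist (ICRT.subtree h (𝒳 (2 ^ k))) univ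
              ≤ ENNReal.ofReal C *
                (∑' n : {n : ℕ // k < n},
                  ENNReal.ofReal (Real.log (𝒳 (2 ^ (n : ℕ))) / 2 ^ (n : ℕ))) := by
  refine ⟨1 / 2560, 328, by norm_num, by norm_num, fun {Ω} _ P _ θ X Y Z hθ h => ?_⟩
  have hex : ∀ l : ℝ, 0 ≤ l → ∃ x, 0 ≤ x ∧ ICRT.meanFun θ x = l := fun l hl =>
    ICRT.exists_meanFun_eq hθ hl
  choose! 𝒳 h𝒳0 h𝒳 using hex
  have hq : ICRT.IsDyadicQuantile θ fun n => 𝒳 (2 ^ n) := fun n =>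
    ⟨h𝒳0 _ (by positivity), h𝒳 _ (by positivity)⟩
  obtain ⟨u, hu⟩ := ICRT.exists_isWindowScale hθ hq
  refine ⟨?_, 𝒳, fun l hl => ⟨h𝒳0 l hl, fun x hx => ?_⟩, ?_⟩
  · rw [h.ae_compactSpace_iff hθ hq hu, ← ICRT.lintegral_inv_lt_top_iff hq hθ,
      setLIntegral_congr_fun measurableSet_Ioi fun l hl => ?_]
    rw [h.meanMass_eq hθ (zero_le_one.trans (mem_Ioi.1 hl).le)]
  · rw [h.meanMass_eq hθ hx, ENNReal.ofReal_eq_ofReal_iff (ICRT.meanFun_nonneg hθ hx) hl,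
      ← (ICRT.meanFun_strictMonoOn hθ).injOn.eq_iff (mem_Ici.2 hx) (mem_Ici.2 (h𝒳0 l hl)),
      h𝒳 l hl]
  · filter_upwards [h.ae_regular hθ hq hu] with ω hω
    have hd := hω.2.isStickData hω.1
    exact ⟨hd, hω.2.hausdorffEDist_bounds hω.1 hθ hq hu hd⟩
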